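/- **Setting.** A thinker is a function $f:\{0,1\}^*\to\{0,1\}$. Let $\overline f(x)=[x,f(x)]$ (append the bit $f(x)$), let $f^{\mathrm{e2e},T}(x)$ be the last bit of $\overline f^{\,T}(x)$, and let $f^{\mathrm{CoT},T}(x)=[f^{\mathrm{e2e},1}(x),\dots,f^{\mathrm{e2e},T}(x)]$. For a class $\mathcal F$ of thinkers put $\mathcal F^{\mathrm{e2e},T}=\{f^{\mathrm{e2e},T}:f\in\mathcal F\}$ and $\mathcal L^{\mathrm{CoT},T}(\mathcal F)=\{(x,z)\mapsto \mathbf 1[z\ne f^{\mathrm{CoT},T}(x)]: f\in\mathcal F\}$. For a domain $\mathcal X\subseteq\{0,1\}^*$, VC dimensions are taken over $\mathcal X$ for $\mathcal F^{\mathrm{e2e},T}$, over $\mathcal X\times\{0,1\}^T$ for $\mathcal L^{\mathrm{CoT},T}(\mathcal F)$, and over $\{[x,u]:x\in\mathcal X,\ |u|<T\}$ for $\mathcal F$. Logarithms are natural. **Protocol.** The adversary chooses a distribution $\mathcal D$ on $\mathcal X$ and $h_*\in\mathcal F^{\mathrm{e2e},T}$. The learner receives $(x^{(i)},h_*(x^{(i)}))_{i\le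 m}$ with $x^{(i)}\sim\mathcal D$ i.i.d. Then, in each round, the learner requests CoTs on at most $M_\star$ of the $m$ examples; the adversary, knowing the training inputs, all previous requests and thinkers and the current request, picks a thinker $f\in\mathcal F$ with $f^{\mathrm{e2e},T}= h_*$ on $\mathcal X$ and reveals $f^{\mathrm{CoT},T}(x^{(i)})$ for the requested $i$. In the *relaxed* protocol the thinker of a round is fixed before the request of that round is revealed. **Algorithm** (parameters $K,L,M_\star$; a rule $\mathrm{Cons}$ which, given pairs $(x,z)$ with $z=f^{\mathrm{CoT},T}(x)$ for one $f\in\mathcal F$, returns some $\widehat f\in\mathcal F$ with $\widehat f^{\mathrm{CoT},T}(x)=z$ for all of them). Let $D^{(1)}$ be uniform on $[m]$. For $k=1,\dots,K$: make up to $L$ attempts, each of which draws $M_\star$ indices i.i.d. from $D^{(k)}$, requests their CoTs in one round, applies $\mathrm{Cons}$ to the answers, and computes the error of the result's end-to-end map on the training set weighted by $D^{(k)}$; stop at the first attempt with error at most $1/4$, and let $\widehat f_k$ be the last predictor and $\epsilon_k$ its error. If $\epsilon_k=0$, return $\widehat f_k^{\mathrm{e2e},T}$. Otherwise set $\alpha_k=\frac12\log\frac{1-\epsilon_k}{\epsilon_k}$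 (read as $0$ if $\epsilon_k=1$) and let $D^{(k+1)}_i\propto D^{(k)}_i e^{\alpha_k}$ if $\widehat f_k^{\mathrm{e2e},T}(x^{(i)})\neq h_*(x^{(i)})$, and $\propto D^{(k)}_i e^{-\alpha_k}$ otherwise. After $K$ iterations return $\widehat h(x)=\arg\max_{b\in\{0,1\}}\sum_k\alpha_k\mathbf 1[\widehat f_k^{\mathrm{e2e},T}(x)=b]$ (ties are resolved as $1$). **Theorem.** There is a universal constant $c\in\mathbb N$ such that the following holds. For $v\in\mathbb N$ and $\varepsilon,\delta\in(0,1)$ let $$m_v(\varepsilon,\delta)=c\,\frac{v\,\log\frac2\varepsilon\,\log^2\frac{2v}{\varepsilon}+\log\frac2\delta}{\varepsilon}$$ (the first summand is $0$ if $v=0$), and run the algorithm with $K=\lceil 8\log m\rceil$ and $L=\lceil\log(2K/\delta)\rceil$. 1. For all $\mathcal F$, $\mathcal X$, $T\ge1$ with $v=\mathrm{VCdim}(\mathcal F^{\mathrm{e2e},T})<\infty$, all $\varepsilon,\delta\in(0,1)$, every integer $m\ge m_v(\varepsilon,\delta)$, every rule $\mathrm{Cons}$, and every adversary of the protocol, the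 algorithm with $M_\star=c\,v$ (independent of $\varepsilon$) returns $\widehat h$ with $\Pr_{x\sim\mathcal D}[\widehat h(x)\ne h_*(x)]\le\varepsilon$ with probability at least $1-\delta$ over the training set and the internal randomness. It always uses at most $K L=O(\log m\cdot\log(\log m/\delta))$ rounds (thinkers), and requests at most $M_\star$ CoTs from each of them. 2. (Running time.) Let $(\mathcal F_d)_d$ be a hierarchy with inputs $\mathcal X_d=\{0,1\}^{\le d}$ and a tractable consistency oracle: a program that, given $d$ and $N$ pairs $(w,f(w))$ with $|w|\le n$ from a single $f\in\mathcal F_d$, returns in time $\mathrm{poly}(d,n,N)$ a representation of a member of $\mathcal F_d$ consistent with them, which a second program evaluates on strings of length at most $n$ in time $\mathrm{poly}(d,n,N)$. Let $v(d,T)=\mathrm{VCdim}(\mathcal F_d^{\mathrm{e2e},T})$ over $\mathcal X_d$ be bounded by $\mathrm{poly}(d,T)$. Then, for $m=\lceil m_{v(d,T)}(\varepsilon,\delta)\rceil$ and $M_\star=c\,v(d,T)$, the algorithm that uses this oracle is carried out, with exactly the same joint law of predictor and rounds against every adversary, by one randomized program (given the labelled training set, $d,T,K,L,M_\star$) in time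 $\mathrm{poly}(d,T,1/\varepsilon,\log(1/\delta))$; it returns a representation of $\widehat h$ which is evaluated on any $x\in\mathcal X_d$ within such a time bound. Time is the number of steps in a fixed programming language with bounded loops in which arithmetic is charged by bit length. The same holds with $M_\star=c\,v_{\mathcal L}(d,T)$ if $v_{\mathcal L}(d,T)=\mathrm{VCdim}(\mathcal L^{\mathrm{CoT},T}(\mathcal F_d))$ is also bounded by $\mathrm{poly}(d,T)$. 3. In the relaxed protocol, part 1 holds with the same $m$, $K$, $L$ and with $M_\star=c\cdot\mathrm{VCdim}(\mathcal L^{\mathrm{CoT},T}(\mathcal F))$ whenever this and $\mathrm{VCdim}(\mathcal F^{\mathrm{e2e},T})$ are finite. Moreover, for all $\mathcal F,\mathcal X$ and $T\ge1$, $\mathrm{VCdim}(\mathcal L^{\mathrm{CoT},T}(\mathcal F))\le c\log|\mathcal F|$ if $\mathcal F$ is finite, and $\mathrm{VCdim}(\mathcal L^{\mathrm{CoT},T}(\mathcal F))\le c\,\mathrm{VCdim}(\mathcal F)\log(T+1)$ if $\mathrm{VCdim}(\mathcal F)<\infty$. -/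

import Mathlib

open scoped ENNReal

noncomputable section

namespace CoTBoosting

/-! ### Autoregressive generation -/

/-- Binary strings, the set `{0,1}^*`. -/
abbrev Str := List Bool

/-- A next-token generator (thinker) `{0,1}^* → {0,1}`. -/
abbrev Thinker := Str → Bool

/-- The apply-and-append map `x ↦ [x, f x]`. -/
def extend (f : Thinker) (x : Str) : Str := x ++ [f x]

/-- The end-to-end map: the last bit after `T` apply-and-append steps. -/
def e2e (f : Thinker) (T : ℕ) : Thinker := fun x => ((extend f)^[T] x).getLastD false

/-- The chain of thought `[e2e f 1 x, …, e2e f T x]`. -/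
def cot (f : Thinker) (T : ℕ) (x : Str) : Str := (List.range T).map fun t => e2e f (t + 1) x

/-- The end-to-end class of a base class `F`. -/
def e2eClass (F : Set Thinker) (T : ℕ) : Set Thinker := {h | ∃ f ∈ F, e2e f T = h}

/-- The chain-of-thought loss class: the functions `(x, z) ↦ 1[z ≠ cot f T x]` for `f ∈ F`. -/
def cotLossClass (F : Set Thinker) (T : ℕ) : Set (Str × Str → Bool) :=
  {l | ∃ f ∈ F, l = fun p => decide (p.2 ≠ cot f T p.1)}

/-- The strings on which generators are evaluated when they produce `T` tokens from an input
in `X`: an input followed by fewer than `T` tokens. -/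
def prefixDomain (X : Set Str) (T : ℕ) : Set Str := {w | ∃ x ∈ X, ∃ u : Str, u.length < T ∧ w = x ++ u}

/-- The domain `X × {0,1}^T` of the chain-of-thought loss class. -/
def traceDomain (X : Set Str) (T : ℕ) : Set (Str × Str) := {p | p.1 ∈ X ∧ p.2.length = T}

/-- The input domain `{0,1}^{≤ d}`. -/
def inputsUpTo (d : ℕ) : Set Str := {x | x.length ≤ d}

/-! ### VC dimension -/

/-- `H` realizes every labelling of the finite set `S`. -/
def Shatters {α : Type} (H : Set (α → Bool)) (S : Finset α) : Prop :=
  ∀ g : α → Bool, ∃ h ∈ H, ∀ a ∈ S, h a = g a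

/-- The VC dimension of `H` over the domain `X` (`⊤` when unbounded). -/
def vcDim {α : Type} (H : Set (α → Bool)) (X : Set α) : ℕ∞ :=
  ⨆ (S : Finset α) (_ : (S : Set α) ⊆ X ∧ Shatters H S), (S.card : ℕ∞)

/-! ### Discrete probability -/

/-- The law of `n` independent draws from `D`. -/
def iid {α : Type} (D : PMF α) : (n : ℕ) → PMF (Fin n → α)
  | 0 => PMF.pure Fin.elim0
  | n + 1 => D.bind fun a => (iid D n).bind fun s => PMF.pure (Fin.cons a s)

/-- The distribution proportional to `D i * exp (w i)`. -/
def reweight {m : ℕ} (D : PMF (Fin m)) (w : Fin m → ℝ) : PMF (Fin m) :=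
  PMF.normalize (fun i => D i * ENNReal.ofReal (Real.exp (w i)))
    (by
      intro h
      obtain ⟨i, hi⟩ := D.support_nonempty
      have h0 := ENNReal.tsum_eq_zero.1 h i
      rcases mul_eq_zero.1 h0 with h1 | h1
      · exact ((D.mem_support_iff i).1 hi) h1
      · exact absurd (ENNReal.ofReal_eq_zero.1 h1) (not_le.2 (Real.exp_pos _)))
    (by
      rw [tsum_fintype]
      exact ENNReal.sum_ne_top.2 fun i _ => ENNReal.mul_ne_top (D.apply_ne_top i) ENNReal.ofReal_ne_top)

/-- The end-to-end disagreement error `Pr_{x ∼ D}(h x ≠ hstar x)`. -/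
def risk (D : PMF Str) (hstar h : Thinker) : ℝ≥0∞ := D.toOuterMeasure {x | h x ≠ hstar x}

/-! ### The active and adaptive protocol -/

/-- One round of chain-of-thought collection: the indices of the training examples on which
chains of thought were requested (repetitions allowed), and the thinker that answered. -/
structure Round (m : ℕ) where
  queried : List (Fin m)
  thinker : Thinker

/-- The adversary picks a thinker, knowing the training inputs, the previous rounds
(most recent first) and the current request. -/
abbrev Adversary (m : ℕ) := (Fin m → Str) → List (Round m) → List (Fin m) → Thinker

/-- Every thinker lies in `F` and agrees end-to-end with `hstar` on the domain `X`. -/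
def Adversary.Valid {m : ℕ} (adv : Adversary m) (F : Set Thinker) (X : Set Str) (T : ℕ)
    (hstar : Thinker) : Prop :=
  ∀ xs H S, adv xs H S ∈ F ∧ ∀ x ∈ X, e2e (adv xs H S) T x = hstar x

/-- Relaxed protocol: the thinker is fixed before the current request is revealed. -/
def Adversary.Relaxed {m : ℕ} (adv : Adversary m) : Prop :=
  ∀ xs H S S', adv xs H S = adv xs H S'

/-- Randomized computations that interact with the adversary; the state is the list of rounds
so far, most recent first. -/
abbrev Interaction (m : ℕ) := StateT (List (Round m)) PMF

/-- One round: request the chains of thought on the examples listed in `S`. -/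
def request {m : ℕ} (T : ℕ) (xs : Fin m → Str) (adv : Adversary m) (S : List (Fin m)) :
    Interaction m (List Str) := fun H =>
  PMF.pure (S.map fun i => cot (adv xs H S) T (xs i), ⟨S, adv xs H S⟩ :: H)

/-! ### The boosting algorithm -/

/-- A learning rule on chain-of-thought data `(x, z)`. -/
abbrev CoTRule := List (Str × Str) → Thinker

/-- The rule returns a member of `F` that reproduces all given chains of thought, whenever they
all come from a single member of `F`. -/
def CoTRule.Consistent (rule : CoTRule) (F : Set Thinker) (T : ℕ) : Prop :=
  ∀ S : List (Str × Str), (∃ f ∈ F, ∀ p ∈ S, p.2 = cot f T p.1) →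
    rule S ∈ F ∧ ∀ p ∈ S, p.2 = cot (rule S) T p.1

/-- The data of a run: thinking length `T`, labelled training set, consistent rule, adversary,
and the per-thinker budget `M`. -/
structure Setup (m : ℕ) where
  T : ℕ
  xs : Fin m → Str
  ys : Fin m → Bool
  rule : CoTRule
  adv : Adversary m
  M : ℕ

/-- The end-to-end error of `f` on the weighted training set. -/
def Setup.error {m : ℕ} (s : Setup m) (D : PMF (Fin m)) (f : Thinker) : ℝ :=
  ∑ i, (D i).toReal * if e2e f s.T (s.xs i) ≠ s.ys i then 1 else 0

/-- Draw `M` indices independently from `D`, request the chains of thought on them from one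
thinker, and call the consistent rule on the answers. -/
def Setup.attempt {m : ℕ} (s : Setup m) (D : PMF (Fin m)) : Interaction m Thinker := do
  let sample ← StateT.lift (iid D s.M)
  let S := List.ofFn sample
  let Z ← request s.T s.xs s.adv S
  return s.rule ((S.map s.xs).zip Z)

/-- The inner loop: one attempt, repeated up to `r` more times until the error is at
most `1/4`; the last predictor is kept. -/
def Setup.weakLearn {m : ℕ} (s : Setup m) (D : PMF (Fin m)) : ℕ → Interaction m Thinker
  | 0 => s.attempt D
  | r + 1 => do
    let f ← s.attempt D
    if s.error D f ≤ 1 / 4 then return f else s.weakLearn D r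

/-- The weighted majority vote over end-to-end predictors (ties are broken in favour of `1`). -/
def vote (T : ℕ) (fs : List (ℝ × Thinker)) : Thinker := fun x =>
  decide ((fs.map fun p => if e2e p.2 T x = false then p.1 else 0).sum ≤
    (fs.map fun p => if e2e p.2 T x = true then p.1 else 0).sum)

/-- The outer loop, with `L` inner attempts per iteration, the current distribution `D` on the
training set, and the weighted predictors `fs` found so far. (In the degenerate case of error
exactly `1` the vote weight is read as `0`.) -/
def Setup.boost {m : ℕ} (s : Setup m) (L : ℕ) :
    ℕ → PMF (Fin m) → List (ℝ × Thinker) → Interaction m Thinker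
  | 0, _, fs => return vote s.T fs
  | k + 1, D, fs => do
    let f ← s.weakLearn D (L - 1)
    let err := s.error D f
    if err = 0 then return e2e f s.T
    else
      let a : ℝ := if err = 1 then 0 else 1 / 2 * Real.log ((1 - err) / err)
      s.boost L k (reweight D fun i => if e2e f s.T (s.xs i) ≠ s.ys i then a else -a)
        (fs ++ [(a, f)])

/-- The boosting algorithm with `K` outer iterations and `L` inner attempts: the joint law of the
returned predictor and of the rounds of chain-of-thought collection. -/
def Setup.adaBoost {m : ℕ} [NeZero m] (s : Setup m) (K L : ℕ) : PMF (Thinker × List (Round m)) :=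
  (s.boost L K (PMF.uniformOfFintype (Fin m)) []).run []

/-- `K = 8 log m`, rounded up. -/
def outerIters (m : ℕ) : ℕ := ⌈8 * Real.log m⌉₊

/-- `L = log (2 K / δ)` with `K = 8 log m`, rounded up. -/
def innerIters (m : ℕ) (δ : ℝ) : ℕ := ⌈Real.log (2 * outerIters m / δ)⌉₊

/-- The end-to-end sample size for VC dimension `v`, accuracy `ε` and confidence `1 - δ`. -/
def sampleSize (c v : ℕ) (ε δ : ℝ) : ℝ :=
  c * ((v * Real.log (2 / ε) * Real.log (2 * v / ε) ^ 2 + Real.log (2 / δ)) / ε)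

/-- The whole experiment: draw `m` inputs from `D`, label them by `hstar`, run the algorithm. -/
def experiment (T : ℕ) (D : PMF Str) (hstar : Thinker) (m : ℕ) [NeZero m] (rule : CoTRule)
    (adv : Adversary m) (M : ℕ) (δ : ℝ) : PMF (Thinker × List (Round m)) :=
  (iid D m).bind fun xs =>
    (Setup.mk T xs (fun i => hstar (xs i)) rule adv M).adaBoost (outerIters m) (innerIters m δ)

/-- Error at most `ε` with probability at least `1 - δ`; in every run, at most `K * L` rounds
(thinkers) and at most `M` chains of thought requested in each of them. -/
def Succeeds (T : ℕ) (D : PMF Str) (hstar : Thinker) (m : ℕ) [NeZero m] (rule : CoTRule)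
    (adv : Adversary m) (M : ℕ) (ε δ : ℝ) : Prop :=
  ENNReal.ofReal (1 - δ) ≤ (experiment T D hstar m rule adv M δ).toOuterMeasure
      {o | risk D hstar o.1 ≤ ENNReal.ofReal ε} ∧
    ∀ o ∈ (experiment T D hstar m rule adv M δ).support,
      o.2.length ≤ outerIters m * innerIters m δ ∧ ∀ r ∈ o.2, r.queried.length ≤ M

/-! ### A programming language with a step count

A typed first-order language over bits, natural numbers in binary, pairs and lists. Data is passed
by reference, so structural operations cost one step; arithmetic is charged by the bit lengths of
the operands (their product for multiplication). All loops are bounded. -/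

/-- Data types. -/
inductive Ty where
  | bit : Ty
  | nat : Ty
  | prod : Ty → Ty → Ty
  | list : Ty → Ty

/-- The values of a data type. -/
@[reducible] def Ty.Val : Ty → Type
  | .bit => Bool
  | .nat => ℕ
  | .prod a b => a.Val × b.Val
  | .list a => List a.Val

/-- Values for the variables of a context. -/
@[reducible] def Env : List Ty → Type
  | [] => Unit
  | a :: G => a.Val × Env G

/-- Variables of type `a` in a context, as positions. -/
inductive Var : List Ty → Ty → Type where
  | head {G : List Ty} {a : Ty} : Var (a :: G) a
  | tail {G : List Ty} {a b : Ty} : Var G a → Var (b :: G) a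

/-- The value of a variable. -/
def Var.get : {G : List Ty} → {a : Ty} → Var G a → Env G → a.Val
  | _, _, .head, e => e.1
  | _, _, .tail v, e => v.get e.2

/-- Deterministic programs with free variables in `G` and a result of type `a`. -/
inductive Tm : List Ty → Ty → Type where
  | var {G : List Ty} {a : Ty} (v : Var G a) : Tm G a
  | letIn {G : List Ty} {a b : Ty} (t : Tm G a) (u : Tm (a :: G) b) : Tm G b
  /-- call of a closed subroutine -/
  | call {G : List Ty} {a b : Ty} (p : Tm [a] b) (t : Tm G a) : Tm G b
  | bit {G : List Ty} (b : Bool) : Tm G .bit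
  | num {G : List Ty} (n : ℕ) : Tm G .nat
  | ite {G : List Ty} {a : Ty} (c : Tm G .bit) (t u : Tm G a) : Tm G a
  | add {G : List Ty} (t u : Tm G .nat) : Tm G .nat
  | sub {G : List Ty} (t u : Tm G .nat) : Tm G .nat
  | mul {G : List Ty} (t u : Tm G .nat) : Tm G .nat
  | le {G : List Ty} (t u : Tm G .nat) : Tm G .bit
  | pair {G : List Ty} {a b : Ty} (t : Tm G a) (u : Tm G b) : Tm G (.prod a b)
  | fst {G : List Ty} {a b : Ty} (t : Tm G (.prod a b)) : Tm G a
  | snd {G : List Ty} {a b : Ty} (t : Tm G (.prod a b)) : Tm G b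
  | nil {G : List Ty} {a : Ty} : Tm G (.list a)
  | cons {G : List Ty} {a : Ty} (t : Tm G a) (u : Tm G (.list a)) : Tm G (.list a)
  /-- case distinction on a list: empty, or head and tail -/
  | caseList {G : List Ty} {a b : Ty} (l : Tm G (.list a)) (t : Tm G b)
      (u : Tm (a :: .list a :: G) b) : Tm G b
  /-- repeat `body` `n` times, starting from `init` -/
  | iter {G : List Ty} {a : Ty} (n : Tm G .nat) (init : Tm G a) (body : Tm (a :: G) a) : Tm G a
  /-- left fold over a list; `body` sees the current element, the accumulator, and `G` -/
  | fold {G : List Ty} {a b : Ty} (l : Tm G (.list a)) (init : Tm G b)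
      (body : Tm (a :: b :: G) b) : Tm G b

/-- Evaluation: the result and the number of steps. -/
def Tm.eval : {G : List Ty} → {a : Ty} → Tm G a → Env G → a.Val × ℕ
  | _, _, .var v, e => (v.get e, 1)
  | _, _, .letIn t u, e =>
    let x := t.eval e
    let y := u.eval (x.1, e)
    (y.1, 1 + x.2 + y.2)
  | _, _, .call p t, e =>
    let x := t.eval e
    let y := p.eval (x.1, ())
    (y.1, 1 + x.2 + y.2)
  | _, _, .bit b, _ => (b, 1)
  | _, _, .num n, _ => (n, 1 + n.size)
  | _, _, .ite c t u, e =>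
    let x := c.eval e
    let y := if x.1 then t.eval e else u.eval e
    (y.1, 1 + x.2 + y.2)
  | _, _, .add t u, e =>
    let x := t.eval e
    let y := u.eval e
    (x.1 + y.1, 1 + x.2 + y.2 + (Nat.size x.1 + Nat.size y.1))
  | _, _, .sub t u, e =>
    let x := t.eval e
    let y := u.eval e
    (x.1 - y.1, 1 + x.2 + y.2 + (Nat.size x.1 + Nat.size y.1))
  | _, _, .mul t u, e =>
    let x := t.eval e
    let y := u.eval e
    (x.1 * y.1, 1 + x.2 + y.2 + (Nat.size x.1 + 1) * (Nat.size y.1 + 1))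
  | _, _, .le t u, e =>
    let x := t.eval e
    let y := u.eval e
    (decide (x.1 ≤ y.1), 1 + x.2 + y.2 + (Nat.size x.1 + Nat.size y.1))
  | _, _, .pair t u, e =>
    let x := t.eval e
    let y := u.eval e
    ((x.1, y.1), 1 + x.2 + y.2)
  | _, _, .fst t, e =>
    let x := t.eval e
    (x.1.1, 1 + x.2)
  | _, _, .snd t, e =>
    let x := t.eval e
    (x.1.2, 1 + x.2)
  | _, _, .nil, _ => ([], 1)
  | _, _, .cons t u, e =>
    let x := t.eval e
    let y := u.eval e
    (x.1 :: y.1, 1 + x.2 + y.2)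
  | _, _, .caseList l t u, e =>
    let x := l.eval e
    let y := match x.1 with
      | [] => t.eval e
      | h :: r => u.eval (h, r, e)
    (y.1, 1 + x.2 + y.2)
  | _, _, .iter n init body, e =>
    let k := n.eval e
    let x := init.eval e
    (fun s => let y := body.eval (s.1, e); (y.1, s.2 + 1 + y.2))^[k.1] (x.1, 1 + k.2 + x.2)
  | _, _, .fold l init body, e =>
    let k := l.eval e
    let x := init.eval e
    k.1.foldl (fun s h => let y := body.eval (h, s.1, e); (y.1, s.2 + 1 + y.2))
      (x.1, 1 + k.2 + x.2)

/-- The output of a program with one input. -/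
def Tm.out {a b : Ty} (p : Tm [a] b) (x : a.Val) : b.Val := (p.eval (x, ())).1

/-- The number of steps of a program with one input. -/
def Tm.time {a b : Ty} (p : Tm [a] b) (x : a.Val) : ℕ := (p.eval (x, ())).2

/-- The type of bit strings. -/
abbrev Ty.str : Ty := .list .bit

/-- Randomized interactive programs: deterministic computation, uniformly random numbers, and
rounds of the protocol. -/
inductive Cmd : List Ty → Ty → Type where
  | ret {G : List Ty} {a : Ty} (t : Tm G a) : Cmd G a
  | bind {G : List Ty} {a b : Ty} (c : Cmd G a) (k : Cmd (a :: G) b) : Cmd G b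
  /-- a uniformly random number below `n` -/
  | rand {G : List Ty} (n : Tm G .nat) : Cmd G .nat
  /-- one round of the protocol, on the given list of indices of training examples -/
  | query {G : List Ty} (l : Tm G (.list .nat)) : Cmd G (.list .str)
  | ite {G : List Ty} {a : Ty} (t : Tm G .bit) (c k : Cmd G a) : Cmd G a
  /-- repeat `body` `n` times, starting from `init` -/
  | iter {G : List Ty} {a : Ty} (n : Tm G .nat) (init : Tm G a) (body : Cmd (a :: G) a) : Cmd G a

/-- The state of an interactive computation: steps taken and rounds so far. -/
structure Trace (m : ℕ) where
  steps : ℕ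
  rounds : List (Round m)

/-- Spend `n` steps. -/
def tick {m : ℕ} (n : ℕ) : StateT (Trace m) PMF Unit :=
  modify fun s => { s with steps := s.steps + n }

/-- Run a deterministic program, spending its steps. -/
def Tm.run {m : ℕ} {G : List Ty} {a : Ty} (t : Tm G a) (e : Env G) : StateT (Trace m) PMF a.Val := do
  tick (t.eval e).2
  return (t.eval e).1

/-- The uniform distribution on `{0, …, n - 1}` (the number `0` when `n = 0`). -/
def uniformBelow : ℕ → PMF ℕ
  | 0 => PMF.pure 0
  | n + 1 => (PMF.uniformOfFintype (Fin (n + 1))).map Fin.val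

/-- `n`-fold repetition of a randomized computation. -/
def repeatM {m : ℕ} {β : Type} (f : β → StateT (Trace m) PMF β) : ℕ → β → StateT (Trace m) PMF β
  | 0, x => return x
  | n + 1, x => do repeatM f n (← f x)

/-- Execution against the adversary. Indices out of range are ignored in a request; reading the
answer to a request is charged by its total length. -/
def Cmd.exec {m : ℕ} (T : ℕ) (xs : Fin m → Str) (adv : Adversary m) :
    {G : List Ty} → {a : Ty} → Cmd G a → Env G → StateT (Trace m) PMF a.Val
  | _, _, .ret t, e => t.run e
  | _, _, .bind c k, e => do
    let x ← c.exec T xs adv e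
    tick 1
    k.exec T xs adv (x, e)
  | _, _, .rand t, e => do
    let n ← t.run e
    tick (1 + Nat.size n)
    StateT.lift (uniformBelow n)
  | _, _, .query t, e => do
    let l : List ℕ ← t.run e
    let S : List (Fin m) := l.filterMap fun i => if h : i < m then some ⟨i, h⟩ else none
    tick (1 + l.length + T * S.length)
    fun s => do
      let o ← (request T xs adv S).run s.rounds
      return (o.1, { s with rounds := o.2 })
  | _, _, .ite t c k, e => do
    let b ← t.run e
    tick 1
    if b then c.exec T xs adv e else k.exec T xs adv e
  | _, _, .iter n init body, e => do
    let k ← n.run e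
    let x ← init.run e
    repeatM (fun y => do tick 1; body.exec T xs adv (y, e)) k x

/-! ### Tractable consistency oracles and polynomial running time -/

/-- A tractable consistency oracle for a hierarchy `F`: a program `find` that, given `d` and finitely
many sequence / next-token pairs produced by a single member of `F d`, returns a representation of a
consistent member of `F d`, together with a program `next` that evaluates representations; the time
is polynomial in `d`, the sequence lengths and the number of pairs. -/
structure ConsistencyOracle (F : ℕ → Set Thinker) where
  code : Ty
  find : Tm [.prod (.list (.prod .str .bit)) .nat] code
  next : Tm [.prod code .str] .bit
  degree : ℕ
  mem : ∀ (d : ℕ) (S : List (Str × Bool)), (∃ f ∈ F d, ∀ p ∈ S, f p.1 = p.2) →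
    (fun x => next.out (find.out (S, d), x)) ∈ F d
  consistent : ∀ (d : ℕ) (S : List (Str × Bool)), (∃ f ∈ F d, ∀ p ∈ S, f p.1 = p.2) →
    ∀ p ∈ S, next.out (find.out (S, d), p.1) = p.2
  find_time : ∀ (d n : ℕ) (S : List (Str × Bool)), (∃ f ∈ F d, ∀ p ∈ S, f p.1 = p.2) →
    (∀ p ∈ S, p.1.length ≤ n) →
    find.time (S, d) ≤ degree * (1 + d + n + S.length) ^ degree
  next_time : ∀ (d n : ℕ) (S : List (Str × Bool)), (∃ f ∈ F d, ∀ p ∈ S, f p.1 = p.2) →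
    (∀ p ∈ S, p.1.length ≤ n) → ∀ x : Str, x.length ≤ n →
    next.time (find.out (S, d), x) ≤ degree * (1 + d + n + S.length) ^ degree

/-- All prefix / next-token pairs of chains of thought of length `T`. -/
def nextTokenPairs (T : ℕ) (S : List (Str × Str)) : List (Str × Bool) :=
  S.flatMap fun p => (List.range T).map fun t => (p.1 ++ p.2.take t, p.2.getD t false)

/-- The consistent rule on chains of thought that is obtained from a consistency oracle. -/
def ConsistencyOracle.rule {F : ℕ → Set Thinker} (O : ConsistencyOracle F) (d T : ℕ) : CoTRule :=
  fun S x => O.next.out (O.find.out (nextTokenPairs T S, d), x)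

/-- `g d T` is bounded by a polynomial in `d` and `T`. -/
def PolyBounded (g : ℕ → ℕ → ℕ) : Prop :=
  ∃ C : ℕ, ∀ d T, 1 ≤ T → g d T ≤ C * (1 + d + T) ^ C

/-- The input of the learner: labelled training set, `d`, `T`, `K`, `L`, `M`. -/
abbrev learnerInput : Ty :=
  .prod (.list (.prod .str .bit)) (.prod .nat (.prod .nat (.prod .nat (.prod .nat .nat))))

/-- The boosting algorithm, with the consistent rule of the oracle `O`, end-to-end sample size
`⌈sampleSize c (vc d T) ε δ⌉` and per-thinker budget `budget d T`, is carried out by one program in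
time polynomial in `d`, `T`, `1/ε` and `log (1/δ)`: for every adversary, the returned predictor and
the rounds have exactly the joint law of the algorithm. The program returns a representation of the
predictor, which a second program evaluates on inputs in polynomial time. -/
def RunsInPolyTime (c : ℕ) {F : ℕ → Set Thinker} (O : ConsistencyOracle F)
    (vc budget : ℕ → ℕ → ℕ) : Prop :=
  ∃ (rep : Ty) (learn : Cmd [learnerInput] rep) (predict : Tm [.prod rep .str] .bit) (C : ℕ),
    ∀ (d T : ℕ), 1 ≤ T → ∀ (ε δ : ℝ), 0 < ε → ε < 1 → 0 < δ → δ < 1 →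
    ∀ (m : ℕ) [NeZero m], m = ⌈sampleSize c (vc d T) ε δ⌉₊ →
    ∀ hstar ∈ e2eClass (F d) T, ∀ xs : Fin m → Str, (∀ i, xs i ∈ inputsUpTo d) →
    ∀ adv : Adversary m, adv.Valid (F d) (inputsUpTo d) T hstar →
    ∀ run : PMF (rep.Val × Trace m),
      run = (learn.exec T xs adv
        ((List.ofFn fun i => (xs i, hstar (xs i)), d, T, outerIters m, innerIters m δ, budget d T),
          ())).run ⟨0, []⟩ →
      run.map (fun o => ((fun x => predict.out (o.1, x) : Thinker), o.2.rounds)) =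
          (Setup.mk T xs (fun i => hstar (xs i)) (O.rule d T) adv (budget d T)).adaBoost
            (outerIters m) (innerIters m δ) ∧
        ∀ o ∈ run.support,
          (o.2.steps : ℝ) ≤ C * (1 + d + T + 1 / ε + Real.log (1 / δ)) ^ C ∧
          ∀ x ∈ inputsUpTo d,
            (predict.time (o.1, x) : ℝ) ≤ C * (1 + d + T + 1 / ε + Real.log (1 / δ)) ^ C

end CoTBoosting

end

noncomputable section

namespace CoTBoosting

/-! ### Independent draws -/

/-! Weak learning. The adversary may pick its thinker after seeing the request, but all answers of a
round come from one thinker whose end-to-end map is `hstar` on the domain. A predictor that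
reproduces these answers is therefore end-to-end correct on the requested examples, whichever
thinker was picked. Uniform convergence over the end-to-end class then gives weighted error at most
1/4 with probability at least 1 - 1/e from a number of draws proportional to the VC dimension, with
no dependence on ε or m (`weak_uniform_convergence`, `weaklyLearns_of_vcDim`). In the relaxed
protocol the thinker is fixed before the draw, so the answers label an i.i.d. sample by one fixed
chain-of-thought map, and the loss class can replace the end-to-end class
(`weaklyLearns_of_relaxed`).

Boosting. All L attempts of an iteration fail with probability at most e^(-L), and a union bound
runs over the K iterations. Each successful iteration multiplies the average of exp(-margin) over
the training set by 2√(ε_k(1-ε_k)) ≤ √(3/4). After 8 log m iterations this average is below 1/m, so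
every training example has positive margin (`Setup.WeaklyLearns.boost`, `adaBoost_fail_le`).

Generalization. In every run the returned predictor is a weighted vote of at most K members of the
end-to-end class (`support_boost`). Such votes have at most (N+1)^(K(v+1)) traces on N points
(`card_traces_voteClass_le`), by Sauer–Shelah for the voters and a dimension count for the weights.
Double sampling (`uniform_convergence`) bounds the probability that any vote fits the sample yet
errs by more than ε; `numerics` checks that the sample size suffices, and `succeeds` adds the two
failure probabilities.

Running time. The real weights of boosting can be replaced exactly by natural numbers. If the total
weight is W and the misclassified weight is E, scaling the factors exp(±α) by √(E(W-E)) turns them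
into W-E and E (`hasWeights_step`), and the vote becomes a comparison of two products
(`vote_voters`). The total weight at most squares in each iteration, so it stays below m^(2^K); as
2^K is polynomial in m (`two_pow_outerIters_le`), bit lengths are polynomial. `Ev` tracks values and
costs of deterministic terms, `Sim` the exact joint law and cost of interactive commands;
`sim_boost` and `learnCmd_spec` combine them for the learner, and `runsInPolyTime` concludes.

Loss class. Whether z is the chain of thought of x under f depends only on the values of f at the T
strings obtained from x and a proper prefix of z. So n shattered pairs involve at most nT strings,
and Sauer–Shelah gives 2^n ≤ (e n T / v)^v (`exists_vcDim_cotLossClass`). For a finite class,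
counting is enough. -/

theorem ite_cons_eq {α : Type} {n : ℕ} (a : α) (t : Fin n → α) (s : Fin (n + 1) → α) :
    (s = Fin.cons a t) ↔ (s 0 = a ∧ Fin.tail s = t) := by
  constructor
  · rintro rfl; simp
  · rintro ⟨rfl, rfl⟩; simp

theorem iid_apply {α : Type} (D : PMF α) : ∀ (n : ℕ) (s : Fin n → α), iid D n s = ∏ i, D (s i)
  | 0, s => by
    have : s = Fin.elim0 := Subsingleton.elim _ _
    simp [iid, PMF.pure_apply, this]
  | n + 1, s => by
    classical
    rw [Fin.prod_univ_succ, iid, PMF.bind_apply, tsum_eq_single (s 0)]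
    · rw [PMF.bind_apply, tsum_eq_single (Fin.tail s)]
      · rw [iid_apply D n]
        simp [Fin.tail]
      · intro t ht
        rw [PMF.pure_apply, if_neg, mul_zero]
        rw [ite_cons_eq]
        exact fun h => ht h.2.symm
    · intro a ha
      rw [PMF.bind_apply, ENNReal.tsum_eq_zero.2, mul_zero]
      intro t
      rw [PMF.pure_apply, if_neg, mul_zero]
      rw [ite_cons_eq]
      exact fun h => ha h.1.symm

/-- Here `φ` need not have total mass one: applied to a discounted law it computes an exponential
moment of an i.i.d. sample. -/
theorem tsum_prod_pi {α : Type} (φ : α → ℝ≥0∞) :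
    ∀ n : ℕ, ∑' s : Fin n → α, ∏ i, φ (s i) = (∑' a, φ a) ^ n
  | 0 => by simp [tsum_fintype]
  | n + 1 => by
    rw [← (Fin.consEquiv fun _ : Fin (n + 1) => α).tsum_eq, ENNReal.tsum_prod']
    simp only [Fin.consEquiv_apply, Fin.prod_univ_succ, Fin.cons_zero, Fin.cons_succ]
    simp_rw [ENNReal.tsum_mul_left, tsum_prod_pi φ n, ENNReal.tsum_mul_right]
    rw [pow_succ, mul_comm]

theorem support_iid {α : Type} (D : PMF α) {n : ℕ} {s : Fin n → α} (hs : s ∈ (iid D n).support)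
    (i : Fin n) : s i ∈ D.support := by
  rw [PMF.mem_support_iff, iid_apply] at hs
  exact (PMF.mem_support_iff _ _).2 fun h => hs (Finset.prod_eq_zero (Finset.mem_univ i) h)

/-- Few successes in `n` independent trials of success probability at least `p` are unlikely. -/
theorem iid_lower_tail {α : Type} (D : PMF α) (e : α → Bool) (n k : ℕ) (p : ℝ)
    (hp : ENNReal.ofReal p ≤ D.toOuterMeasure {a | e a = true}) :
    (iid D n).toOuterMeasure {s | (Finset.univ.filter fun i => e (s i) = true).card < k} ≤
      2 ^ k * ENNReal.ofReal (1 - p / 2) ^ n := by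
  classical
  -- Exponential Markov inequality: each success is discounted by 1/2, and fewer than `k` successes
  -- leave a discount of at least `2⁻ᵏ`.
  set φ : α → ℝ≥0∞ := fun a => D a * if e a = true then 2⁻¹ else 1 with hφ
  have h1 : ∑' a, φ a ≤ ENNReal.ofReal (1 - p / 2) := by
    have hsum : ∑' a, φ a + 2⁻¹ * D.toOuterMeasure {a | e a = true} = 1 := by
      rw [PMF.toOuterMeasure_apply, ← ENNReal.tsum_mul_left, ← ENNReal.tsum_add, ← D.tsum_coe]
      refine tsum_congr fun a => ?_
      by_cases h : e a = true
      · simp only [hφ, h, if_true, Set.indicator, Set.mem_ofPred_eq]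
        rw [mul_comm, ← add_mul, ENNReal.inv_two_add_inv_two, one_mul]
      · simp [hφ, h]
    have h2 : ENNReal.ofReal (p / 2) ≤ 2⁻¹ * D.toOuterMeasure {a | e a = true} := by
      rw [div_eq_inv_mul, ENNReal.ofReal_mul (by norm_num), ENNReal.ofReal_inv_of_pos (by norm_num)]
      simp only [ENNReal.ofReal_ofNat]
      gcongr
    by_cases hp0 : 0 ≤ p
    · rw [ENNReal.ofReal_sub _ (by linarith), ENNReal.ofReal_one]
      refine ENNReal.le_sub_of_add_le_right ENNReal.ofReal_ne_top ?_
      calc _ ≤ _ := by gcongr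
        _ = 1 := hsum
    · calc ∑' a, φ a ≤ 1 := hsum ▸ le_self_add
        _ = ENNReal.ofReal 1 := by simp
        _ ≤ _ := ENNReal.ofReal_le_ofReal (by linarith)
  rw [PMF.toOuterMeasure_apply]
  calc _ ≤ ∑' s : Fin n → α, 2 ^ k * ∏ i, φ (s i) := by
        refine ENNReal.tsum_le_tsum fun s => ?_
        rw [Set.indicator_apply]
        split_ifs with hs
        · rw [iid_apply, Finset.prod_mul_distrib, Finset.prod_ite, Finset.prod_const,
            Finset.prod_const_one, mul_one, mul_comm, mul_assoc]
          refine le_mul_of_one_le_right' ?_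
          have hs' : (Finset.univ.filter fun i => e (s i) = true).card < k := hs
          rw [← ENNReal.inv_pow, mul_comm, ← div_eq_mul_inv,
            ENNReal.le_div_iff_mul_le (by simp) (by simp), one_mul]
          exact pow_le_pow_right₀ (by norm_num) hs'.le
        · exact zero_le
    _ = 2 ^ k * (∑' a, φ a) ^ n := by rw [ENNReal.tsum_mul_left, tsum_prod_pi]
    _ ≤ _ := by gcongr

/-! ### Traces of a class on a finite set -/

/-- The sets cut out of `U` by members of `H`. -/
def traces {α : Type} (H : Set (α → Bool)) (U : Finset α) : Finset (Finset α) :=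
  open Classical in U.powerset.filter fun t => ∃ h ∈ H, t = U.filter fun a => h a = true

theorem mem_traces {α : Type} {H : Set (α → Bool)} {U t : Finset α} :
    t ∈ traces H U ↔ ∃ h ∈ H, t = U.filter fun a => h a = true := by
  classical
  simp only [traces, Finset.mem_filter, Finset.mem_powerset]
  constructor
  · exact fun h => h.2
  · rintro ⟨h, hH, rfl⟩
    exact ⟨Finset.filter_subset _ _, h, hH, rfl⟩

/-! ### Uniform convergence by double sampling -/

/-- Exchange the two samples at the coordinates selected by `σ`. -/
def swapEquiv {α : Type} {n : ℕ} (σ : Fin n → Bool) :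
    ((Fin n → α) × (Fin n → α)) ≃ ((Fin n → α) × (Fin n → α)) where
  toFun p := (fun i => if σ i then p.2 i else p.1 i, fun i => if σ i then p.1 i else p.2 i)
  invFun p := (fun i => if σ i then p.2 i else p.1 i, fun i => if σ i then p.1 i else p.2 i)
  left_inv p := by ext i <;> simp <;> split_ifs <;> rfl
  right_inv p := by ext i <;> simp <;> split_ifs <;> rfl

/-- The joint law of two samples is a product over coordinates, each factor symmetric in its two
entries. -/
theorem weight_swapEquiv {α : Type} {n : ℕ} (D : PMF α) (σ : Fin n → Bool)
    (p : (Fin n → α) × (Fin n → α)) :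
    iid D n (swapEquiv σ p).1 * iid D n (swapEquiv σ p).2 = iid D n p.1 * iid D n p.2 := by
  simp only [iid_apply, ← Finset.prod_mul_distrib]
  refine Finset.prod_congr rfl fun i _ => ?_
  simp only [swapEquiv, Equiv.coe_fn_mk]
  split_ifs
  · exact mul_comm _ _
  · rfl

/-- Few exchanges put all errors of a fixed function into the second sample. -/
theorem card_swaps_le {α : Type} {n k : ℕ} (e : α → Bool) (p : (Fin n → α) × (Fin n → α)) :
    (Finset.univ.filter fun σ : Fin n → Bool => (∀ i, e ((swapEquiv σ p).1 i) = false) ∧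
      k ≤ (Finset.univ.filter fun i => e ((swapEquiv σ p).2 i) = true).card).card * 2 ^ k ≤ 2 ^ n := by
  classical
  set J : Finset (Fin n) := Finset.univ.filter fun i => e (p.1 i) = true ∨ e (p.2 i) = true with hJ
  set A := Finset.univ.filter fun σ : Fin n → Bool => (∀ i, e ((swapEquiv σ p).1 i) = false) ∧
      k ≤ (Finset.univ.filter fun i => e ((swapEquiv σ p).2 i) = true).card with hA
  by_cases hk : k ≤ J.card
  -- At a coordinate carrying an error the swap is forced: the error has to leave the first sample,
  -- so `σ i` must equal `e (p.1 i)`. Only coordinates outside `J` stay free.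
  · have hsub : A ⊆ Fintype.piFinset fun i => if i ∈ J then {e (p.1 i)} else Finset.univ := by
      intro σ hσ
      simp only [hA, Finset.mem_filter, Finset.mem_univ, true_and] at hσ
      rw [Fintype.mem_piFinset]
      intro i
      split_ifs with hi
      · have h1 := hσ.1 i
        simp only [swapEquiv, Equiv.coe_fn_mk] at h1
        simp only [hJ, Finset.mem_filter, Finset.mem_univ, true_and] at hi
        rw [Finset.mem_singleton]
        cases hs : σ i <;> simp [hs] at h1 <;> simp_all
      · exact Finset.mem_univ _
    have hcard := Finset.card_le_card hsub
    rw [Fintype.card_piFinset] at hcard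
    have hprod : ∏ i, (if i ∈ J then ({e (p.1 i)} : Finset Bool) else Finset.univ).card
        = 2 ^ (n - J.card) := by
      have : ∀ i, (if i ∈ J then ({e (p.1 i)} : Finset Bool) else Finset.univ).card
          = if i ∈ J then 1 else 2 := by
        intro i; split_ifs <;> simp
      simp_rw [this]
      rw [Finset.prod_ite, Finset.prod_const_one, one_mul, Finset.prod_const]
      congr 1
      rw [Finset.filter_not, Finset.card_sdiff_of_subset (Finset.filter_subset _ _)]
      simp
    rw [hprod] at hcard
    have hJn : J.card ≤ n := by simpa using Finset.card_le_univ J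
    calc A.card * 2 ^ k ≤ 2 ^ (n - J.card) * 2 ^ J.card := by gcongr; norm_num
      _ = 2 ^ n := by rw [← pow_add]; congr 1; omega
  -- Errors in the second sample sit at coordinates of `J`, so fewer than `k` such coordinates rule
  -- out every swap.
  · have : A = ∅ := by
      rw [Finset.eq_empty_iff_forall_notMem]
      intro σ hσ
      simp only [hA, Finset.mem_filter, Finset.mem_univ, true_and] at hσ
      apply hk
      refine hσ.2.trans (Finset.card_le_card ?_)
      intro i
      simp only [hJ, swapEquiv, Equiv.coe_fn_mk, Finset.mem_filter_univ]
      intro h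
      have h := (Finset.mem_filter.1 h).2
      split_ifs at h <;> tauto
    simp [this]

/-- The event of the second stage of double sampling. -/
def SplitEvent {α : Type} (H : Set (α → Bool)) (g : α → Bool) {n : ℕ} (k : ℕ)
    (p : (Fin n → α) × (Fin n → α)) : Prop :=
  ∃ h ∈ H, (∀ i, h (p.1 i) = g (p.1 i)) ∧
    k ≤ (Finset.univ.filter fun i => h (p.2 i) ≠ g (p.2 i)).card

open Classical in
-- On the two samples a hypothesis acts only through its trace on their union, so `card_swaps_le` is
-- summed over the traces instead of over `H`.
theorem card_splitEvent_le {α : Type} (H : Set (α → Bool)) (g : α → Bool) {n : ℕ} (k : ℕ) (G : ℕ)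
    (p : (Fin n → α) × (Fin n → α))
    (hG : (traces H (Finset.univ.image p.1 ∪ Finset.univ.image p.2)).card ≤ G) :
    (Finset.univ.filter fun σ : Fin n → Bool => SplitEvent H g k (swapEquiv σ p)).card * 2 ^ k
      ≤ G * 2 ^ n := by
  set U := Finset.univ.image p.1 ∪ Finset.univ.image p.2 with hU
  set er : Finset α → α → Bool := fun t a => decide ((decide (a ∈ t)) ≠ g a) with her
  have h1 : ∀ i, p.1 i ∈ U := fun i =>
    Finset.mem_union_left _ (Finset.mem_image_of_mem _ (Finset.mem_univ i))
  have h2 : ∀ i, p.2 i ∈ U := fun i =>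
    Finset.mem_union_right _ (Finset.mem_image_of_mem _ (Finset.mem_univ i))
  have hsub : (Finset.univ.filter fun σ : Fin n → Bool => SplitEvent H g k (swapEquiv σ p)) ⊆
      (traces H U).biUnion fun t => Finset.univ.filter fun σ : Fin n → Bool =>
        (∀ i, er t ((swapEquiv σ p).1 i) = false) ∧
          k ≤ (Finset.univ.filter fun i => er t ((swapEquiv σ p).2 i) = true).card := by
    intro σ hσ
    simp only [Finset.mem_filter, Finset.mem_univ, true_and] at hσ
    obtain ⟨h, hH, hc, hk⟩ := hσ
    rw [Finset.mem_biUnion]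
    refine ⟨U.filter fun a => h a = true, mem_traces.2 ⟨h, hH, rfl⟩, ?_⟩
    have hm1 : ∀ i, (swapEquiv σ p).1 i ∈ U := by
      intro i; simp only [swapEquiv, Equiv.coe_fn_mk]; split_ifs; exacts [h2 i, h1 i]
    have hm2 : ∀ i, (swapEquiv σ p).2 i ∈ U := by
      intro i; simp only [swapEquiv, Equiv.coe_fn_mk]; split_ifs; exacts [h1 i, h2 i]
    simp only [Finset.mem_filter, Finset.mem_univ, true_and, her, decide_eq_false_iff_not,
      decide_eq_true_eq, hm1, hm2, Bool.decide_eq_true, not_not]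
    exact ⟨hc, hk⟩
  calc _ ≤ (∑ t ∈ traces H U, (Finset.univ.filter fun σ : Fin n → Bool =>
        (∀ i, er t ((swapEquiv σ p).1 i) = false) ∧
          k ≤ (Finset.univ.filter fun i => er t ((swapEquiv σ p).2 i) = true).card).card) * 2 ^ k := by
        gcongr
        exact (Finset.card_le_card hsub).trans Finset.card_biUnion_le
    _ ≤ ∑ t ∈ traces H U, 2 ^ n := by
        rw [Finset.sum_mul]
        exact Finset.sum_le_sum fun t _ => card_swaps_le _ _
    _ ≤ _ := by
        rw [Finset.sum_const, smul_eq_mul]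
        gcongr

open Classical in
-- Swapping preserves the law of the pair, so the probability equals its average over all `2 ^ n`
-- swaps, and for a fixed pair few swaps are bad.
theorem splitEvent_prob_le {α : Type} (D : PMF α) (H : Set (α → Bool)) (g : α → Bool) (n k G : ℕ)
    (hG : ∀ U : Finset α, (U : Set α) ⊆ D.support → U.card ≤ 2 * n → (traces H U).card ≤ G) :
    (∑' p : (Fin n → α) × (Fin n → α), iid D n p.1 * iid D n p.2 *
      if SplitEvent H g k p then 1 else 0) * 2 ^ k ≤ G := by
  set P := ∑' p : (Fin n → α) × (Fin n → α), iid D n p.1 * iid D n p.2 *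
      if SplitEvent H g k p then 1 else 0 with hP
  have hσ : ∀ σ : Fin n → Bool, P = ∑' p : (Fin n → α) × (Fin n → α),
      iid D n p.1 * iid D n p.2 * if SplitEvent H g k (swapEquiv σ p) then 1 else 0 := by
    intro σ
    rw [hP, ← (swapEquiv σ).tsum_eq]
    refine tsum_congr fun p => ?_
    rw [weight_swapEquiv]
  have hone : ∑' p : (Fin n → α) × (Fin n → α), iid D n p.1 * iid D n p.2 = 1 := by
    rw [ENNReal.tsum_prod']
    simp_rw [ENNReal.tsum_mul_left, PMF.tsum_coe, mul_one, PMF.tsum_coe]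
  have hmain : (2 ^ n * P) * 2 ^ k ≤ G * 2 ^ n := by
    calc (2 ^ n * P) * 2 ^ k = (∑ σ : Fin n → Bool, P) * 2 ^ k := by simp
      _ = (∑ σ : Fin n → Bool, ∑' p : (Fin n → α) × (Fin n → α), iid D n p.1 * iid D n p.2 *
            if SplitEvent H g k (swapEquiv σ p) then 1 else 0) * 2 ^ k := by
          rw [Finset.sum_congr rfl fun σ _ => hσ σ]
      _ = ∑' p : (Fin n → α) × (Fin n → α), iid D n p.1 * iid D n p.2 *
            (((Finset.univ.filter fun σ : Fin n → Bool =>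
              SplitEvent H g k (swapEquiv σ p)).card * 2 ^ k : ℕ) : ℝ≥0∞) := by
          rw [← Summable.tsum_finsetSum fun _ _ => ENNReal.summable, ← ENNReal.tsum_mul_right]
          refine tsum_congr fun p => ?_
          rw [← Finset.mul_sum, Finset.sum_boole, mul_assoc]
          push_cast; rfl
      _ ≤ ∑' p : (Fin n → α) × (Fin n → α), iid D n p.1 * iid D n p.2 *
            ((G * 2 ^ n : ℕ) : ℝ≥0∞) := by
          refine ENNReal.tsum_le_tsum fun p => ?_
          -- Pairs of probability zero contribute nothing; the points of all other pairs lie in the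
          -- support, where the growth bound is available.
          by_cases h0 : iid D n p.1 * iid D n p.2 = 0
          · simp [h0]
          obtain ⟨ha, hb⟩ := mul_ne_zero_iff.1 h0
          refine mul_le_mul_right (Nat.cast_le.2 ?_) _
          refine card_splitEvent_le H g k G p (hG _ ?_ ?_)
          · intro a ha'
            simp only [Finset.coe_union, Finset.coe_image, Finset.coe_univ, Set.image_univ,
              Set.mem_union, Set.mem_range] at ha'
            rcases ha' with ⟨i, rfl⟩ | ⟨i, rfl⟩
            · exact support_iid D ha i
            · exact support_iid D hb i
          · refine (Finset.card_union_le _ _).trans ?_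
            have e1 := Finset.card_image_le (s := Finset.univ) (f := p.1)
            have e2 := Finset.card_image_le (s := Finset.univ) (f := p.2)
            simp only [Finset.card_univ, Fintype.card_fin] at e1 e2
            omega
      _ = G * 2 ^ n := by rw [ENNReal.tsum_mul_right, hone]; simp
  have h2 : (2 : ℝ≥0∞) ^ n ≠ 0 := by simp
  have h2' : (2 : ℝ≥0∞) ^ n ≠ ∞ := by simp
  rw [mul_comm (2 ^ n) P, mul_assoc, mul_comm (2 ^ n), ← mul_assoc] at hmain
  exact (ENNReal.mul_le_mul_iff_left h2 h2').1 hmain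

/-- A sample of size `n` on which some `h ∈ H` of error more than `ε` is consistent with `g` is
unlikely. -/
theorem uniform_convergence {α : Type} (D : PMF α) (H : Set (α → Bool)) (g : α → Bool)
    (n k G : ℕ) (ε : ℝ) (hε : ε ≤ 1)
    (hG : ∀ U : Finset α, (U : Set α) ⊆ D.support → U.card ≤ 2 * n → (traces H U).card ≤ G)
    (hk : (2 : ℝ) ^ k * (1 - ε / 2) ^ n ≤ 1 / 2) :
    (iid D n).toOuterMeasure {s | ∃ h ∈ H, (∀ i, h (s i) = g (s i)) ∧
      ENNReal.ofReal ε < D.toOuterMeasure {a | h a ≠ g a}} * 2 ^ k ≤ 2 * G := by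
  classical
  set A := {s : Fin n → α | ∃ h ∈ H, (∀ i, h (s i) = g (s i)) ∧
      ENNReal.ofReal ε < D.toOuterMeasure {a | h a ≠ g a}} with hA
  -- Ghost sample: if `h` fits `s` and has error above `ε`, an independent second sample shows at
  -- least `k` errors of `h` with probability at least 1/2.
  have hpt : ∀ s, (A.indicator (iid D n) s) ≤ 2 * ∑' s' : Fin n → α, iid D n s * iid D n s' *
      if SplitEvent H g k (s, s') then 1 else 0 := by
    intro s
    rw [Set.indicator_apply]
    split_ifs with hs
    · obtain ⟨h, hH, hc, he⟩ := hs
      have htail := iid_lower_tail D (fun a => decide (h a ≠ g a)) n k ε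
        (by simpa using he.le)
      have hle : (iid D n).toOuterMeasure
          {s' | (Finset.univ.filter fun i => decide (h (s' i) ≠ g (s' i)) = true).card < k} ≤ 2⁻¹ := by
        refine htail.trans ?_
        have h0 : (0:ℝ) ≤ 1 - ε / 2 := by linarith
        rw [← ENNReal.ofReal_pow h0, show (2 : ℝ≥0∞) ^ k = ENNReal.ofReal (2 ^ k) by
          rw [ENNReal.ofReal_pow (by norm_num)]; simp, ← ENNReal.ofReal_mul (by positivity)]
        refine (ENNReal.ofReal_le_ofReal hk).trans ?_
        rw [one_div, ENNReal.ofReal_inv_of_pos (by norm_num)]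
        simp
      have hcompl : (iid D n).toOuterMeasure
          {s' | (Finset.univ.filter fun i => decide (h (s' i) ≠ g (s' i)) = true).card < k} +
          ∑' s' : Fin n → α, iid D n s' * (if SplitEvent H g k (s, s') then 1 else 0) ≥ 1 := by
        rw [PMF.toOuterMeasure_apply, ← ENNReal.tsum_add, ← (iid D n).tsum_coe]
        refine ENNReal.tsum_le_tsum fun s' => ?_
        rw [Set.indicator_apply]
        split_ifs with h1 h2 h2
        · exact le_self_add
        · exact le_self_add
        · simp
        · exfalso
          apply h2
          refine ⟨h, hH, hc, ?_⟩
          simpa using h1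
      have hhalf : 2⁻¹ ≤ ∑' s' : Fin n → α,
          iid D n s' * (if SplitEvent H g k (s, s') then 1 else 0) := by
        by_contra hlt
        push Not at hlt
        have := ENNReal.add_lt_add_of_le_of_lt (by
          exact ne_top_of_le_ne_top (by simp) hle) hle hlt
        rw [ENNReal.inv_two_add_inv_two] at this
        exact absurd hcompl (not_le.2 this)
      simp_rw [mul_assoc, ENNReal.tsum_mul_left]
      calc iid D n s = 2 * (iid D n s * 2⁻¹) := by
            rw [mul_comm, mul_assoc, ENNReal.inv_mul_cancel (by simp) (by simp), mul_one]
        _ ≤ _ := by gcongr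
    · exact zero_le
  have hsum : (iid D n).toOuterMeasure A ≤ 2 * ∑' p : (Fin n → α) × (Fin n → α),
      iid D n p.1 * iid D n p.2 * if SplitEvent H g k p then 1 else 0 := by
    rw [PMF.toOuterMeasure_apply, ENNReal.tsum_prod', ← ENNReal.tsum_mul_left]
    exact ENNReal.tsum_le_tsum hpt
  calc _ ≤ (2 * ∑' p : (Fin n → α) × (Fin n → α),
      iid D n p.1 * iid D n p.2 * if SplitEvent H g k p then 1 else 0) * 2 ^ k := by gcongr
    _ ≤ _ := by
      rw [mul_assoc]
      gcongr
      exact splitEvent_prob_le D H g n k G hG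

/-! ### Growth of classes of finite VC dimension -/

theorem vcDim_le_iff {α : Type} {H : Set (α → Bool)} {X : Set α} {d : ℕ} :
    vcDim H X ≤ d ↔ ∀ S : Finset α, (S : Set α) ⊆ X → Shatters H S → S.card ≤ d := by
  simp only [vcDim, iSup_le_iff, and_imp, Nat.cast_le]

theorem exists_vcDim_eq {α : Type} {H : Set (α → Bool)} {X : Set α} {B : ℝ} (hB : 0 ≤ B)
    (h : ∀ S : Finset α, (S : Set α) ⊆ X → Shatters H S → (S.card : ℝ) ≤ B) :
    ∃ v : ℕ, vcDim H X = v ∧ (v : ℝ) ≤ B := by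
  have hle : vcDim H X ≤ (⌊B⌋₊ : ℕ) := vcDim_le_iff.2 fun S h1 h2 => Nat.le_floor (h S h1 h2)
  obtain ⟨v, hv⟩ := ENat.ne_top_iff_exists.1 (ne_top_of_le_ne_top (ENat.natCast_ne_top _) hle)
  refine ⟨v, hv.symm, ?_⟩
  rw [← hv, Nat.cast_le] at hle
  exact (Nat.cast_le.2 hle).trans (Nat.floor_le hB)

/-- A shattered set meets each fibre of `φ` at most once, since a pulled-back function cannot
separate points of one fibre. Its image therefore has the same size and is shattered by `H`. -/
theorem vcDim_comp_le {α β : Type} {H : Set (α → Bool)} {X : Set α} {d : ℕ} (hd : vcDim H X ≤ d)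
    (φ : β → α) {Y : Set β} (hφ : ∀ y ∈ Y, φ y ∈ X) : vcDim ((fun h => h ∘ φ) '' H) Y ≤ d := by
  classical
  rw [vcDim_le_iff] at hd ⊢
  intro S hS hsh
  have hinj : Set.InjOn φ S := by
    intro a ha b hb hab
    by_contra hne
    obtain ⟨_, ⟨h, -, rfl⟩, hh⟩ := hsh fun y => decide (y = a)
    have h1 := hh a ha
    have h2 := hh b hb
    simp only [Function.comp_apply, hab] at h1 h2
    rw [h1] at h2
    simp [Ne.symm hne] at h2
  rw [← Finset.card_image_of_injOn hinj]
  refine hd _ ?_ ?_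
  · intro x hx
    simp only [Finset.coe_image, Set.mem_image] at hx
    obtain ⟨y, hy, rfl⟩ := hx
    exact hφ y (hS hy)
  · intro g
    obtain ⟨_, ⟨h, hH, rfl⟩, hh⟩ := hsh (g ∘ φ)
    refine ⟨h, hH, fun a ha => ?_⟩
    obtain ⟨y, hy, rfl⟩ := Finset.mem_image.1 ha
    exact hh y hy

/-- Sauer–Shelah: a family has at most as many members as sets that it shatters, and a set shattered
by the traces lies in `U` and has at most `d` elements. -/
theorem card_traces_le {α : Type} {H : Set (α → Bool)} {X : Set α} {d : ℕ} (hd : vcDim H X ≤ d)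
    {U : Finset α} (hU : (U : Set α) ⊆ X) :
    (traces H U).card ≤ ∑ k ∈ Finset.range (d + 1), U.card.choose k := by
  classical
  rw [vcDim_le_iff] at hd
  refine (Finset.card_le_card_shatterer _).trans ?_
  have hsub : (traces H U).shatterer ⊆ (Finset.range (d + 1)).biUnion fun k => U.powersetCard k := by
    intro s hs
    rw [Finset.mem_shatterer] at hs
    have hsU : s ⊆ U := by
      obtain ⟨t, ht, hst⟩ := hs.exists_superset
      obtain ⟨h, -, rfl⟩ := mem_traces.1 ht
      exact hst.trans (Finset.filter_subset _ _)
    rw [Finset.mem_biUnion]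
    refine ⟨s.card, ?_, Finset.mem_powersetCard.2 ⟨hsU, rfl⟩⟩
    rw [Finset.mem_range, Nat.lt_succ_iff]
    refine hd s (fun a ha => hU (hsU ha)) fun g => ?_
    obtain ⟨u, hu, hsu⟩ := hs (Finset.filter_subset (fun a => g a = true) s)
    obtain ⟨h, hH, rfl⟩ := mem_traces.1 hu
    refine ⟨h, hH, fun a ha => ?_⟩
    have := Finset.ext_iff.1 hsu a
    simp only [Finset.mem_inter, Finset.mem_filter, ha, hsU ha, true_and] at this
    exact Bool.eq_iff_iff.2 this
  refine (Finset.card_le_card hsub).trans (Finset.card_biUnion_le.trans ?_)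
  simp

theorem sum_choose_le_pow (N d : ℕ) : ∑ k ∈ Finset.range (d + 1), N.choose k ≤ (N + 1) ^ d := by
  rw [add_pow]
  refine Finset.sum_le_sum fun k hk => ?_
  rw [one_pow, mul_one]
  have h1 : 1 ≤ d.choose k := Nat.choose_pos (Nat.lt_succ_iff.1 (Finset.mem_range.1 hk))
  calc N.choose k ≤ N ^ k := Nat.choose_le_pow N k
    _ ≤ N ^ k * d.choose k := Nat.le_mul_of_pos_right _ h1

/-- As `d / N ≤ 1`, the factor `(d / N) ^ d` may be replaced by `(d / N) ^ k` in the k-th term;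
completing the binomial sum gives `(1 + d / N) ^ N ≤ exp d`. -/
theorem sum_choose_le_exp {N d : ℕ} (hd : 1 ≤ d) (hN : d ≤ N) :
    (∑ k ∈ Finset.range (d + 1), (N.choose k : ℝ)) ≤ (Real.exp 1 * N / d) ^ d := by
  have hd0 : (0 : ℝ) < d := by exact_mod_cast hd
  have hN0 : (0 : ℝ) < N := by exact_mod_cast hd.trans hN
  have hx : (d : ℝ) / N ≤ 1 := by rw [div_le_one hN0]; exact_mod_cast hN
  have hx0 : (0 : ℝ) < d / N := by positivity
  have key : (∑ k ∈ Finset.range (d + 1), (N.choose k : ℝ)) * ((d : ℝ) / N) ^ d ≤ Real.exp d := by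
    calc _ = ∑ k ∈ Finset.range (d + 1), (N.choose k : ℝ) * ((d : ℝ) / N) ^ d := by
          rw [Finset.sum_mul]
      _ ≤ ∑ k ∈ Finset.range (d + 1), (N.choose k : ℝ) * ((d : ℝ) / N) ^ k := by
          refine Finset.sum_le_sum fun k hk => ?_
          refine mul_le_mul_of_nonneg_left ?_ (by positivity)
          exact pow_le_pow_of_le_one hx0.le hx (Nat.lt_succ_iff.1 (Finset.mem_range.1 hk))
      _ ≤ ∑ k ∈ Finset.range (N + 1), (N.choose k : ℝ) * ((d : ℝ) / N) ^ k := by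
          refine Finset.sum_le_sum_of_subset_of_nonneg ?_ fun _ _ _ => by positivity
          exact Finset.range_subset_range.2 (by omega)
      _ = (d / N + 1) ^ N := by
          rw [add_pow]
          refine Finset.sum_congr rfl fun k _ => ?_
          rw [one_pow]; ring
      _ ≤ Real.exp (d / N) ^ N := by
          refine pow_le_pow_left₀ (by positivity) (Real.add_one_le_exp _) _
      _ = Real.exp d := by
          rw [← Real.exp_nat_mul]; congr 1; field_simp
  rw [← le_div_iff₀ (by positivity)] at key
  refine key.trans (le_of_eq ?_)
  have : Real.exp d = Real.exp 1 ^ d := by rw [← Real.exp_nat_mul]; simp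
  rw [this, ← div_pow]
  congr 1
  field_simp

/-- If the trace on `S` of each member of `H'` is a function of the trace on `W` of some member of
`H`, then `H'` has at most as many traces on `S` as `H` on `W`. -/
theorem card_traces_le_of_determined {α β : Type} {H' : Set (α → Bool)} {S : Finset α}
    {H : Set (β → Bool)} {W : Finset β} (Φ : Finset β → Finset α)
    (hΦ : ∀ h' ∈ H', ∃ h ∈ H,
      (S.filter fun a => h' a = true) = Φ (W.filter fun b => h b = true)) :
    (traces H' S).card ≤ (traces H W).card := by
  classical
  refine (Finset.card_le_card (t := (traces H W).image Φ) ?_).trans Finset.card_image_le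
  intro t ht
  obtain ⟨h', hH', rfl⟩ := mem_traces.1 ht
  obtain ⟨h, hH, he⟩ := hΦ h' hH'
  exact Finset.mem_image.2 ⟨_, mem_traces.2 ⟨h, hH, rfl⟩, he.symm⟩

theorem Shatters.two_pow_le {α : Type} {H : Set (α → Bool)} {S : Finset α} (h : Shatters H S) :
    2 ^ S.card ≤ (traces H S).card := by
  classical
  rw [← Finset.card_powerset]
  refine Finset.card_le_card fun t ht => ?_
  obtain ⟨f, hf, hft⟩ := h fun a => decide (a ∈ t)
  refine mem_traces.2 ⟨f, hf, ?_⟩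
  ext a
  rw [Finset.mem_filter]
  constructor
  · intro hat
    have := Finset.mem_powerset.1 ht hat
    exact ⟨this, by rw [hft a this]; simpa using hat⟩
  · rintro ⟨haS, hfa⟩
    rw [hft a haS] at hfa
    simpa using hfa

/-! ### Weighted votes -/

/-- Nonnegativity sets of linear combinations of the functions `φ k`. -/
def linClass {α : Type} {K : ℕ} (φ : Fin K → α → ℝ) : Set (α → Bool) :=
  {h | ∃ a : Fin K → ℝ, h = fun x => decide (0 ≤ ∑ k, a k * φ k x)}

/-- More than `K` points have linearly dependent vectors of values. A dependence `c` annihilates the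
values of every combination, so no combination can be nonnegative exactly where `c` is negative. -/
theorem vcDim_linClass_le {α : Type} {K : ℕ} (φ : Fin K → α → ℝ) (X : Set α) :
    vcDim (linClass φ) X ≤ K := by
  classical
  rw [vcDim_le_iff]
  intro S _ hsh
  by_contra hlt
  push Not at hlt
  have hdep : ¬ LinearIndependent ℝ fun (x : S) (k : Fin K) => φ k x := by
    intro hli
    have := hli.fintype_card_le_finrank
    simp only [Fintype.card_coe, Module.finrank_fintype_fun_eq_card, Fintype.card_fin] at this
    omega
  obtain ⟨c₀, hc₀, i₀, hi₀⟩ := Fintype.not_linearIndependent_iff.1 hdep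
  -- Up to a sign some coefficient is positive. The label there is `false`, which means a strictly
  -- negative value, and this makes the contradiction strict.
  obtain ⟨c, hc, i, hi⟩ : ∃ c : S → ℝ, (∑ x, c x • fun k : Fin K => φ k x) = 0 ∧ ∃ i, 0 < c i := by
    rcases lt_or_gt_of_ne hi₀ with h | h
    · refine ⟨-c₀, ?_, i₀, by simpa using h⟩
      simp only [Pi.neg_apply, neg_smul, Finset.sum_neg_distrib, hc₀, neg_zero]
    · exact ⟨c₀, hc₀, i₀, h⟩
  obtain ⟨_, ⟨a, rfl⟩, ha⟩ := hsh fun x => if hx : x ∈ S then decide (c ⟨x, hx⟩ < 0) else false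
  have ha' : ∀ x : S, (0 ≤ ∑ k, a k * φ k x) ↔ c x < 0 := by
    intro x
    have := ha x x.2
    simpa using this
  have hzero : ∑ x : S, c x * ∑ k, a k * φ k x = 0 := by
    have h1 : ∀ k, ∑ x : S, c x * φ k x = 0 := fun k => by
      simpa using congrFun hc k
    calc ∑ x : S, c x * ∑ k, a k * φ k x = ∑ k, a k * ∑ x : S, c x * φ k x := by
          simp_rw [Finset.mul_sum]
          rw [Finset.sum_comm]
          exact Finset.sum_congr rfl fun _ _ => Finset.sum_congr rfl fun _ _ => by ring
      _ = 0 := Finset.sum_eq_zero fun k _ => by rw [h1 k, mul_zero]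
  have hneg : ∑ x : S, c x * ∑ k, a k * φ k x < 0 := by
    refine Finset.sum_neg' (fun x _ => ?_) ⟨i, Finset.mem_univ _, ?_⟩
    · by_cases hx : c x < 0
      · exact mul_nonpos_of_nonpos_of_nonneg hx.le ((ha' x).2 hx)
      · have := mt (ha' x).1 hx
        exact mul_nonpos_of_nonneg_of_nonpos (not_lt.1 hx) (not_le.1 this).le
    · have := mt (ha' i).1 (not_lt.2 hi.le)
      exact mul_neg_of_pos_of_neg hi (not_le.1 this)
  linarith

/-- Weighted votes of at most `K` members of `H`, ties being broken in favour of `true`. -/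
def voteClass {α : Type} (H : Set (α → Bool)) (K : ℕ) : Set (α → Bool) :=
  {h | ∃ (a : Fin K → ℝ) (g : Fin K → α → Bool), (∀ k, g k ∈ H) ∧
    h = fun x => decide (0 ≤ ∑ k, a k * if g k x = true then 1 else -1)}

/-- Once the `K` voters are replaced by their traces on `U`, only the weights vary and the vote is a
linear threshold in `K` fixed functions. Choices of traces and thresholds are counted separately. -/
theorem card_traces_voteClass_le {α : Type} {H : Set (α → Bool)} {X : Set α} {d : ℕ}
    (hd : vcDim H X ≤ d) {U : Finset α} (hU : (U : Set α) ⊆ X) (K : ℕ) :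
    (traces (voteClass H K) U).card ≤ (U.card + 1) ^ (K * (d + 1)) := by
  classical
  set φ : (Fin K → Finset α) → Fin K → α → ℝ := fun τ k x => if x ∈ τ k then 1 else -1 with hφ
  have hsub : traces (voteClass H K) U ⊆
      (Fintype.piFinset fun _ : Fin K => traces H U).biUnion fun τ => traces (linClass (φ τ)) U := by
    intro t ht
    obtain ⟨_, ⟨a, g, hg, rfl⟩, rfl⟩ := mem_traces.1 ht
    rw [Finset.mem_biUnion]
    refine ⟨fun k => U.filter fun x => g k x = true,
      Fintype.mem_piFinset.2 fun k => mem_traces.2 ⟨g k, hg k, rfl⟩, mem_traces.2 ⟨_, ⟨a, rfl⟩, ?_⟩⟩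
    refine Finset.filter_congr fun x hx => ?_
    simp [hφ, hx]
  calc _ ≤ ∑ τ ∈ Fintype.piFinset fun _ : Fin K => traces H U, (traces (linClass (φ τ)) U).card :=
        (Finset.card_le_card hsub).trans Finset.card_biUnion_le
    _ ≤ ∑ τ ∈ Fintype.piFinset fun _ : Fin K => traces H U, (U.card + 1) ^ K :=
        Finset.sum_le_sum fun τ _ =>
          (card_traces_le (vcDim_linClass_le _ _) hU).trans (sum_choose_le_pow _ _)
    _ = (traces H U).card ^ K * (U.card + 1) ^ K := by
        rw [Finset.sum_const, Fintype.card_piFinset]; simp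
    _ ≤ ((U.card + 1) ^ d) ^ K * (U.card + 1) ^ K := by
        gcongr
        exact (card_traces_le hd hU).trans (sum_choose_le_pow _ _)
    _ = _ := by rw [← pow_mul, ← pow_add]; congr 1; ring

/-! ### Chains of thought -/

theorem cot_succ (f : Thinker) (T : ℕ) (x : Str) :
    cot f (T + 1) x = cot f T x ++ [e2e f (T + 1) x] := by
  simp [cot, List.range_succ]

theorem iterate_extend (f : Thinker) (x : Str) :
    ∀ T, (extend f)^[T] x = x ++ cot f T x ∧ e2e f (T + 1) x = f (x ++ cot f T x)
  | 0 => by simp [cot, e2e, extend]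
  | T + 1 => by
    obtain ⟨h1, h2⟩ := iterate_extend f x T
    have h3 : (extend f)^[T + 1] x = x ++ cot f (T + 1) x := by
      rw [Function.iterate_succ_apply', h1, cot_succ, h2]
      simp [extend]
    refine ⟨h3, ?_⟩
    rw [e2e, Function.iterate_succ_apply', h3]
    simp [extend]

theorem e2e_succ (f : Thinker) (T : ℕ) (x : Str) : e2e f (T + 1) x = f (x ++ cot f T x) :=
  (iterate_extend f x T).2

theorem length_cot (f : Thinker) (T : ℕ) (x : Str) : (cot f T x).length = T := by simp [cot]

theorem take_cot (f : Thinker) {t T : ℕ} (h : t ≤ T) (x : Str) : (cot f T x).take t = cot f t x := by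
  simp [cot, ← List.map_take, List.take_range, h]

theorem getD_cot (f : Thinker) {t T : ℕ} (h : t < T) (x : Str) :
    (cot f T x).getD t false = f (x ++ cot f t x) := by
  rw [← e2e_succ f t x]
  simp [cot, h]

/-- If each token of `z` is the right continuation of the prefix before it, those prefixes are
inductively the prefixes of the chain of thought. The right-hand side evaluates `f` only at strings
fixed by `x` and `z`, which makes the loss class countable through `F`. -/
theorem eq_cot_iff (f : Thinker) {T : ℕ} (x : Str) {z : Str} (hz : z.length = T) :
    z = cot f T x ↔ ∀ t < T, f (x ++ z.take t) = z.getD t false := by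
  constructor
  · rintro rfl t ht
    rw [take_cot f ht.le, getD_cot f ht]
  · intro h
    have key : ∀ t ≤ T, z.take t = cot f t x := by
      intro t
      induction t with
      | zero => intro _; simp [cot]
      | succ t ih =>
        intro ht
        have h1 := h t ht
        have h2 : t < z.length := by omega
        rw [List.take_succ_eq_append_getElem h2, cot_succ, e2e_succ, ih (by omega)]
        rw [ih (by omega)] at h1
        rw [h1]
        simp [h2]
    rw [← key T le_rfl, ← hz, List.take_length]

theorem e2e_eq_of_cot_eq {f g : Thinker} {T : ℕ} (hT : 1 ≤ T) {x : Str}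
    (h : cot f T x = cot g T x) : e2e f T x = e2e g T x := by
  obtain ⟨T, rfl⟩ := Nat.exists_eq_add_of_le' hT
  rw [cot_succ, cot_succ] at h
  simpa using (List.append_inj' h rfl).2

/-! ### The VC dimension of the chain-of-thought loss class -/

theorem two_pow_le_ncard {F : Set Thinker} (hF : F.Finite) {T : ℕ} {S : Finset (Str × Str)}
    (h : Shatters (cotLossClass F T) S) : 2 ^ S.card ≤ F.ncard := by
  classical
  refine h.two_pow_le.trans ?_
  rw [Set.ncard_eq_toFinset_card _ hF]
  refine (Finset.card_le_card (t := hF.toFinset.image fun f =>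
    S.filter fun p => decide (p.2 ≠ cot f T p.1) = true) ?_).trans Finset.card_image_le
  intro t ht
  obtain ⟨_, ⟨f, hf, rfl⟩, rfl⟩ := mem_traces.1 ht
  exact Finset.mem_image.2 ⟨f, hF.mem_toFinset.2 hf, rfl⟩

/-- A shattered set satisfies `2 ^ |S| ≤ |F|`, and `1 / log 2 < 2`. -/
theorem exists_vcDim_cotLossClass_of_finite {F : Set Thinker} (hF : F.Finite) (T : ℕ)
    (X : Set (Str × Str)) :
    ∃ v : ℕ, vcDim (cotLossClass F T) X = v ∧ (v : ℝ) ≤ 2 * Real.log F.ncard := by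
  have hlog : 0 ≤ Real.log (F.ncard : ℝ) := Real.log_natCast_nonneg _
  refine exists_vcDim_eq (by positivity) fun S _ hsh => ?_
  have h1 : ((2 : ℝ) ^ S.card) ≤ F.ncard := by exact_mod_cast two_pow_le_ncard hF hsh
  have h2 := Real.log_le_log (by positivity) h1
  rw [Real.log_pow] at h2
  nlinarith [Real.log_two_gt_d9, Nat.cast_nonneg (α := ℝ) S.card]

/-- The prefixes of chains of thought in a set of pairs. -/
def prefixes (T : ℕ) (S : Finset (Str × Str)) : Finset Str :=
  S.biUnion fun p => (Finset.range T).image fun t => p.1 ++ p.2.take t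

theorem card_prefixes_le (T : ℕ) (S : Finset (Str × Str)) : (prefixes T S).card ≤ S.card * T :=
  Finset.card_biUnion_le_card_mul _ _ _ fun _ _ => Finset.card_image_le.trans (by simp)

/-- By `eq_cot_iff` the loss at a pair of `S` is settled by next-token tests at strings in `prefixes
T S`, so the trace of `f` there determines the trace of its loss on `S`. -/
theorem card_traces_cotLossClass_le (F : Set Thinker) (T : ℕ) (S : Finset (Str × Str))
    (hS : ∀ p ∈ S, p.2.length = T) :
    (traces (cotLossClass F T) S).card ≤ (traces F (prefixes T S)).card := by
  classical
  refine card_traces_le_of_determined (fun t => S.filter fun p =>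
    ∃ k < T, decide (p.1 ++ p.2.take k ∈ t) ≠ p.2.getD k false) ?_
  rintro _ ⟨f, hf, rfl⟩
  refine ⟨f, hf, Finset.filter_congr fun p hp => ?_⟩
  rw [decide_eq_true_iff, ne_eq, eq_cot_iff f p.1 (hS p hp)]
  push Not
  refine exists_congr fun k => and_congr_right fun hk => ?_
  have : p.1 ++ p.2.take k ∈ prefixes T S :=
    Finset.mem_biUnion.2 ⟨p, hp, Finset.mem_image_of_mem _ (Finset.mem_range.2 hk)⟩
  simp [Finset.mem_filter, this]

/-- With `r = n / v`, logarithms give `r log 2 ≤ 1 + log T + log r`, and `log r ≤ log 4 + r / 4 - 1`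
lets the left side absorb `log r`. -/
theorem le_mul_log_of_two_pow_le {n v T : ℕ} (hT : 1 ≤ T) (hv : 1 ≤ v) (hn : v ≤ n * T)
    (h : (2 : ℝ) ^ n ≤ (Real.exp 1 * ((n * T : ℕ) : ℝ) / v) ^ v) :
    (n : ℝ) ≤ 7 * (v * Real.log (T + 1)) := by
  have hv0 : (0 : ℝ) < v := by exact_mod_cast hv
  have hT0 : (0 : ℝ) < T := by exact_mod_cast hT
  have hn0 : (0 : ℝ) < n := by
    rcases Nat.eq_zero_or_pos n with rfl | h0
    · omega
    · exact_mod_cast h0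
  set r : ℝ := n / v with hr
  have hr0 : 0 < r := by positivity
  have h1 := Real.log_le_log (by positivity) h
  rw [Real.log_pow, Real.log_pow] at h1
  have h2 : Real.exp 1 * ((n * T : ℕ) : ℝ) / v = Real.exp 1 * (T * (4 * (r / 4))) := by
    rw [hr]; push_cast; field_simp
  rw [h2, Real.log_mul (by positivity) (by positivity), Real.log_exp,
    Real.log_mul (by positivity) (by positivity), Real.log_mul (by positivity) (by positivity)] at h1
  have h3 := Real.log_le_sub_one_of_pos (show 0 < r / 4 by positivity)
  have h4 : Real.log 4 = 2 * Real.log 2 := by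
    rw [show (4 : ℝ) = 2 ^ 2 by norm_num, Real.log_pow]; norm_num
  have h5 : Real.log 2 ≤ Real.log (T + 1) :=
    Real.log_le_log (by norm_num) (by linarith [show (1 : ℝ) ≤ T by exact_mod_cast hT])
  have h6 : Real.log T ≤ Real.log (T + 1) := Real.log_le_log hT0 (by linarith)
  have h7 : (n : ℝ) = v * r := by rw [hr]; field_simp
  rw [h7, mul_assoc] at h1
  have h8 := le_of_mul_le_mul_left h1 hv0
  rw [h7]
  -- Here `r (log 2 - 1/4) ≤ log T + 2 log 2 ≤ 3 log (T + 1)`, and `3 / (log 2 - 1/4) < 7`.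
  have h9 : r ≤ 7 * Real.log (T + 1) := by nlinarith [Real.log_two_gt_d9]
  nlinarith

theorem exists_vcDim_cotLossClass {F : Set Thinker} {T : ℕ} (hT : 1 ≤ T) {X : Set Str} {v : ℕ}
    (hv : vcDim F (prefixDomain X T) = v) :
    ∃ vl : ℕ, vcDim (cotLossClass F T) (traceDomain X T) = vl ∧
      (vl : ℝ) ≤ 7 * (v * Real.log (T + 1)) := by
  have hT1 : (1 : ℝ) ≤ T := by exact_mod_cast hT
  have hlog : Real.log 2 ≤ Real.log (T + 1) := Real.log_le_log (by norm_num) (by linarith)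
  have hlog2 := Real.log_two_gt_d9
  refine exists_vcDim_eq (by have := hlog2.trans_le hlog; positivity) fun S hS hsh => ?_
  have hW : (prefixes T S : Set Str) ⊆ prefixDomain X T := by
    intro w hw
    simp only [prefixes, Finset.coe_biUnion, Set.mem_iUnion, Finset.coe_image, Set.mem_image] at hw
    obtain ⟨p, hp, t, ht, rfl⟩ := hw
    have := hS hp
    have ht' : t < T := by simpa using ht
    exact ⟨p.1, this.1, p.2.take t, (List.length_take_le _ _).trans_lt ht', rfl⟩
  have hgrow : 2 ^ S.card ≤ ∑ k ∈ Finset.range (v + 1), (S.card * T).choose k :=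
    calc 2 ^ S.card ≤ _ := hsh.two_pow_le
      _ ≤ _ := card_traces_cotLossClass_le F T S fun p hp => (hS hp).2
      _ ≤ _ := card_traces_le hv.le hW
      _ ≤ _ := Finset.sum_le_sum fun k _ => Nat.choose_le_choose k (card_prefixes_le T S)
  rcases Nat.eq_zero_or_pos v with rfl | hv1
  · have : S.card = 0 := by
      by_contra h0
      have := Nat.one_lt_two_pow h0
      simp at hgrow
      omega
    simp [this]
  · by_cases hle : v ≤ S.card * T
    · refine le_mul_log_of_two_pow_le hT hv1 hle ?_
      refine le_trans ?_ (sum_choose_le_exp hv1 hle)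
      exact_mod_cast hgrow
    -- With fewer than `v` potential prefixes the exponential bound on the binomial sum does not
    -- apply, but then `|S| ≤ v`, and `7 log 2 > 1`.
    · push Not at hle
      have h1 : S.card ≤ v := (Nat.le_mul_of_pos_right _ hT).trans hle.le
      have h2 : (S.card : ℝ) ≤ v := by exact_mod_cast h1
      nlinarith [Nat.cast_nonneg (α := ℝ) v]

/-! ### Weak learning from few examples -/

theorem le_ofReal_of_mul_two_pow_le {P : ℝ≥0∞} {k G : ℕ} {b : ℝ} (h : P * 2 ^ k ≤ 2 * G)
    (hb : 2 * (G : ℝ) ≤ b * 2 ^ k) : P ≤ ENNReal.ofReal b := by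
  have h2 : (2 : ℝ≥0∞) ^ k = ENNReal.ofReal (2 ^ k) := by
    rw [ENNReal.ofReal_pow (by norm_num)]; simp
  have h3 : (2 * G : ℝ≥0∞) = ENNReal.ofReal (2 * G) := by
    rw [ENNReal.ofReal_mul (by norm_num)]; simp
  have h4 : P * 2 ^ k ≤ ENNReal.ofReal b * 2 ^ k := by
    refine h.trans ?_
    rw [h2, h3, ← ENNReal.ofReal_mul' (by positivity)]
    exact ENNReal.ofReal_le_ofReal hb
  exact (ENNReal.mul_le_mul_iff_left (by simp) (by simp)).1 h4

/-- Two members that differ at a point of `X` would shatter it. This settles dimension 0, where the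
weak learner draws no examples at all. -/
theorem eq_of_vcDim_le_zero {α : Type} {H : Set (α → Bool)} {X : Set α} (hd : vcDim H X ≤ (0 : ℕ))
    {g h : α → Bool} (hg : g ∈ H) (hh : h ∈ H) {a : α} (ha : a ∈ X) : h a = g a := by
  by_contra hne
  have := vcDim_le_iff.1 hd {a} (by simpa using ha) fun t => by
    by_cases ht : h a = t a
    · exact ⟨h, hh, by simpa using ht⟩
    · refine ⟨g, hg, ?_⟩
      simp only [Finset.mem_singleton, forall_eq]
      cases h1 : h a <;> cases h2 : g a <;> cases h3 : t a <;> simp_all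
  simp at this

/-- The number is `288 = 6 * 48` with `48 > 16 e`: the base `16 e c` of the growth function has to
stay below `2 ^ c / 6`. The inequality still fails at `c = 11`. -/
theorem mul_le_two_pow {c : ℕ} (hc : 12 ≤ c) : 288 * c ≤ 2 ^ c := by
  induction c, hc using Nat.le_induction with
  | base => norm_num
  | succ n hn ih => rw [pow_succ]; omega

/-- With `8 c d` draws and threshold `k = c d`, double sampling weighs a growth of at most `(16 e c)
^ d` against `2 ^ (c d)`. Both are d-th powers, so a constant `c` suffices: at constant accuracy the
budget carries no logarithm. -/
theorem weak_uniform_convergence {α : Type} (D : PMF α) {H : Set (α → Bool)} {g : α → Bool}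
    (hg : g ∈ H) {c d : ℕ} (hd : vcDim H D.support ≤ d) (hc : 12 ≤ c) :
    (iid D (8 * c * d)).toOuterMeasure {s | ∃ h ∈ H, (∀ i, h (s i) = g (s i)) ∧
      ENNReal.ofReal (1 / 4) < D.toOuterMeasure {a | h a ≠ g a}} ≤
        ENNReal.ofReal (Real.exp (-1)) := by
  rcases Nat.eq_zero_or_pos d with rfl | hd1
  · have : {s : Fin (8 * c * 0) → α | ∃ h ∈ H, (∀ i, h (s i) = g (s i)) ∧
        ENNReal.ofReal (1 / 4) < D.toOuterMeasure {a | h a ≠ g a}} = ∅ := by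
      rw [Set.eq_empty_iff_forall_notMem]
      rintro s ⟨h, hh, -, hlt⟩
      have h0 : D.toOuterMeasure {a | h a ≠ g a} = 0 := by
        rw [PMF.toOuterMeasure_apply_eq_zero_iff, Set.disjoint_left]
        intro a ha hne
        exact hne (eq_of_vcDim_le_zero hd hg hh ha)
      rw [h0] at hlt
      exact not_lt_zero hlt
    rw [this]
    simp
  · set G := ∑ k ∈ Finset.range (d + 1), (2 * (8 * c * d)).choose k with hG
    have hcd : 2 ≤ c * d := by nlinarith
    have hUC := uniform_convergence D H g (8 * c * d) (c * d) G (1 / 4) (by norm_num)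
      (fun U hU hcard => (card_traces_le hd hU).trans
        (Finset.sum_le_sum fun k _ => Nat.choose_le_choose k hcard)) (by
        -- The base `2 (7/8) ^ 8` is below 0.7 and its square below 1/2, hence the use of `2 ≤ c *
        -- d`.
        have hpow : (2 : ℝ) ^ (c * d) * (1 - 1 / 4 / 2) ^ (8 * c * d) =
            (2 * (1 - 1 / 4 / 2 : ℝ) ^ 8) ^ (c * d) := by rw [mul_pow, ← pow_mul, mul_assoc]
        rw [hpow]
        calc (2 * (1 - 1 / 4 / 2 : ℝ) ^ 8) ^ (c * d) ≤ (2 * (1 - 1 / 4 / 2 : ℝ) ^ 8) ^ 2 :=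
              pow_le_pow_of_le_one (by norm_num) (by norm_num) hcd
          _ ≤ 1 / 2 := by norm_num)
    refine le_ofReal_of_mul_two_pow_le hUC ?_
    have hd0 : (0 : ℝ) < d := by exact_mod_cast hd1
    have hG' : (G : ℝ) ≤ (Real.exp 1 * (16 * c)) ^ d := by
      rw [hG]
      push_cast
      refine (sum_choose_le_exp hd1 (by nlinarith)).trans (le_of_eq ?_)
      push_cast
      congr 1
      field_simp
      norm_num
    have hc' : (288 * c : ℝ) ≤ 2 ^ c := by exact_mod_cast mul_le_two_pow hc
    have he : Real.exp 1 < 3 := by linarith [Real.exp_one_lt_d9]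
    have he' : (1 : ℝ) / 3 ≤ Real.exp (-1) := by
      rw [Real.exp_neg, one_div]
      exact inv_anti₀ (Real.exp_pos _) he.le
    have hc0 : (0 : ℝ) ≤ c := Nat.cast_nonneg c
    have h1 : Real.exp 1 * (16 * c) ≤ 2 ^ c / 6 := by nlinarith
    calc 2 * (G : ℝ) ≤ 2 * (2 ^ c / 6) ^ d := by
          have := hG'.trans (pow_le_pow_left₀ (by positivity) h1 d)
          linarith
      _ = 2 * (1 / 6) ^ d * 2 ^ (c * d) := by rw [pow_mul, div_pow, one_div, inv_pow]; ring
      _ ≤ Real.exp (-1) * 2 ^ (c * d) := by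
          refine mul_le_mul_of_nonneg_right ?_ (by positivity)
          have : ((1 : ℝ) / 6) ^ d ≤ (1 / 6) ^ 1 :=
            pow_le_pow_of_le_one (by norm_num) (by norm_num) hd1
          linarith

/-! ### The steps of the algorithm -/

namespace Setup

variable {m : ℕ} (s : Setup m)

/-- The predictor and the round that an attempt with the drawn indices `t` produces. -/
def attemptResult (H : List (Round m)) {n : ℕ} (t : Fin n → Fin m) : Thinker × List (Round m) :=
  (s.rule (((List.ofFn t).map s.xs).zip
      ((List.ofFn t).map fun i => cot (s.adv s.xs H (List.ofFn t)) s.T (s.xs i))),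
    ⟨List.ofFn t, s.adv s.xs H (List.ofFn t)⟩ :: H)

/-- The drawn indices are the only randomness of an attempt: given them and the history, the answer
and the predictor are determined. -/
theorem attempt_eq (D : PMF (Fin m)) (H : List (Round m)) :
    s.attempt D H = (iid D s.M).map (s.attemptResult H) := by
  change ((iid D s.M).bind fun a => PMF.pure (a, H)).bind _ = _
  rw [PMF.bind_bind, ← PMF.bind_pure_comp]
  congr 1
  funext a
  rw [PMF.pure_bind]
  change (PMF.pure _).bind _ = _
  rw [PMF.pure_bind]
  rfl

theorem weakLearn_succ (D : PMF (Fin m)) (r : ℕ) (H : List (Round m)) :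
    s.weakLearn D (r + 1) H = (s.attempt D H).bind fun o =>
      if s.error D o.1 ≤ 1 / 4 then PMF.pure o else s.weakLearn D r o.2 := by
  change (s.attempt D H).bind _ = _
  congr 1
  funext o
  obtain ⟨f, H'⟩ := o
  by_cases h : s.error D f ≤ 1 / 4
  · simp only [h, if_true]; rfl
  · simp only [h, if_false]

/-- The vote weight of a predictor of error `e`. -/
def voteWeight (e : ℝ) : ℝ := if e = 1 then 0 else 1 / 2 * Real.log ((1 - e) / e)

theorem boost_succ (L k : ℕ) (D : PMF (Fin m)) (fs : List (ℝ × Thinker)) (H : List (Round m)) :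
    s.boost L (k + 1) D fs H = (s.weakLearn D (L - 1) H).bind fun o =>
      if s.error D o.1 = 0 then PMF.pure (e2e o.1 s.T, o.2)
      else s.boost L k (reweight D fun i => if e2e o.1 s.T (s.xs i) ≠ s.ys i
        then voteWeight (s.error D o.1) else -voteWeight (s.error D o.1))
        (fs ++ [(voteWeight (s.error D o.1), o.1)]) o.2 := by
  change (s.weakLearn D (L - 1) H).bind _ = _
  congr 1
  funext o
  obtain ⟨f, H'⟩ := o
  by_cases h : s.error D f = 0
  · simp only [h, if_true]; rfl
  · simp only [h, if_false]; rfl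

theorem boost_zero (L : ℕ) (D : PMF (Fin m)) (fs : List (ℝ × Thinker)) (H : List (Round m)) :
    s.boost L 0 D fs H = PMF.pure (vote s.T fs, H) := rfl

end Setup

/-! ### Votes -/

/-- The signed weight with which the vote `fs` supports the label `y` at `x`. -/
def margin (T : ℕ) (fs : List (ℝ × Thinker)) (x : Str) (y : Bool) : ℝ :=
  (fs.map fun p => p.1 * if e2e p.2 T x = y then 1 else -1).sum

theorem margin_append (T : ℕ) (fs : List (ℝ × Thinker)) (p : ℝ × Thinker) (x : Str) (y : Bool) :
    margin T (fs ++ [p]) x y = margin T fs x y + p.1 * if e2e p.2 T x = y then 1 else -1 := by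
  simp [margin]

theorem margin_true_eq (T : ℕ) (fs : List (ℝ × Thinker)) (x : Str) :
    margin T fs x true = (fs.map fun p => if e2e p.2 T x = true then p.1 else 0).sum -
      (fs.map fun p => if e2e p.2 T x = false then p.1 else 0).sum := by
  induction fs with
  | nil => simp [margin]
  | cons p fs ih =>
    simp only [margin, List.map_cons, List.sum_cons] at ih ⊢
    rw [ih]
    cases e2e p.2 T x <;> simp <;> ring

theorem margin_false_eq (T : ℕ) (fs : List (ℝ × Thinker)) (x : Str) :
    margin T fs x false = -margin T fs x true := by
  induction fs with
  | nil => simp [margin]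
  | cons p fs ih =>
    simp only [margin, List.map_cons, List.sum_cons] at ih ⊢
    rw [ih]
    cases e2e p.2 T x <;> simp <;> ring

theorem vote_eq (T : ℕ) (fs : List (ℝ × Thinker)) (x : Str) :
    vote T fs x = decide (0 ≤ margin T fs x true) := by
  rw [vote, margin_true_eq]
  simp

theorem vote_eq_of_margin_pos {T : ℕ} {fs : List (ℝ × Thinker)} {x : Str} {y : Bool}
    (h : 0 < margin T fs x y) : vote T fs x = y := by
  rw [vote_eq]
  cases y
  · rw [margin_false_eq] at h
    simpa using h
  · simpa using h.le

theorem vote_singleton {a : ℝ} (ha : 0 < a) (T : ℕ) (f : Thinker) : vote T [(a, f)] = e2e f T := by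
  funext x
  refine vote_eq_of_margin_pos ?_
  simpa [margin] using ha

/-- Shorter votes are padded with voters of weight zero up to exactly `K`. -/
theorem vote_mem_voteClass {F : Set Thinker} {T K : ℕ} {fs : List (ℝ × Thinker)}
    (hfs : ∀ p ∈ fs, p.2 ∈ F) (hK : fs.length ≤ K) {f₀ : Thinker} (hf₀ : f₀ ∈ F) :
    vote T fs ∈ voteClass (e2eClass F T) K := by
  obtain ⟨l, hlen, hmem, hmargin⟩ : ∃ l : List (ℝ × Thinker), l.length = K ∧ (∀ p ∈ l, p.2 ∈ F) ∧
      ∀ x, margin T fs x true = margin T l x true := by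
    refine ⟨fs ++ List.replicate (K - fs.length) ((0 : ℝ), f₀), by simp; omega, fun p hp => ?_,
      fun x => by simp [margin]⟩
    rcases List.mem_append.1 hp with h | h
    · exact hfs p h
    · rw [List.eq_of_mem_replicate h]; exact hf₀
  subst hlen
  refine ⟨fun k => l[k.1].1, fun k => e2e l[k.1].2 T, fun k => ⟨_, hmem _ (List.getElem_mem _), rfl⟩, ?_⟩
  funext x
  rw [vote_eq]
  congr 2
  rw [hmargin, margin, ← Fin.sum_univ_getElem]
  simp only [List.getElem_map]
  exact Fintype.sum_equiv (finCongr (by simp)) _ _ fun i => by simp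

/-! ### The outcome of every run -/

/-- One thinker answers the whole request, so the premise of consistency is met even though that
thinker may depend on the drawn indices. -/
theorem attemptResult_mem {m : ℕ} (s : Setup m) {F : Set Thinker} {X : Set Str} {hstar : Thinker}
    (hrule : s.rule.Consistent F s.T) (hadv : s.adv.Valid F X s.T hstar) (H : List (Round m)) {n : ℕ}
    (t : Fin n → Fin m) :
    (s.attemptResult H t).1 ∈ F ∧ ∀ j, cot (s.attemptResult H t).1 s.T (s.xs (t j)) =
      cot (s.adv s.xs H (List.ofFn t)) s.T (s.xs (t j)) := by
  have hlist : ((List.ofFn t).map s.xs).zip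
      ((List.ofFn t).map fun i => cot (s.adv s.xs H (List.ofFn t)) s.T (s.xs i)) =
      (List.ofFn t).map fun i => (s.xs i, cot (s.adv s.xs H (List.ofFn t)) s.T (s.xs i)) := by
    rw [List.zip_map']
  have h := hrule ((List.ofFn t).map fun i => (s.xs i, cot (s.adv s.xs H (List.ofFn t)) s.T (s.xs i)))
    ⟨_, (hadv s.xs H (List.ofFn t)).1, by simp⟩
  simp only [Setup.attemptResult, hlist]
  refine ⟨h.1, fun j => ?_⟩
  exact (h.2 (s.xs (t j), _) (List.mem_map.2 ⟨t j, by simp [List.mem_ofFn], rfl⟩)).symm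

/-- The rounds `H'` extend `H` by at most `n` rounds of `M` requests. -/
def Extends {m : ℕ} (M n : ℕ) (H H' : List (Round m)) : Prop :=
  ∃ R : List (Round m), H' = R ++ H ∧ R.length ≤ n ∧ ∀ r ∈ R, r.queried.length = M

theorem Extends.refl {m : ℕ} (M n : ℕ) (H : List (Round m)) : Extends M n H H :=
  ⟨[], rfl, by simp, by simp⟩

theorem Extends.trans {m M a b n : ℕ} {H H' H'' : List (Round m)} (h : Extends M a H H')
    (h' : Extends M b H' H'') (hn : a + b ≤ n) : Extends M n H H'' := by
  obtain ⟨R, rfl, h1, h2⟩ := h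
  obtain ⟨R', rfl, h3, h4⟩ := h'
  refine ⟨R' ++ R, by simp, by simp; omega, fun r hr => ?_⟩
  rcases List.mem_append.1 hr with h | h
  exacts [h4 r h, h2 r h]

section Support

variable {m : ℕ} {s : Setup m} {F : Set Thinker} {X : Set Str} {hstar : Thinker}

theorem support_attempt (hrule : s.rule.Consistent F s.T) (hadv : s.adv.Valid F X s.T hstar)
    {D : PMF (Fin m)} {H : List (Round m)} {o : Thinker × List (Round m)}
    (ho : o ∈ (s.attempt D H).support) : o.1 ∈ F ∧ Extends s.M 1 H o.2 := by
  rw [Setup.attempt_eq, PMF.support_map] at ho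
  obtain ⟨t, -, rfl⟩ := ho
  exact ⟨(attemptResult_mem s hrule hadv H t).1, [_], rfl, by simp, by simp⟩

theorem support_weakLearn (hrule : s.rule.Consistent F s.T) (hadv : s.adv.Valid F X s.T hstar)
    {D : PMF (Fin m)} : ∀ {r : ℕ} {H : List (Round m)} {o : Thinker × List (Round m)},
    o ∈ (s.weakLearn D r H).support → o.1 ∈ F ∧ Extends s.M (r + 1) H o.2
  | 0, H, o, ho => support_attempt hrule hadv ho
  | r + 1, H, o, ho => by
    rw [Setup.weakLearn_succ, PMF.mem_support_bind_iff] at ho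
    obtain ⟨p, hp, ho⟩ := ho
    obtain ⟨h1, h2⟩ := support_attempt hrule hadv hp
    split_ifs at ho
    · rw [PMF.mem_support_pure_iff] at ho
      subst ho
      exact ⟨h1, h2.trans (Extends.refl s.M 0 _) (by omega)⟩
    · obtain ⟨h3, h4⟩ := support_weakLearn hrule hadv ho
      exact ⟨h3, h2.trans h4 (by omega)⟩

/-- Both exits produce a vote, an early return being the vote of a single predictor of weight one.
The bound `1 ≤ L` matters because one attempt plus up to `L - 1` repetitions make `L` only then. -/
theorem support_boost (hrule : s.rule.Consistent F s.T) (hadv : s.adv.Valid F X s.T hstar)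
    {L K : ℕ} (hL : 1 ≤ L) : ∀ {k : ℕ} {D : PMF (Fin m)} {fs : List (ℝ × Thinker)}
    {H : List (Round m)} {o : Thinker × List (Round m)}, (∀ p ∈ fs, p.2 ∈ F) → fs.length + k ≤ K →
    o ∈ (s.boost L k D fs H).support →
    o.1 ∈ voteClass (e2eClass F s.T) K ∧ Extends s.M (k * L) H o.2
  | 0, D, fs, H, o, hfs, hk, ho => by
    rw [Setup.boost_zero, PMF.mem_support_pure_iff] at ho
    subst ho
    exact ⟨vote_mem_voteClass hfs (by omega) (hadv s.xs H []).1, Extends.refl _ _ _⟩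
  | k + 1, D, fs, H, o, hfs, hk, ho => by
    rw [Setup.boost_succ, PMF.mem_support_bind_iff] at ho
    obtain ⟨p, hp, ho⟩ := ho
    obtain ⟨h1, h2⟩ := support_weakLearn hrule hadv hp
    have hL' : L - 1 + 1 = L := by omega
    rw [hL'] at h2
    split_ifs at ho
    · rw [PMF.mem_support_pure_iff] at ho
      subst ho
      refine ⟨?_, h2.trans (Extends.refl s.M (k * L) _) (by rw [add_mul]; omega)⟩
      rw [← vote_singleton one_pos]
      exact vote_mem_voteClass (by simpa using h1) (by simp; omega) h1
    · obtain ⟨h3, h4⟩ := support_boost (K := K) hrule hadv hL (by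
        intro q hq
        rcases List.mem_append.1 hq with h | h
        · exact hfs q h
        · rw [List.mem_singleton.1 h]; exact h1) (by simp; omega) ho
      exact ⟨h3, h2.trans h4 (by rw [add_mul]; omega)⟩

end Support

/-! ### Probability of success of the attempts -/

/-- Union bound in two stages: either the first stage falls into `A`, or the second fails from a
good start. -/
theorem toOuterMeasure_bind_le {α β : Type} (p : PMF α) (q : α → PMF β) {A : Set α} {B : Set β}
    {a b : ℝ≥0∞} (hA : p.toOuterMeasure A ≤ a)
    (hB : ∀ x ∈ p.support, x ∉ A → (q x).toOuterMeasure B ≤ b) :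
    (p.bind q).toOuterMeasure B ≤ a + b := by
  classical
  rw [PMF.toOuterMeasure_bind_apply]
  calc ∑' x, p x * (q x).toOuterMeasure B ≤ ∑' x, (A.indicator p x + p x * b) := by
        refine ENNReal.tsum_le_tsum fun x => ?_
        by_cases hx : x ∈ A
        · rw [Set.indicator_of_mem hx]
          have h1 : (q x).toOuterMeasure B ≤ 1 := by
            rw [PMF.toOuterMeasure_apply, ← (q x).tsum_coe]
            exact ENNReal.tsum_le_tsum fun y => Set.indicator_le_self _ _ _
          calc p x * (q x).toOuterMeasure B ≤ p x * 1 := by gcongr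
            _ ≤ _ := by rw [mul_one]; exact le_self_add
        · by_cases hs : x ∈ p.support
          · exact (mul_le_mul_right (hB x hs hx) _).trans le_add_self
          · rw [(p.apply_eq_zero_iff x).2 hs]; simp
    _ = p.toOuterMeasure A + b := by
        rw [ENNReal.tsum_add, ← PMF.toOuterMeasure_apply, ENNReal.tsum_mul_right, p.tsum_coe, one_mul]
    _ ≤ a + b := by gcongr

/-- Only outcomes in `A` can still lead to `B`, so failure probabilities multiply; this serves
repeated attempts. -/
theorem toOuterMeasure_bind_le_mul {α β : Type} (p : PMF α) (q : α → PMF β) {A : Set α} {B : Set β}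
    {a b : ℝ≥0∞} (hA : p.toOuterMeasure A ≤ a) (hA' : ∀ x ∈ A, (q x).toOuterMeasure B ≤ b)
    (hB : ∀ x ∉ A, (q x).toOuterMeasure B = 0) :
    (p.bind q).toOuterMeasure B ≤ a * b := by
  classical
  rw [PMF.toOuterMeasure_bind_apply]
  calc ∑' x, p x * (q x).toOuterMeasure B ≤ ∑' x, A.indicator p x * b := by
        refine ENNReal.tsum_le_tsum fun x => ?_
        by_cases hx : x ∈ A
        · rw [Set.indicator_of_mem hx]
          gcongr
          exact hA' x hx
        · rw [hB x hx]; simp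
    _ = p.toOuterMeasure A * b := by rw [ENNReal.tsum_mul_right, ← PMF.toOuterMeasure_apply]
    _ ≤ a * b := by gcongr

/-- Every attempt succeeds with probability at least `1 - 1 / e`. -/
def Setup.WeaklyLearns {m : ℕ} (s : Setup m) : Prop :=
  ∀ (D : PMF (Fin m)) (H : List (Round m)),
    (s.attempt D H).toOuterMeasure {o | ¬ s.error D o.1 ≤ 1 / 4} ≤ ENNReal.ofReal (Real.exp (-1))

theorem Setup.error_eq {m : ℕ} (s : Setup m) (D : PMF (Fin m)) (f : Thinker) :
    s.error D f = (D.toOuterMeasure {i | e2e f s.T (s.xs i) ≠ s.ys i}).toReal := by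
  classical
  rw [PMF.toOuterMeasure_apply_fintype, ENNReal.toReal_sum fun i _ => by
    rw [Set.indicator_apply]; split_ifs; exacts [D.apply_ne_top i, ENNReal.zero_ne_top]]
  refine Finset.sum_congr rfl fun i _ => ?_
  rw [Set.indicator_apply]
  by_cases h : e2e f s.T (s.xs i) ≠ s.ys i <;> simp [h]

theorem Setup.error_le_iff {m : ℕ} (s : Setup m) (D : PMF (Fin m)) (f : Thinker) {b : ℝ}
    (hb : 0 ≤ b) : s.error D f ≤ b ↔
      D.toOuterMeasure {i | e2e f s.T (s.xs i) ≠ s.ys i} ≤ ENNReal.ofReal b := by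
  rw [Setup.error_eq]
  refine (ENNReal.le_ofReal_iff_toReal_le (ne_top_of_le_ne_top ENNReal.one_ne_top ?_) hb).symm
  rw [PMF.toOuterMeasure_apply, ← D.tsum_coe]
  exact ENNReal.tsum_le_tsum fun y => Set.indicator_le_self _ _ _

section Attempts

variable {m : ℕ} {s : Setup m} {F : Set Thinker} {X : Set Str} {hstar : Thinker}

/-- Equal chains of thought have equal last tokens, and the thinker's last tokens are the labels of
`hstar`. The predictor thus fits `hstar` on the draw, a statement from which the adversary's choice
has disappeared, and uniform convergence over the end-to-end class applies. -/
theorem weaklyLearns_of_vcDim (hrule : s.rule.Consistent F s.T) (hadv : s.adv.Valid F X s.T hstar)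
    (hT : 1 ≤ s.T) (hxs : ∀ i, s.xs i ∈ X) (hys : ∀ i, s.ys i = hstar (s.xs i))
    (hstarF : hstar ∈ e2eClass F s.T) {c v : ℕ} (hc : 12 ≤ c)
    (hv : vcDim (e2eClass F s.T) X ≤ v) (hM : s.M = 8 * c * v) : s.WeaklyLearns := by
  intro D H
  rw [Setup.attempt_eq, PMF.toOuterMeasure_map_apply]
  have h := weak_uniform_convergence (g := hstar ∘ s.xs) D
    (H := (fun h => h ∘ s.xs) '' e2eClass F s.T) ⟨hstar, hstarF, rfl⟩
    (vcDim_comp_le hv s.xs (Y := D.support) fun i _ => hxs i) hc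
  rw [← hM] at h
  refine le_trans (PMF.toOuterMeasure_mono _ ?_) h
  rintro t ⟨ht, -⟩
  obtain ⟨h1, h2⟩ := attemptResult_mem s hrule hadv H t
  refine ⟨_, ⟨e2e (s.attemptResult H t).1 s.T, ⟨_, h1, rfl⟩, rfl⟩, fun j => ?_, ?_⟩
  · simp only [Function.comp_apply]
    rw [e2e_eq_of_cot_eq hT (h2 j)]
    exact (hadv _ _ _).2 _ (hxs _)
  · have ht : ¬ s.error D (s.attemptResult H t).1 ≤ 1 / 4 := ht
    rw [Setup.error_le_iff _ _ _ (by norm_num), not_le] at ht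
    simpa [hys] using ht

/-- The thinker `f` does not depend on the draw, so the pairs of inputs and chains of thought of `f`
are i.i.d. The loss of the predictor vanishes on them like that of `f`, and small loss forces small
end-to-end error. -/
theorem weaklyLearns_of_relaxed (hrule : s.rule.Consistent F s.T)
    (hadv : s.adv.Valid F X s.T hstar) (hrel : s.adv.Relaxed)
    (hT : 1 ≤ s.T) (hxs : ∀ i, s.xs i ∈ X) (hys : ∀ i, s.ys i = hstar (s.xs i))
    {c v : ℕ} (hc : 12 ≤ c)
    (hv : vcDim (cotLossClass F s.T) (traceDomain X s.T) ≤ v) (hM : s.M = 8 * c * v) :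
    s.WeaklyLearns := by
  intro D H
  rw [Setup.attempt_eq, PMF.toOuterMeasure_map_apply]
  set f := s.adv s.xs H [] with hf
  have hfS : ∀ S, s.adv s.xs H S = f := fun S => hrel _ _ _ _
  have hfF := hadv s.xs H []
  rw [← hf] at hfF
  set φ : Fin m → Str × Str := fun i => (s.xs i, cot f s.T (s.xs i)) with hφ
  have h := weak_uniform_convergence D (H := (fun h => h ∘ φ) '' cotLossClass F s.T)
    (g := (fun p : Str × Str => decide (p.2 ≠ cot f s.T p.1)) ∘ φ) ⟨_, ⟨f, hfF.1, rfl⟩, rfl⟩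
    (vcDim_comp_le hv φ (Y := D.support) fun i _ => ⟨hxs i, length_cot _ _ _⟩) hc
  rw [← hM] at h
  refine le_trans (PMF.toOuterMeasure_mono _ ?_) h
  rintro t ⟨ht, -⟩
  obtain ⟨h1, h2⟩ := attemptResult_mem s hrule hadv H t
  refine ⟨_, ⟨_, ⟨(s.attemptResult H t).1, h1, rfl⟩, rfl⟩, fun j => ?_, ?_⟩
  · simp only [Function.comp_apply, hφ, h2, hfS]
  · have ht : ¬ s.error D (s.attemptResult H t).1 ≤ 1 / 4 := ht
    rw [Setup.error_le_iff _ _ _ (by norm_num), not_le] at ht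
    refine ht.trans_le (PMF.toOuterMeasure_mono _ ?_)
    rintro i ⟨hi, -⟩
    have hne : cot f s.T (s.xs i) ≠ cot (s.attemptResult H t).1 s.T (s.xs i) := by
      intro heq
      apply hi
      rw [← e2e_eq_of_cot_eq hT heq, hys]
      exact hfF.2 _ (hxs i)
    simpa [hφ] using hne

/-- The bound for one attempt holds after every history, so failures multiply although the adversary
adapts to earlier attempts. -/
theorem Setup.WeaklyLearns.weakLearn (hw : s.WeaklyLearns) (D : PMF (Fin m)) :
    ∀ (r : ℕ) (H : List (Round m)),
      (s.weakLearn D r H).toOuterMeasure {o | ¬ s.error D o.1 ≤ 1 / 4} ≤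
        ENNReal.ofReal (Real.exp (-1)) ^ (r + 1)
  | 0, H => by rw [zero_add, pow_one]; exact hw D H
  | r + 1, H => by
    rw [Setup.weakLearn_succ, pow_succ']
    refine toOuterMeasure_bind_le_mul _ _ (hw D H) (fun o ho => ?_) fun o ho => ?_
    · rw [if_neg ho]
      exact hw.weakLearn D r o.2
    · have ho : s.error D o.1 ≤ 1 / 4 := not_not.1 ho
      rw [if_pos ho]
      simpa using ho

end Attempts

/-! ### The training error of the vote -/

theorem toReal_reweight {m : ℕ} (D : PMF (Fin m)) (w : Fin m → ℝ) (i : Fin m) :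
    (reweight D w i).toReal =
      (D i).toReal * Real.exp (w i) / ∑ j, (D j).toReal * Real.exp (w j) := by
  rw [reweight, PMF.normalize_apply, ENNReal.toReal_mul, ENNReal.toReal_inv, tsum_fintype,
    ENNReal.toReal_sum fun j _ => ENNReal.mul_ne_top (D.apply_ne_top j) ENNReal.ofReal_ne_top,
    ENNReal.toReal_mul, ENNReal.toReal_ofReal (Real.exp_pos _).le, div_eq_mul_inv]
  congr 2
  exact Finset.sum_congr rfl fun j _ => by
    rw [ENNReal.toReal_mul, ENNReal.toReal_ofReal (Real.exp_pos _).le]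

theorem sum_toReal {m : ℕ} (D : PMF (Fin m)) : ∑ i, (D i).toReal = 1 := by
  rw [← ENNReal.toReal_sum fun i _ => D.apply_ne_top i, ← tsum_fintype (L := .unconditional _),
    D.tsum_coe, ENNReal.toReal_one]

/-- The normalization factor of a reweighting step. -/
theorem sum_reweight {m : ℕ} (s : Setup m) (D : PMF (Fin m)) (f : Thinker) (a : ℝ) :
    ∑ j, (D j).toReal * Real.exp (if e2e f s.T (s.xs j) ≠ s.ys j then a else -a) =
      s.error D f * Real.exp a + (1 - s.error D f) * Real.exp (-a) := by
  rw [← sum_toReal D, Setup.error, sub_mul, Finset.sum_mul, Finset.sum_mul, Finset.sum_mul,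
    ← Finset.sum_sub_distrib, ← Finset.sum_add_distrib]
  refine Finset.sum_congr rfl fun j _ => ?_
  split_ifs <;> ring

/-- For this weight both summands equal `√(e (1 - e))`, and `4 e (1 - e) ≤ 3/4` for `e ≤ 1/4`. -/
theorem normalizer_le {e : ℝ} (he0 : 0 < e) (he : e ≤ 1 / 4) :
    e * Real.exp (Setup.voteWeight e) + (1 - e) * Real.exp (-Setup.voteWeight e) ≤ √(3 / 4) := by
  have hne : e ≠ 1 := by linarith
  set t := Real.exp (Setup.voteWeight e) with ht
  have ht0 : 0 < t := Real.exp_pos _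
  have ht2 : t ^ 2 = (1 - e) / e := by
    rw [ht, ← Real.exp_nat_mul, Setup.voteWeight, if_neg hne]
    push_cast
    rw [← mul_assoc, show (2 : ℝ) * (1 / 2) = 1 by norm_num, one_mul, Real.exp_log]
    exact div_pos (by linarith) he0
  have h1 : 1 - e = e * t ^ 2 := by rw [ht2]; field_simp
  rw [Real.exp_neg, ← ht, h1]
  refine Real.le_sqrt_of_sq_le ?_
  have h2 : e * t + e * t ^ 2 * t⁻¹ = 2 * (e * t) := by field_simp; norm_num
  rw [h2, mul_pow, mul_pow, sq e, mul_assoc, ← h1]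
  nlinarith

/-- `Z` is the product of the normalizers so far, equal to the average of exp(-margin) over the
training set. Each successful inner loop shrinks it by `√(3/4)`, so the last hypothesis makes all
final margins positive; unsuccessful inner loops are paid for by the union bound. -/
theorem Setup.WeaklyLearns.boost {m : ℕ} {s : Setup m} (hw : s.WeaklyLearns) {L : ℕ} (hL : 1 ≤ L) :
    ∀ (k : ℕ) (D : PMF (Fin m)) (fs : List (ℝ × Thinker)) (H : List (Round m)) (Z : ℝ), 0 ≤ Z →
      (∀ i, (D i).toReal * Z * m = Real.exp (-margin s.T fs (s.xs i) (s.ys i))) →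
      Z * √(3 / 4) ^ k * m < 1 →
      (s.boost L k D fs H).toOuterMeasure {o | ∃ i, o.1 (s.xs i) ≠ s.ys i} ≤
        k * ENNReal.ofReal (Real.exp (-1)) ^ L
  | 0, D, fs, H, Z, hZ, hD, hlt => by
    rw [Setup.boost_zero]
    simp only [PMF.toOuterMeasure_pure_apply]
    rw [if_neg]
    · exact zero_le
    · rintro ⟨i, hi⟩
      apply hi
      refine vote_eq_of_margin_pos ?_
      have h1 : Real.exp (-margin s.T fs (s.xs i) (s.ys i)) < 1 := by
        rw [← hD]
        refine lt_of_le_of_lt ?_ hlt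
        have h2 : (D i).toReal ≤ 1 := by
          rw [← ENNReal.toReal_one]
          exact ENNReal.toReal_mono ENNReal.one_ne_top (D.coe_le_one i)
        rw [pow_zero, mul_one]
        have h3 : 0 ≤ Z * m := by positivity
        nlinarith
      rw [Real.exp_lt_one_iff] at h1
      linarith
  | k + 1, D, fs, H, Z, hZ, hD, hlt => by
    rw [Setup.boost_succ, Nat.cast_succ, add_comm (k : ℝ≥0∞), add_mul, one_mul]
    have hwl := hw.weakLearn D (L - 1) H
    rw [show L - 1 + 1 = L by omega] at hwl
    refine toOuterMeasure_bind_le _ _ hwl fun o _ ho => ?_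
    have ho : s.error D o.1 ≤ 1 / 4 := not_not.1 ho
    -- The invariant gives `D` full support, so weighted error zero means that no training example
    -- is misclassified.
    have hpos : ∀ i, 0 < (D i).toReal := by
      intro i
      by_contra h0
      have h1 := Real.exp_pos (-margin s.T fs (s.xs i) (s.ys i))
      rw [← hD i, le_antisymm (not_lt.1 h0) ENNReal.toReal_nonneg, zero_mul, zero_mul] at h1
      exact h1.false
    have herr0 : 0 ≤ s.error D o.1 := Finset.sum_nonneg fun i _ => by positivity
    by_cases h0 : s.error D o.1 = 0
    · rw [if_pos h0]
      simp only [PMF.toOuterMeasure_pure_apply]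
      rw [if_neg]
      · exact zero_le
      · rintro ⟨i, hi⟩
        rw [Setup.error, Finset.sum_eq_zero_iff_of_nonneg fun i _ => by positivity] at h0
        have := h0 i (Finset.mem_univ i)
        rw [if_pos hi, mul_one] at this
        exact (hpos i).ne' this
    · rw [if_neg h0]
      set a := Setup.voteWeight (s.error D o.1) with ha
      have hN := normalizer_le (lt_of_le_of_ne herr0 (Ne.symm h0)) ho
      rw [← ha] at hN
      have hsum := sum_reweight s D o.1 a
      have hN0 : 0 < ∑ j, (D j).toReal *
          Real.exp (if e2e o.1 s.T (s.xs j) ≠ s.ys j then a else -a) := by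
        rw [hsum]
        have h1 := Real.exp_pos a
        have h2 := Real.exp_pos (-a)
        have : 0 < 1 - s.error D o.1 := by linarith
        positivity
      refine hw.boost hL k _ _ _ (Z * ∑ j, (D j).toReal *
          Real.exp (if e2e o.1 s.T (s.xs j) ≠ s.ys j then a else -a)) (by positivity) ?_ ?_
      · intro i
        rw [toReal_reweight, margin_append, neg_add, Real.exp_add, ← hD i]
        have hexp : Real.exp (if e2e o.1 s.T (s.xs i) ≠ s.ys i then a else -a) =
            Real.exp (-(a * if e2e o.1 s.T (s.xs i) = s.ys i then 1 else -1)) := by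
          by_cases h : e2e o.1 s.T (s.xs i) = s.ys i <;> simp [h]
        rw [← hexp]
        field_simp
      · refine lt_of_le_of_lt ?_ hlt
        rw [hsum, pow_succ]
        have h3 : 0 ≤ Z * √(3 / 4) ^ k * m := by positivity
        calc _ = Z * √(3 / 4) ^ k * m * (s.error D o.1 * Real.exp a +
              (1 - s.error D o.1) * Real.exp (-a)) := by ring
          _ ≤ Z * √(3 / 4) ^ k * m * √(3 / 4) := mul_le_mul_of_nonneg_left hN h3
          _ = _ := by ring

theorem outerIters_pos {m : ℕ} (hm : 2 ≤ m) : 1 ≤ outerIters m := by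
  refine Nat.one_le_iff_ne_zero.2 (Nat.ceil_pos.2 ?_).ne'
  have : 0 < Real.log m := Real.log_pos (by exact_mod_cast hm)
  positivity

/-- As `log (3/4) < -1/4`, the logarithm of `√(3/4)` is below `-1/8`, which the factor 8 in the
number of iterations turns into `-log m`. -/
theorem sqrt_pow_outerIters_lt {m : ℕ} (hm : 2 ≤ m) : √(3 / 4) ^ outerIters m * m < 1 := by
  have hm0 : (0 : ℝ) < m := by positivity
  have hlog : 0 < Real.log m := Real.log_pos (by exact_mod_cast hm)
  have hq : (0 : ℝ) < √(3 / 4) := by positivity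
  rw [← Real.log_lt_log_iff (by positivity) one_pos, Real.log_one,
    Real.log_mul (by positivity) hm0.ne', Real.log_pow, Real.log_sqrt (by norm_num)]
  have h1 : Real.log (3 / 4) < 3 / 4 - 1 := Real.log_lt_sub_one_of_pos (by norm_num) (by norm_num)
  have h2 : 8 * Real.log m ≤ outerIters m := Nat.le_ceil _
  nlinarith

theorem innerIters_pos {m : ℕ} (hm : 2 ≤ m) {δ : ℝ} (hδ : 0 < δ) (hδ1 : δ < 1) :
    1 ≤ innerIters m δ := by
  refine Nat.one_le_iff_ne_zero.2 (Nat.ceil_pos.2 (Real.log_pos ?_)).ne'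
  have : (1 : ℝ) ≤ outerIters m := by exact_mod_cast outerIters_pos hm
  rw [lt_div_iff₀ hδ]
  linarith

/-- By the choice of `L`, one inner loop fails with probability at most `δ / (2 K)`. -/
theorem mul_exp_innerIters_le {m : ℕ} (hm : 2 ≤ m) {δ : ℝ} (hδ : 0 < δ) :
    (outerIters m : ℝ≥0∞) * ENNReal.ofReal (Real.exp (-1)) ^ innerIters m δ ≤
      ENNReal.ofReal (δ / 2) := by
  have hK : (1 : ℝ) ≤ outerIters m := by exact_mod_cast outerIters_pos hm
  rw [← ENNReal.ofReal_pow (Real.exp_pos _).le, ← Real.exp_nat_mul, ← ENNReal.ofReal_natCast,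
    ← ENNReal.ofReal_mul (by positivity)]
  refine ENNReal.ofReal_le_ofReal ?_
  have h1 : Real.log (2 * outerIters m / δ) ≤ innerIters m δ := Nat.le_ceil _
  have h2 : Real.exp ((innerIters m δ : ℝ) * -1) ≤ δ / (2 * outerIters m) := by
    rw [mul_neg_one, Real.exp_neg, ← inv_div]
    refine inv_anti₀ (by positivity) ?_
    rw [← Real.log_le_iff_le_exp (by positivity)]
    exact h1
  calc _ ≤ (outerIters m : ℝ) * (δ / (2 * outerIters m)) := by gcongr
    _ = δ / 2 := by field_simp

theorem adaBoost_fail_le {m : ℕ} [NeZero m] {s : Setup m} (hw : s.WeaklyLearns) (hm : 2 ≤ m) {δ : ℝ}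
    (hδ : 0 < δ) (hδ1 : δ < 1) :
    (s.adaBoost (outerIters m) (innerIters m δ)).toOuterMeasure {o | ∃ i, o.1 (s.xs i) ≠ s.ys i} ≤
      ENNReal.ofReal (δ / 2) := by
  refine le_trans (hw.boost (innerIters_pos hm hδ hδ1) _ _ _ _ 1 zero_le_one ?_ ?_)
    (mul_exp_innerIters_le hm hδ)
  · intro i
    have : (m : ℝ) ≠ 0 := by exact_mod_cast NeZero.ne m
    simp [PMF.uniformOfFintype_apply, margin, this]
  · rw [one_mul]
    exact sqrt_pow_outerIters_lt hm

/-! ### Sample sizes -/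

theorem sampleSize_pos_bounds {c v : ℕ} {ε δ : ℝ} {m : ℝ} (hε : 0 < ε) (hε1 : ε < 1)
    (hm : sampleSize c v ε δ ≤ m) (hδ : 0 < δ) (hδ1 : δ < 1) :
    c * Real.log (2 / δ) ≤ m * ε ∧
      c * (v * Real.log (2 / ε) * Real.log (2 * v / ε) ^ 2) ≤ m * ε := by
  have h1 : 0 ≤ Real.log (2 / δ) := Real.log_nonneg (by rw [le_div_iff₀ hδ]; linarith)
  have h2 : 0 ≤ Real.log (2 / ε) := Real.log_nonneg (by rw [le_div_iff₀ hε]; linarith)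
  have h3 : (0 : ℝ) ≤ v * Real.log (2 / ε) * Real.log (2 * v / ε) ^ 2 := by positivity
  rw [sampleSize, mul_div_assoc', div_le_iff₀ hε] at hm
  have hc : (0 : ℝ) ≤ c := Nat.cast_nonneg c
  constructor <;> nlinarith

theorem two_le_of_sampleSize_le {c v m : ℕ} {ε δ : ℝ} (hε : 0 < ε) (hε1 : ε < 1) (hδ : 0 < δ)
    (hδ1 : δ < 1) (hc : 2 ≤ c) (hm : sampleSize c v ε δ ≤ m) : 2 ≤ m := by
  have h1 := (sampleSize_pos_bounds hε hε1 hm hδ hδ1).1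
  have h2 : Real.log 2 ≤ Real.log (2 / δ) :=
    Real.log_le_log (by norm_num) (by rw [le_div_iff₀ hδ]; linarith)
  have h3 := Real.log_two_gt_d9
  have hc' : (2 : ℝ) ≤ c := by exact_mod_cast hc
  have hm0 : (0 : ℝ) ≤ m := Nat.cast_nonneg m
  have h4 : (1 : ℝ) < m := by nlinarith
  exact_mod_cast h4

/-- Write `log t` as four times the logarithm of the fourth root and use `log s ≤ s`. -/
theorem sq_log_le {t : ℝ} (ht : 1 ≤ t) : Real.log t ^ 2 ≤ 16 * √t := by
  have h0 : 0 < t := by linarith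
  have h1 : Real.log t = 4 * Real.log (√(√t)) := by
    rw [Real.log_sqrt (by positivity), Real.log_sqrt (by positivity)]; ring
  have h2 : 1 ≤ √(√t) := Real.one_le_sqrt.2 (Real.one_le_sqrt.2 ht)
  have h3 : 0 ≤ Real.log (√(√t)) := Real.log_nonneg h2
  have h4 : Real.log (√(√t)) ≤ √(√t) := (Real.log_le_sub_one_of_pos (by positivity)).trans (by linarith)
  have h5 : √(√t) ^ 2 = √t := Real.sq_sqrt (by positivity)
  have h6 : Real.log (√(√t)) ^ 2 ≤ √(√t) ^ 2 := pow_le_pow_left₀ h3 h4 2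
  rw [h1, mul_pow]
  linarith

/-- Inverts the sample size condition. With `A = 2 v / ε` and `t = m ε / (2 v)` one has `m = A t`.
The hypothesis makes `log² A` a small multiple of `t`, and `log² t` is of order at most `√t`,
negligible because `t` is large. -/
theorem sq_log_sampleSize_le {c v : ℕ} {m : ℕ} {ε : ℝ} (hε : 0 < ε) (hε1 : ε < 1)
    (hc : 2 ^ 30 ≤ c) (hv : 1 ≤ v)
    (h : c * (v * Real.log (2 / ε) * Real.log (2 * v / ε) ^ 2) ≤ m * ε) :
    v * Real.log m ^ 2 ≤ m * ε / 144 := by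
  have hv1 : (1 : ℝ) ≤ v := by exact_mod_cast hv
  have hc' : (2 ^ 30 : ℝ) ≤ c := by exact_mod_cast hc
  set A : ℝ := 2 * v / ε with hA
  have hA2 : 2 ≤ A := by rw [hA, le_div_iff₀ hε]; nlinarith
  have hl2 := Real.log_two_gt_d9
  have hlA : Real.log 2 ≤ Real.log A := Real.log_le_log (by norm_num) hA2
  have hlε : Real.log 2 ≤ Real.log (2 / ε) :=
    Real.log_le_log (by norm_num) (by rw [le_div_iff₀ hε]; linarith)
  set t : ℝ := m * ε / (2 * v) with ht
  have hmt : (m : ℝ) * ε = 2 * v * t := by rw [ht]; field_simp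
  have hmAt : (m : ℝ) = A * t := by rw [hA, ht]; field_simp
  have hA0 : 0 ≤ Real.log A ^ 2 := sq_nonneg _
  have htA : c / 3 * Real.log A ^ 2 ≤ t := by
    have h1 : c * (v * (2 / 3) * Real.log A ^ 2) ≤ 2 * v * t := by
      rw [← hmt]
      refine le_trans ?_ h
      gcongr
      linarith
    nlinarith
  have hAge : 0.48 ≤ Real.log A ^ 2 := by nlinarith
  -- From `t ≥ c / 3 * 0.48` and `c ≥ 2 ^ 30`.
  have ht1 : 2 ^ 26 ≤ t := by nlinarith
  have ht0 : 0 < t := by linarith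
  have hsqrt : (2 : ℝ) ^ 13 ≤ √t := by
    rw [show (2 : ℝ) ^ 13 = √((2 ^ 13) ^ 2) by rw [Real.sqrt_sq (by positivity)]]
    exact Real.sqrt_le_sqrt (by norm_num at ht1 ⊢; exact ht1)
  have hlogt := sq_log_le (show 1 ≤ t by linarith)
  have h3 : √t * √t = t := Real.mul_self_sqrt ht0.le
  -- This needs `√t ≥ 32 * 144 = 4608`, which `2 ^ 13` exceeds.
  have h4 : 32 * √t ≤ t / 144 := by nlinarith
  have h5 : 2 * Real.log A ^ 2 ≤ t / 144 := by nlinarith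
  have h6 : Real.log m ^ 2 ≤ t / 72 := by
    rw [hmAt, Real.log_mul (by positivity) ht0.ne']
    nlinarith [sq_nonneg (Real.log A - Real.log t)]
  rw [hmt]
  nlinarith

/-- Take `k = ⌊m ε / 2⌋`. Since `log 2 < 1`, `2 ^ k (1 - ε / 2) ^ m` decays exponentially in `m ε`.
The logarithm of the growth is at most `36 v log² m ≤ m ε / 4`, while `k log 2` is about `0.35 m ε`;
the gap pays for `log (2 / δ)`. -/
theorem numerics {c v m : ℕ} {ε δ : ℝ} (hε : 0 < ε) (hε1 : ε < 1) (hδ : 0 < δ) (hδ1 : δ < 1)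
    (hc : 2 ^ 30 ≤ c) (hv : 1 ≤ v) (hm : sampleSize c v ε δ ≤ m) :
    ∃ k : ℕ, (2 : ℝ) ^ k * (1 - ε / 2) ^ m ≤ 1 / 2 ∧
      2 * (((2 * m + 1) ^ (outerIters m * (v + 1)) : ℕ) : ℝ) ≤ δ / 2 * 2 ^ k := by
  obtain ⟨h1, h2⟩ := sampleSize_pos_bounds hε hε1 hm hδ hδ1
  have hlog := sq_log_sampleSize_le hε hε1 hc hv h2
  have hv1 : (1 : ℝ) ≤ v := by exact_mod_cast hv
  have hc' : (2 ^ 30 : ℝ) ≤ c := by exact_mod_cast hc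
  have hl2 := Real.log_two_gt_d9
  have hl2' := Real.log_two_lt_d9
  have hδ2 : Real.log 2 ≤ Real.log (2 / δ) :=
    Real.log_le_log (by norm_num) (by rw [le_div_iff₀ hδ]; linarith)
  have hmε : 2 ^ 29 ≤ m * ε := by nlinarith
  have hm0 : (0 : ℝ) ≤ m := Nat.cast_nonneg m
  have hm3 : (2 ^ 29 : ℝ) ≤ m := by nlinarith
  have hm1 : 1 ≤ Real.log m := by
    rw [Real.le_log_iff_exp_le (by linarith)]
    linarith [Real.exp_one_lt_d9]
  have hmpos : (0 : ℝ) < m := by linarith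
  refine ⟨⌊m * ε / 2⌋₊, ?_, ?_⟩
  · have hk : (⌊m * ε / 2⌋₊ : ℝ) ≤ m * ε / 2 := Nat.floor_le (by positivity)
    have h3 : 0 < 1 - ε / 2 := by linarith
    have h4 : Real.log (1 - ε / 2) ≤ -(ε / 2) :=
      (Real.log_le_sub_one_of_pos h3).trans (by linarith)
    rw [← Real.log_le_log_iff (by positivity) (by norm_num), Real.log_mul (by positivity) (by positivity),
      Real.log_pow, Real.log_pow, one_div, Real.log_inv]
    nlinarith
  · have hk : m * ε / 2 < ⌊m * ε / 2⌋₊ + 1 := Nat.lt_floor_add_one _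
    rw [← Real.log_le_log_iff (by positivity) (by positivity), Real.log_mul (by norm_num) (by positivity),
      Real.log_mul (by positivity) (by positivity), Real.log_pow, Nat.cast_pow, Real.log_pow]
    have h5 : Real.log (δ / 2) = -Real.log (2 / δ) := by rw [← inv_div, Real.log_inv]
    rw [h5]
    have hK : (outerIters m : ℝ) ≤ 9 * Real.log m := by
      have : (outerIters m : ℝ) < 8 * Real.log m + 1 := Nat.ceil_lt_add_one (by linarith)
      linarith
    have h6 : Real.log ((2 * m + 1 : ℕ) : ℝ) ≤ 2 * Real.log m := by
      rw [show (2 : ℝ) * Real.log m = Real.log (m ^ 2) by rw [Real.log_pow]; norm_num]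
      refine Real.log_le_log (by positivity) ?_
      push_cast
      nlinarith
    -- The factor 36 collects `K ≤ 9 log m`, `v + 1 ≤ 2 v` and `log (2 m + 1) ≤ 2 log m`.
    have h7 : ((outerIters m * (v + 1) : ℕ) : ℝ) * Real.log ((2 * m + 1 : ℕ) : ℝ) ≤
        36 * (v * Real.log m ^ 2) := by
      push_cast at h6 ⊢
      calc _ ≤ (9 * Real.log m * (2 * v)) * (2 * Real.log m) := by
            refine mul_le_mul ?_ h6 (Real.log_nonneg (by linarith)) (by positivity)
            exact mul_le_mul hK (by linarith) (by positivity) (by positivity)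
        _ = _ := by ring
    nlinarith

/-! ### Generalization -/

theorem succeeds_of_fail_le {T : ℕ} {D : PMF Str} {hstar : Thinker} {m : ℕ} [NeZero m]
    {rule : CoTRule} {adv : Adversary m} {F : Set Thinker} {X : Set Str} {M : ℕ} {ε δ : ℝ}
    (hδ : 0 < δ) (hδ1 : δ < 1) (hm : 2 ≤ m) (hrule : rule.Consistent F T)
    (hadv : adv.Valid F X T hstar)
    (h : (experiment T D hstar m rule adv M δ).toOuterMeasure
      {o | ¬ risk D hstar o.1 ≤ ENNReal.ofReal ε} ≤ ENNReal.ofReal δ) :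
    Succeeds T D hstar m rule adv M ε δ := by
  constructor
  · rw [ENNReal.ofReal_sub _ hδ.le, ENNReal.ofReal_one, tsub_le_iff_right]
    set P := experiment T D hstar m rule adv M δ
    calc (1 : ℝ≥0∞) = P.toOuterMeasure Set.univ :=
          ((P.toOuterMeasure_apply_eq_one_iff _).2 (Set.subset_univ _)).symm
      _ ≤ P.toOuterMeasure {o | risk D hstar o.1 ≤ ENNReal.ofReal ε} +
          P.toOuterMeasure {o | ¬ risk D hstar o.1 ≤ ENNReal.ofReal ε} := by
          refine le_trans (le_of_eq ?_) (MeasureTheory.measure_union_le _ _)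
          congr 1
          ext o
          simp [le_or_gt]
      _ ≤ _ := by gcongr
  · intro o ho
    rw [experiment, PMF.mem_support_bind_iff] at ho
    obtain ⟨xs, -, ho⟩ := ho
    obtain ⟨-, R, hR, h1, h2⟩ := support_boost (K := outerIters m)
      (s := Setup.mk T xs (fun i => hstar (xs i)) rule adv M) hrule hadv
      (innerIters_pos hm hδ hδ1) (by simp) (by simp) ho
    rw [List.append_nil] at hR
    rw [hR]
    exact ⟨h1, fun r hr => (h2 r hr).le⟩

/-- When all of `F` labels the sample alike, the first weak learner has error 0 and is returned at
once. -/
theorem support_boost_of_unique {m : ℕ} {s : Setup m} {F : Set Thinker} {X : Set Str}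
    {hstar : Thinker} (hrule : s.rule.Consistent F s.T) (hadv : s.adv.Valid F X s.T hstar)
    (huniq : ∀ f ∈ F, ∀ i, e2e f s.T (s.xs i) = s.ys i)
    {L k : ℕ} {D : PMF (Fin m)} {fs : List (ℝ × Thinker)} {H : List (Round m)}
    {o : Thinker × List (Round m)} (ho : o ∈ (s.boost L (k + 1) D fs H).support) :
    ∃ f ∈ F, o.1 = e2e f s.T := by
  rw [Setup.boost_succ, PMF.mem_support_bind_iff] at ho
  obtain ⟨p, hp, ho⟩ := ho
  have hF := (support_weakLearn hrule hadv hp).1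
  rw [if_pos (by simp [Setup.error, huniq p.1 hF]), PMF.mem_support_pure_iff] at ho
  exact ⟨p.1, hF, by rw [ho]⟩

/-- Two failures of probability at most `δ / 2` each: some vote fits the sample but has risk above
`ε`, or boosting does not fit the sample. The first event concerns all votes simultaneously, so it
is irrelevant how adaptive answers select the returned one. -/
theorem succeeds {F : Set Thinker} {T : ℕ} {X : Set Str} {c v : ℕ}
    (hc : 2 ^ 30 ≤ c) (hv : vcDim (e2eClass F T) X = v) {ε δ : ℝ}
    (hε : 0 < ε) (hε1 : ε < 1) (hδ : 0 < δ) (hδ1 : δ < 1) {m : ℕ} [NeZero m]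
    (hm : sampleSize c v ε δ ≤ m) {D : PMF Str} (hD : D.support ⊆ X) {hstar : Thinker}
    (hstarF : hstar ∈ e2eClass F T) {rule : CoTRule} (hrule : rule.Consistent F T)
    {adv : Adversary m} (hadv : adv.Valid F X T hstar) {M : ℕ}
    (hweak : ∀ xs : Fin m → Str, (∀ i, xs i ∈ X) →
      (Setup.mk T xs (fun i => hstar (xs i)) rule adv M).WeaklyLearns) :
    Succeeds T D hstar m rule adv M ε δ := by
  have hm2 : 2 ≤ m := two_le_of_sampleSize_le hε hε1 hδ hδ1 ((by norm_num : 2 ≤ 2 ^ 30).trans hc) hm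
  refine succeeds_of_fail_le hδ hδ1 hm2 hrule hadv ?_
  rcases Nat.eq_zero_or_pos v with rfl | hv1
  -- In dimension 0 the estimate `numerics` is not available, but all end-to-end maps agree with
  -- `hstar` on `X` and failure is impossible.
  · refine le_of_eq_of_le ?_ zero_le
    rw [PMF.toOuterMeasure_apply_eq_zero_iff, Set.disjoint_left]
    intro o ho hbad
    rw [experiment, PMF.mem_support_bind_iff] at ho
    obtain ⟨xs, hxs, ho⟩ := ho
    have huniq : ∀ f ∈ F, ∀ x ∈ X, e2e f T x = hstar x := fun f hf x hx =>
      eq_of_vcDim_le_zero hv.le hstarF ⟨f, hf, rfl⟩ hx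
    obtain ⟨k, hk⟩ := Nat.exists_eq_add_of_le' (outerIters_pos hm2)
    rw [hk] at ho
    obtain ⟨f, hf, hof⟩ := support_boost_of_unique
      (s := Setup.mk T xs (fun i => hstar (xs i)) rule adv M) hrule hadv
      (fun f hf i => huniq f hf _ (hD (support_iid D hxs i))) ho
    apply hbad
    refine le_of_eq_of_le ?_ zero_le
    rw [risk, PMF.toOuterMeasure_apply_eq_zero_iff, Set.disjoint_left]
    intro x hx hne
    exact hne (by rw [hof]; exact huniq f hf x (hD hx))
  · obtain ⟨k, hk1, hk2⟩ := numerics hε hε1 hδ hδ1 hc hv1 hm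
    have hUC := uniform_convergence D (voteClass (e2eClass F T) (outerIters m)) hstar m k _ ε hε1.le
      (fun U hU hcard => (card_traces_voteClass_le hv.le (hU.trans hD) _).trans
        (Nat.pow_le_pow_left (show U.card + 1 ≤ 2 * m + 1 by omega) _)) hk1
    have hA := le_ofReal_of_mul_two_pow_le hUC hk2
    have hhalf : ENNReal.ofReal δ = ENNReal.ofReal (δ / 2) + ENNReal.ofReal (δ / 2) := by
      rw [← ENNReal.ofReal_add (by positivity) (by positivity), add_halves]
    rw [hhalf, experiment]
    refine toOuterMeasure_bind_le _ _ hA fun xs hxs hxA => ?_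
    have hX : ∀ i, xs i ∈ X := fun i => hD (support_iid D hxs i)
    refine le_trans (PMF.toOuterMeasure_mono _ ?_) (adaBoost_fail_le (hweak xs hX) hm2 hδ hδ1)
    rintro o ⟨hbad, ho⟩
    by_contra hgood
    have hgood : ∀ i, o.1 (xs i) = hstar (xs i) := by
      intro i
      by_contra hne
      exact hgood ⟨i, hne⟩
    have hvote := (support_boost (K := outerIters m)
      (s := Setup.mk T xs (fun i => hstar (xs i)) rule adv M) hrule hadv
      (innerIters_pos hm2 hδ hδ1) (by simp) (by simp) ho).1
    exact hxA ⟨o.1, hvote, hgood, not_le.1 hbad⟩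

theorem succeeds_adaptive {F : Set Thinker} {T : ℕ} {X : Set Str} {c v : ℕ} (hT : 1 ≤ T)
    (hc : 2 ^ 30 ≤ c) (hv : vcDim (e2eClass F T) X = v) {ε δ : ℝ}
    (hε : 0 < ε) (hε1 : ε < 1) (hδ : 0 < δ) (hδ1 : δ < 1) {m : ℕ} [NeZero m]
    (hm : sampleSize (8 * c) v ε δ ≤ m) {D : PMF Str} (hD : D.support ⊆ X) {hstar : Thinker}
    (hstarF : hstar ∈ e2eClass F T) {rule : CoTRule} (hrule : rule.Consistent F T)
    {adv : Adversary m} (hadv : adv.Valid F X T hstar) :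
    Succeeds T D hstar m rule adv (8 * c * v) ε δ :=
  succeeds (hc.trans (by omega)) hv hε hε1 hδ hδ1 hm hD hstarF hrule hadv fun xs hxs =>
    weaklyLearns_of_vcDim (s := Setup.mk T xs (fun i => hstar (xs i)) rule adv (8 * c * v))
      hrule hadv hT hxs (fun _ => rfl) hstarF ((by norm_num : 12 ≤ 2 ^ 30).trans hc) hv.le rfl

theorem succeeds_relaxed {F : Set Thinker} {T : ℕ} {X : Set Str} {c v vl : ℕ} (hT : 1 ≤ T)
    (hc : 2 ^ 30 ≤ c) (hv : vcDim (e2eClass F T) X = v)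
    (hvl : vcDim (cotLossClass F T) (traceDomain X T) = vl) {ε δ : ℝ}
    (hε : 0 < ε) (hε1 : ε < 1) (hδ : 0 < δ) (hδ1 : δ < 1) {m : ℕ} [NeZero m]
    (hm : sampleSize (8 * c) v ε δ ≤ m) {D : PMF Str} (hD : D.support ⊆ X) {hstar : Thinker}
    (hstarF : hstar ∈ e2eClass F T) {rule : CoTRule} (hrule : rule.Consistent F T)
    {adv : Adversary m} (hadv : adv.Valid F X T hstar) (hrel : adv.Relaxed) :
    Succeeds T D hstar m rule adv (8 * c * vl) ε δ :=
  succeeds (hc.trans (by omega)) hv hε hε1 hδ hδ1 hm hD hstarF hrule hadv fun xs hxs =>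
    weaklyLearns_of_relaxed (s := Setup.mk T xs (fun i => hstar (xs i)) rule adv (8 * c * vl))
      hrule hadv hrel hT hxs (fun _ => rfl) ((by norm_num : 12 ≤ 2 ^ 30).trans hc) hvl.le rfl

/-! ### Values and running times of terms -/

/-- The term `t` has value `v` in the environment `e`, and takes at most `B` steps. -/
def Ev {G : List Ty} {a : Ty} (t : Tm G a) (e : Env G) (v : a.Val) (B : ℕ) : Prop :=
  (t.eval e).1 = v ∧ (t.eval e).2 ≤ B

/-! ### Composition rules for values and step counts -/

namespace Ev

variable {G : List Ty} {a b : Ty} {e : Env G}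

theorem mono {t : Tm G a} {v : a.Val} {B B' : ℕ} (h : Ev t e v B) (hB : B ≤ B') : Ev t e v B' :=
  ⟨h.1, h.2.trans hB⟩

theorem conv {t : Tm G a} {v v' : a.Val} {B B' : ℕ} (h : Ev t e v B) (hv : v = v') (hB : B ≤ B') :
    Ev t e v' B' :=
  ⟨h.1.trans hv, h.2.trans hB⟩

theorem letIn {t : Tm G a} {u : Tm (a :: G) b} {x : a.Val} {y : b.Val} {B C : ℕ}
    (h : Ev t e x B) (h' : Ev u (x, e) y C) : Ev (.letIn t u) e y (1 + B + C) := by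
  obtain ⟨rfl, h2⟩ := h
  exact ⟨h'.1, Nat.add_le_add (Nat.add_le_add_left h2 1) h'.2⟩

theorem call {t : Tm G a} {p : Tm [a] b} {x : a.Val} {y : b.Val} {B C : ℕ}
    (h : Ev t e x B) (h' : Ev p (x, ()) y C) : Ev (.call p t) e y (1 + B + C) := by
  obtain ⟨rfl, h2⟩ := h
  exact ⟨h'.1, Nat.add_le_add (Nat.add_le_add_left h2 1) h'.2⟩

theorem bit (x : Bool) : Ev (.bit x) e x 1 := ⟨rfl, le_rfl⟩

theorem num (n : ℕ) : Ev (.num n) e n (1 + n.size) := ⟨rfl, le_rfl⟩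

theorem ite {c : Tm G .bit} {t u : Tm G a} {x : Bool} {v : a.Val} {B C : ℕ} (h : Ev c e x B)
    (ht : x = true → Ev t e v C) (hu : x = false → Ev u e v C) :
    Ev (.ite c t u) e v (1 + B + C) := by
  obtain ⟨h1, h2⟩ := h
  cases x
  · have : (Tm.ite c t u).eval e = ((u.eval e).1, 1 + (c.eval e).2 + (u.eval e).2) := by
      simp [Tm.eval, h1]
    rw [Ev, this]
    exact ⟨(hu rfl).1, Nat.add_le_add (Nat.add_le_add_left h2 1) (hu rfl).2⟩
  · have : (Tm.ite c t u).eval e = ((t.eval e).1, 1 + (c.eval e).2 + (t.eval e).2) := by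
      simp [Tm.eval, h1]
    rw [Ev, this]
    exact ⟨(ht rfl).1, Nat.add_le_add (Nat.add_le_add_left h2 1) (ht rfl).2⟩

theorem add {t u : Tm G .nat} {x y : ℕ} {B C : ℕ} (h : Ev t e x B) (h' : Ev u e y C) :
    Ev (.add t u) e (x + y : ℕ) (1 + B + C + (x.size + y.size)) := by
  obtain ⟨rfl, h2⟩ := h
  obtain ⟨rfl, h3⟩ := h'
  exact ⟨rfl, Nat.add_le_add_right (Nat.add_le_add (Nat.add_le_add_left h2 1) h3) _⟩

theorem sub {t u : Tm G .nat} {x y : ℕ} {B C : ℕ} (h : Ev t e x B) (h' : Ev u e y C) :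
    Ev (.sub t u) e (x - y : ℕ) (1 + B + C + (x.size + y.size)) := by
  obtain ⟨rfl, h2⟩ := h
  obtain ⟨rfl, h3⟩ := h'
  exact ⟨rfl, Nat.add_le_add_right (Nat.add_le_add (Nat.add_le_add_left h2 1) h3) _⟩

theorem mul {t u : Tm G .nat} {x y : ℕ} {B C : ℕ} (h : Ev t e x B) (h' : Ev u e y C) :
    Ev (.mul t u) e (x * y : ℕ) (1 + B + C + (x.size + 1) * (y.size + 1)) := by
  obtain ⟨rfl, h2⟩ := h
  obtain ⟨rfl, h3⟩ := h'
  exact ⟨rfl, Nat.add_le_add_right (Nat.add_le_add (Nat.add_le_add_left h2 1) h3) _⟩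

theorem le {t u : Tm G .nat} {x y : ℕ} {B C : ℕ} (h : Ev t e x B) (h' : Ev u e y C) :
    Ev (.le t u) e (decide (x ≤ y)) (1 + B + C + (x.size + y.size)) := by
  obtain ⟨rfl, h2⟩ := h
  obtain ⟨rfl, h3⟩ := h'
  exact ⟨rfl, Nat.add_le_add_right (Nat.add_le_add (Nat.add_le_add_left h2 1) h3) _⟩

theorem pair {t : Tm G a} {u : Tm G b} {x : a.Val} {y : b.Val} {B C : ℕ} (h : Ev t e x B)
    (h' : Ev u e y C) : Ev (.pair t u) e (x, y) (1 + B + C) := by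
  obtain ⟨rfl, h2⟩ := h
  obtain ⟨rfl, h3⟩ := h'
  exact ⟨rfl, Nat.add_le_add (Nat.add_le_add_left h2 1) h3⟩

theorem fst {t : Tm G (.prod a b)} {x : a.Val × b.Val} {B : ℕ} (h : Ev t e x B) :
    Ev (.fst t) e x.1 (1 + B) := by
  obtain ⟨rfl, h2⟩ := h
  exact ⟨rfl, Nat.add_le_add_left h2 1⟩

theorem snd {t : Tm G (.prod a b)} {x : a.Val × b.Val} {B : ℕ} (h : Ev t e x B) :
    Ev (.snd t) e x.2 (1 + B) := by
  obtain ⟨rfl, h2⟩ := h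
  exact ⟨rfl, Nat.add_le_add_left h2 1⟩

theorem nil : Ev (.nil : Tm G (.list a)) e ([] : List a.Val) 1 := ⟨rfl, le_rfl⟩

theorem cons {t : Tm G a} {u : Tm G (.list a)} {x : a.Val} {y : List a.Val} {B C : ℕ}
    (h : Ev t e x B) (h' : Ev u e y C) : Ev (.cons t u) e (x :: y : List a.Val) (1 + B + C) := by
  obtain ⟨rfl, h2⟩ := h
  obtain ⟨rfl, h3⟩ := h'
  exact ⟨rfl, Nat.add_le_add (Nat.add_le_add_left h2 1) h3⟩

theorem caseCons {l : Tm G (.list a)} {t : Tm G b} {u : Tm (a :: .list a :: G) b} {x : a.Val}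
    {r : List a.Val} {v : b.Val} {B C : ℕ} (h : Ev l e (x :: r : List a.Val) B)
    (h' : Ev u (x, r, e) v C) : Ev (.caseList l t u) e v (1 + B + C) := by
  obtain ⟨h1, h2⟩ := h
  have : (Tm.caseList l t u).eval e = ((u.eval (x, r, e)).1, 1 + (l.eval e).2 + (u.eval (x, r, e)).2) := by
    simp only [Tm.eval, h1]
  rw [Ev, this]
  exact ⟨h'.1, Nat.add_le_add (Nat.add_le_add_left h2 1) h'.2⟩

/-- `σ j` is the state after `j` iterations. The cost is stated with any `Q ≥ k`, so that all costs
become functions of a single bound. -/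
theorem iter {n : Tm G .nat} {init : Tm G a} {body : Tm (a :: G) a} {k Q : ℕ} (σ : ℕ → a.Val)
    {B C D : ℕ} (hn : Ev n e k B) (hQ : k ≤ Q) (hi : Ev init e (σ 0) C)
    (hb : ∀ j < k, Ev body (σ j, e) (σ (j + 1)) D) :
    Ev (.iter n init body) e (σ k) (1 + B + C + Q * (1 + D)) := by
  obtain ⟨hn1, hn2⟩ := hn
  obtain ⟨hi1, hi2⟩ := hi
  set F : a.Val × ℕ → a.Val × ℕ := fun s => ((body.eval (s.1, e)).1, s.2 + 1 + (body.eval (s.1, e)).2)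
    with hF
  have key : ∀ j ≤ k, (F^[j] ((init.eval e).1, 1 + (n.eval e).2 + (init.eval e).2)).1 = σ j ∧
      (F^[j] ((init.eval e).1, 1 + (n.eval e).2 + (init.eval e).2)).2 ≤ 1 + B + C + j * (1 + D) := by
    intro j
    induction j with
    | zero => intro _; exact ⟨hi1, by simp only [Function.iterate_zero, id]; omega⟩
    | succ j ih =>
      intro hj
      obtain ⟨h1, h2⟩ := ih (by omega)
      obtain ⟨h3, h4⟩ := hb j hj
      rw [Function.iterate_succ_apply']
      simp only [hF] at h1 h2 ⊢
      rw [h1]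
      refine ⟨h3, ?_⟩
      rw [add_mul]
      omega
  obtain ⟨h1, h2⟩ := key k le_rfl
  have heq : (Tm.iter n init body).eval e =
      F^[k] ((init.eval e).1, 1 + (n.eval e).2 + (init.eval e).2) := by
    simp only [Tm.eval, hn1, hF]
  rw [Ev, heq]
  have := Nat.mul_le_mul_right (1 + D) hQ
  exact ⟨h1, by omega⟩

/-- `σ pre` is the accumulator after the prefix `pre`. The body is checked only at splittings of the
list, which supply membership and length facts about the current element. -/
theorem fold {l : Tm G (.list a)} {init : Tm G b} {body : Tm (a :: b :: G) b} {xs : List a.Val}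
    {Q : ℕ} (σ : List a.Val → b.Val) {B C D : ℕ} (hl : Ev l e xs B) (hQ : xs.length ≤ Q)
    (hi : Ev init e (σ []) C)
    (hb : ∀ pre x suf, xs = pre ++ x :: suf → Ev body (x, σ pre, e) (σ (pre ++ [x])) D) :
    Ev (.fold l init body) e (σ xs) (1 + B + C + Q * (1 + D)) := by
  obtain ⟨hl1, hl2⟩ := hl
  obtain ⟨hi1, hi2⟩ := hi
  set F : b.Val × ℕ → a.Val → b.Val × ℕ := fun s h =>
    ((body.eval (h, s.1, e)).1, s.2 + 1 + (body.eval (h, s.1, e)).2) with hF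
  have key : ∀ suf pre : List a.Val, ∀ s : b.Val × ℕ, xs = pre ++ suf → s.1 = σ pre →
      (suf.foldl F s).1 = σ xs ∧ (suf.foldl F s).2 ≤ s.2 + suf.length * (1 + D) := by
    intro suf
    induction suf with
    | nil =>
      intro pre s h1 h2
      rw [List.append_nil] at h1
      subst h1
      exact ⟨h2, by simp⟩
    | cons x suf ih =>
      intro pre s h1 h2
      obtain ⟨h3, h4⟩ := hb pre x suf h1
      obtain ⟨h5, h6⟩ := ih (pre ++ [x]) (F s x) (by simp [h1]) (by simp only [hF]; rw [h2]; exact h3)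
      refine ⟨h5, h6.trans ?_⟩
      simp only [hF, List.length_cons]
      rw [h2, add_mul]
      omega
  obtain ⟨h1, h2⟩ := key xs [] ((init.eval e).1, 1 + (l.eval e).2 + (init.eval e).2) rfl hi1
  have heq : (Tm.fold l init body).eval e =
      xs.foldl F ((init.eval e).1, 1 + (l.eval e).2 + (init.eval e).2) := by
    simp only [Tm.eval, hl1, hF]
  rw [Ev, heq]
  have := Nat.mul_le_mul_right (1 + D) hQ
  refine ⟨h1, h2.trans ?_⟩
  simp only
  omega

theorem out_eq {p : Tm [a] b} {x : a.Val} {v : b.Val} {B : ℕ} (h : Ev p (x, ()) v B) :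
    p.out x = v := h.1

theorem time_le {p : Tm [a] b} {x : a.Val} {v : b.Val} {B : ℕ} (h : Ev p (x, ()) v B) :
    p.time x ≤ B := h.2

theorem of_time {p : Tm [a] b} {x : a.Val} {B : ℕ} (h : p.time x ≤ B) :
    Ev p (x, ()) (p.out x) B := ⟨rfl, h⟩

end Ev

/-- The innermost variable, and the ones around it. -/
abbrev x0 {G : List Ty} {a : Ty} : Tm (a :: G) a := .var .head
abbrev x1 {G : List Ty} {a b : Ty} : Tm (b :: a :: G) a := .var (.tail .head)
abbrev x2 {G : List Ty} {a b c : Ty} : Tm (c :: b :: a :: G) a := .var (.tail (.tail .head))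
abbrev x3 {G : List Ty} {a b c d : Ty} : Tm (d :: c :: b :: a :: G) a :=
  .var (.tail (.tail (.tail .head)))
abbrev x4 {G : List Ty} {a b c d e : Ty} : Tm (e :: d :: c :: b :: a :: G) a :=
  .var (.tail (.tail (.tail (.tail .head))))
abbrev x6 {G : List Ty} {a b c d e f g : Ty} : Tm (g :: f :: e :: d :: c :: b :: a :: G) a :=
  .var (.tail (.tail (.tail (.tail (.tail (.tail .head))))))

section Variables

variable {G : List Ty} {a b c d f g h : Ty} {e : Env G} {va : a.Val} {vb : b.Val} {vc : c.Val}
  {vd : d.Val} {vf : f.Val} {vg : g.Val} {vh : h.Val}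

theorem Ev.x0 : Ev (G := a :: G) CoTBoosting.x0 (va, e) va 1 := ⟨rfl, le_rfl⟩
theorem Ev.x1 : Ev (G := b :: a :: G) CoTBoosting.x1 (vb, va, e) va 1 := ⟨rfl, le_rfl⟩
theorem Ev.x2 : Ev (G := c :: b :: a :: G) CoTBoosting.x2 (vc, vb, va, e) va 1 := ⟨rfl, le_rfl⟩
theorem Ev.x3 : Ev (G := d :: c :: b :: a :: G) CoTBoosting.x3 (vd, vc, vb, va, e) va 1 := ⟨rfl, le_rfl⟩
theorem Ev.x4 : Ev (G := f :: d :: c :: b :: a :: G) CoTBoosting.x4 (vf, vd, vc, vb, va, e) va 1 := ⟨rfl, le_rfl⟩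
theorem Ev.x6 : Ev (G := h :: g :: f :: d :: c :: b :: a :: G) CoTBoosting.x6 (vh, vg, vf, vd, vc, vb, va, e) va 1 := ⟨rfl, le_rfl⟩

end Variables

/-! ### Lists -/

/-- List reversal. -/
def revTm (a : Ty) : Tm [.list a] (.list a) := .fold x0 .nil (.cons x0 x1)

theorem ev_revTm {a : Ty} {l : List a.Val} {Q : ℕ} (hQ : l.length ≤ Q) :
    Ev (revTm a) (l, ()) l.reverse (3 + 4 * Q) := by
  unfold revTm
  refine Ev.conv (Ev.fold (xs := l) (fun pre => pre.reverse) Ev.x0 hQ Ev.nil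
    fun pre x suf _ => Ev.conv (Ev.cons Ev.x0 Ev.x1) ?_ le_rfl) rfl (by omega)
  simp

/-- Append an element at the end. -/
def snocTm (a : Ty) : Tm [.prod (.list a) a] (.list a) :=
  .call (revTm a) (.cons (.snd x0) (.call (revTm a) (.fst x0)))

theorem ev_snocTm {a : Ty} {l : List a.Val} {x : a.Val} {Q : ℕ} (hQ : l.length ≤ Q) :
    Ev (snocTm a) ((l, x), ()) (l ++ [x]) (20 + 8 * Q) := by
  unfold snocTm
  refine Ev.conv (Ev.call (Ev.cons (Ev.snd Ev.x0) (Ev.call (Ev.fst Ev.x0)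
    (ev_revTm (Q := Q) hQ))) (ev_revTm (Q := Q + 1) ?_)) ?_ (by omega)
  · simpa using hQ
  · simp

/-! ### End-to-end evaluation -/

section Oracle

variable {code : Ty} (next : Tm [.prod code .str] .bit)

/-- The thinker that a representation stands for. -/
def thinkerOf (r : code.Val) : Thinker := fun x => next.out (r, x)

/-- The end-to-end map of a represented thinker. -/
def e2eTm : Tm [.prod (.prod code .nat) .str] .bit :=
  .snd (.iter (.snd (.fst x0)) (.pair (.snd x0) (.bit false))
    (.letIn (.call next (.pair (.fst (.fst x1)) (.fst x0)))
      (.pair (.call (snocTm .bit) (.pair (.fst x1) x0)) x0)))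

theorem length_iterate_extend (f : Thinker) (x : Str) (j : ℕ) :
    ((extend f)^[j] x).length = x.length + j := by
  rw [(iterate_extend f x j).1, List.length_append, length_cot]

theorem ev_e2eTm {r : code.Val} {T : ℕ} {x : Str} {Q n : ℕ} (hT : 1 ≤ T) (hx : x.length + T ≤ n)
    (hnQ : n ≤ Q) (hn : ∀ w : Str, w.length ≤ n → next.time (r, w) ≤ Q) :
    Ev (e2eTm next) (((r, T), x), ()) (e2e (thinkerOf next r) T x) (10 + Q * (50 + 9 * Q)) := by
  set f := thinkerOf next r with hf
  unfold e2eTm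
  -- Before the first token the recorded bit is a dummy `false` and not the last bit of `x`; `1 ≤ T`
  -- ensures that it is never returned.
  refine Ev.conv (Ev.snd (Ev.iter (Q := Q) (k := T)
    (fun j => (((extend f)^[j] x, if j = 0 then false else ((extend f)^[j] x).getLastD false) :
      (Ty.prod .str .bit).Val)) (Ev.snd (Ev.fst Ev.x0)) (by omega)
      (Ev.pair (Ev.snd Ev.x0) (Ev.bit _)) (D := 40 + 9 * Q) fun j hj => ?_)) ?_ ?_
  · have hlen : ((extend f)^[j] x).length ≤ n := by rw [length_iterate_extend]; omega
    refine Ev.conv (Ev.letIn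
          (Ev.call (Ev.pair (Ev.fst (Ev.fst Ev.x1)) (Ev.fst Ev.x0)) (Ev.of_time (hn _ hlen)))
          (Ev.pair (Ev.call (Ev.pair (Ev.fst Ev.x1) Ev.x0)
            (ev_snocTm (hlen.trans hnQ))) Ev.x0)) ?_ (by omega)
    rw [Function.iterate_succ_apply']
    simp [extend, hf, thinkerOf]
  · have : T ≠ 0 := by omega
    simp [this, e2e]
  · have : Q * (1 + (40 + 9 * Q)) ≤ Q * (50 + 9 * Q) := Nat.mul_le_mul_left _ (by omega)
    omega

end Oracle

/-! ### Weighted examples -/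

/-- A weighted example: weight, index, input and label. -/
abbrev exTy : Ty := .prod .nat (.prod .nat (.prod .str .bit))

/-- The total weight. -/
def wsum (l : List exTy.Val) : ℕ := (l.map fun p => p.1).sum

/-- The total weight of the examples that `f` misclassifies. -/
def errSum (f : Thinker) (T : ℕ) (l : List exTy.Val) : ℕ :=
  (l.map fun p => if e2e f T p.2.2.1 ≠ p.2.2.2 then p.1 else 0).sum

theorem errSum_le_wsum (f : Thinker) (T : ℕ) (l : List exTy.Val) : errSum f T l ≤ wsum l := by
  refine List.sum_le_sum fun p _ => ?_
  split_ifs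
  exacts [le_rfl, Nat.zero_le _]

theorem wsum_append (l l' : List exTy.Val) : wsum (l ++ l') = wsum l + wsum l' := by simp [wsum]

theorem size_le_of_lt {n Q : ℕ} (h : n < 2 ^ Q) : Nat.size n ≤ Q := Nat.size_le.2 h

theorem size_le_of_le {n Q : ℕ} (h : n ≤ Q) : Nat.size n ≤ Q :=
  Nat.size_le.2 (h.trans_lt Nat.lt_two_pow_self)

theorem size_weight_le {l pre suf : List (ℕ × ℕ × Str × Bool)} {x : ℕ × ℕ × Str × Bool} {Q : ℕ}
    (h : l = pre ++ x :: suf) (hW : wsum l < 2 ^ Q) : Nat.size x.1 ≤ Q ∧ wsum pre < 2 ^ Q := by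
  have h1 : wsum l = wsum pre + (x.1 + wsum suf) := by
    rw [h, wsum_append]; simp [wsum]
  exact ⟨size_le_of_lt (by omega), by omega⟩

/-- The total weight of a list of examples. -/
def totalTm : Tm [.list exTy] .nat := .fold x0 (.num 0) (.add x1 (.fst x0))

theorem ev_totalTm {l : List exTy.Val} {Q : ℕ} (hl : l.length ≤ Q) (hW : wsum l < 2 ^ Q) :
    Ev totalTm (l, ()) (wsum l) (3 + Q * (10 + 2 * Q)) := by
  unfold totalTm
  refine Ev.conv (Ev.fold (xs := l) (fun pre => wsum pre) Ev.x0 hl (Ev.num 0) (D := 9 + 2 * Q)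
    fun pre x suf h => Ev.conv (Ev.add Ev.x1 (Ev.fst Ev.x0)) ?_ ?_) rfl ?_
  · simp [wsum]
  · obtain ⟨h3, h4⟩ := size_weight_le h hW
    have h2 := size_le_of_lt h4
    omega
  · simp only [Nat.size_zero]
    have : Q * (1 + (9 + 2 * Q)) = Q * (10 + 2 * Q) := by ring
    omega

/-- The initial weighted examples. -/
def initTm : Tm [.list (.prod .str .bit)] (.list exTy) :=
  .call (revTm exTy) (.snd (.fold x0 (.pair (.num 0) .nil)
    (.pair (.add (.fst x1) (.num 1)) (.cons (.pair (.num 1) (.pair (.fst x1) x0)) (.snd x1)))))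

theorem ev_initTm {l : List (Str × Bool)} {Q : ℕ} (hl : l.length ≤ Q) :
    Ev initTm (l, ()) (l.mapIdx fun i p => ((1, i, p) : exTy.Val)) (20 + Q * (40 + 2 * Q)) := by
  unfold initTm
  refine Ev.conv (Ev.call (Ev.snd (Ev.fold (xs := l) (fun pre =>
    ((pre.length, (pre.mapIdx fun i p => ((1, i, p) : exTy.Val)).reverse) :
      (Ty.prod .nat (.list exTy)).Val)) Ev.x0 hl (Ev.pair (Ev.num 0) Ev.nil) (D := 30 + 2 * Q)
      fun pre x suf h => Ev.conv (Ev.pair (Ev.add (Ev.fst Ev.x1) (Ev.num 1))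
        (Ev.cons (Ev.pair (Ev.num 1) (Ev.pair (Ev.fst Ev.x1) Ev.x0)) (Ev.snd Ev.x1))) ?_ ?_))
      (ev_revTm (Q := Q) ?_)) ?_ ?_
  · simp [List.mapIdx_concat]
  · have h2 : Nat.size pre.length ≤ Q := size_le_of_le (by rw [h] at hl; simp at hl; omega)
    simp only [Nat.size_one]
    omega
  · simpa using hl
  · simp
  · simp only [Nat.size_zero]
    have : Q * (1 + (30 + 2 * Q)) + 9 * Q = Q * (40 + 2 * Q) := by ring
    omega

/-! ### Drawing an example -/

/-- A drawn example: index and input. -/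
abbrev drawTy : Ty := .prod .nat .str

/-- One step of the search for the example in whose weight interval a number falls. -/
def pickStep (s : Bool × ℕ × ℕ × Str) (p : exTy.Val) : Bool × ℕ × ℕ × Str :=
  if s.1 = true then s
  else if s.2.1 + 1 ≤ p.1 then (true, s.2.1, p.2.1, p.2.2.1) else (false, s.2.1 - p.1, s.2.2)

/-- The example in whose weight interval `r` falls. -/
def pick (l : List exTy.Val) (r : ℕ) : ℕ × Str := (l.foldl pickStep (false, r, 0, [])).2.2

/-- The program for `pick`. -/
def pickTm : Tm [.prod (.list exTy) .nat] drawTy :=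
  .snd (.snd (.fold (.fst x0) (.pair (.bit false) (.pair (.snd x0) (.pair (.num 0) .nil)))
    (.ite (.fst x1) x1
      (.ite (.le (.add (.fst (.snd x1)) (.num 1)) (.fst x0))
        (.pair (.bit true) (.pair (.fst (.snd x1)) (.pair (.fst (.snd x0)) (.fst (.snd (.snd x0))))))
        (.pair (.bit false) (.pair (.sub (.fst (.snd x1)) (.fst x0)) (.snd (.snd x1))))))))

/-- The residue only decreases, so its bit length stays bounded throughout the search. -/
theorem foldl_pickStep_le (l : List exTy.Val) (s : Bool × ℕ × ℕ × Str) :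
    (l.foldl pickStep s).2.1 ≤ s.2.1 := by
  induction l generalizing s with
  | nil => exact le_rfl
  | cons p l ih =>
    refine (ih _).trans ?_
    unfold pickStep
    split_ifs <;> simp

theorem ev_pickTm {l : List exTy.Val} {r Q : ℕ} (hl : l.length ≤ Q) (hW : wsum l < 2 ^ Q)
    (hr : r < wsum l) : Ev pickTm ((l, r), ()) (pick l r) (20 + Q * (50 + 6 * Q)) := by
  unfold pickTm
  refine Ev.conv (Ev.snd (Ev.snd (Ev.fold (xs := l) (fun pre =>
    (pre.foldl pickStep (false, r, 0, []) : (Ty.prod .bit (.prod .nat drawTy)).Val))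
    (Ev.fst Ev.x0) hl (Ev.pair (Ev.bit _) (Ev.pair (Ev.snd Ev.x0) (Ev.pair (Ev.num 0) Ev.nil)))
    (D := 40 + 6 * Q) fun pre x suf h => ?_))) rfl ?_
  · rw [List.foldl_append]
    have hs := foldl_pickStep_le pre (false, r, 0, [])
    generalize pre.foldl pickStep (false, r, 0, []) = s at hs
    have hs : s.2.1 ≤ r := hs
    have h2 := size_le_of_lt (show s.2.1 < 2 ^ Q by omega)
    have h3 := (size_weight_le h hW).1
    have h4 := size_le_of_lt (show s.2.1 + 1 < 2 ^ Q by omega)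
    refine Ev.conv (Ev.ite (Ev.fst Ev.x1) (C := 30 + 6 * Q)
      (fun hc => Ev.conv Ev.x1 ?_ (by omega)) fun hc => ?_) rfl (by omega)
    · simp [pickStep, hc]
    · refine Ev.conv (Ev.ite (Ev.le (Ev.add (Ev.fst (Ev.snd Ev.x1)) (Ev.num 1)) (Ev.fst Ev.x0))
        (C := 15 + 2 * Q)
        (fun hd => Ev.conv (Ev.pair (Ev.bit _) (Ev.pair (Ev.fst (Ev.snd Ev.x1))
          (Ev.pair (Ev.fst (Ev.snd Ev.x0)) (Ev.fst (Ev.snd (Ev.snd Ev.x0)))))) ?_ (by omega))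
        fun hd => Ev.conv (Ev.pair (Ev.bit _) (Ev.pair (Ev.sub (Ev.fst (Ev.snd Ev.x1)) (Ev.fst Ev.x0))
          (Ev.snd (Ev.snd Ev.x1)))) ?_ (by omega)) rfl ?_
      · have hd := of_decide_eq_true hd
        simp [pickStep, hc, hd]
      · have hd := of_decide_eq_false hd
        simp only [List.foldl_cons, List.foldl_nil, pickStep, hc]
        rw [if_neg (by simp), if_neg hd]
      · simp only [Nat.size_one]
        omega
  · simp only [Nat.size_zero]
    have : Q * (1 + (40 + 6 * Q)) ≤ Q * (50 + 6 * Q) := Nat.mul_le_mul_left _ (by omega)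
    omega

/-- The indices of drawn examples. -/
def idxTm : Tm [.list drawTy] (.list .nat) :=
  .call (revTm .nat) (.fold x0 .nil (.cons (.fst x0) x1))

theorem ev_idxTm {l : List drawTy.Val} {Q : ℕ} (hl : l.length ≤ Q) :
    Ev idxTm (l, ()) (l.map Prod.fst : List ℕ) (7 + 9 * Q) := by
  unfold idxTm
  refine Ev.conv (Ev.call (Ev.fold (xs := l) (fun pre => ((pre.map Prod.fst).reverse : List ℕ)) Ev.x0
    hl Ev.nil fun pre x suf h => Ev.conv (Ev.cons (Ev.fst Ev.x0) Ev.x1) ?_ le_rfl)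
    (ev_revTm (a := .nat) (Q := Q) ?_)) ?_ (by omega)
  · simp
  · simpa using hl
  · simp

/-! ### Next-token pairs -/

/-- Put the next-token pairs of a chain of thought in front of a list. -/
def tokTm : Tm [.prod (.prod .str .str) (.list (.prod .str .bit))] (.list (.prod .str .bit)) :=
  .snd (.fold (.snd (.fst x0)) (.pair (.fst (.fst x0)) (.snd x0))
    (.pair (.call (snocTm .bit) (.pair (.fst x1) x0)) (.cons (.pair (.fst x1) x0) (.snd x1))))

/-- The next-token pairs of one chain of thought. -/
def tokenPairs (x z : Str) : List (Str × Bool) :=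
  (List.range z.length).map fun t => (x ++ z.take t, z.getD t false)

theorem tokenPairs_concat (x z : Str) (b : Bool) :
    tokenPairs x (z ++ [b]) = tokenPairs x z ++ [(x ++ z, b)] := by
  unfold tokenPairs
  rw [List.length_append, List.length_singleton, List.range_succ, List.map_append, List.map_singleton]
  congr 1
  · refine List.map_congr_left fun t ht => ?_
    have ht := List.mem_range.1 ht
    rw [List.take_append_of_le_length ht.le, List.getD_append _ _ _ _ ht]
  · simp

theorem ev_tokTm {x z : Str} {out : List (Str × Bool)} {Q : ℕ} (hQ : x.length + z.length ≤ Q) :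
    Ev tokTm (((x, z), out), ()) ((tokenPairs x z).reverse ++ out) (12 + Q * (40 + 8 * Q)) := by
  unfold tokTm
  refine Ev.conv (Ev.snd (Ev.fold (xs := z) (Q := Q) (fun pre : Str =>
    ((x ++ pre, (tokenPairs x pre).reverse ++ out) :
      (Ty.prod .str (.list (.prod .str .bit))).Val)) (Ev.snd (Ev.fst Ev.x0)) (by omega)
      (Ev.conv (Ev.pair (Ev.fst (Ev.fst Ev.x0)) (Ev.snd Ev.x0)) (by simp [tokenPairs]) le_rfl)
      (D := 39 + 8 * Q)
      fun pre b suf h => Ev.conv (Ev.pair (Ev.call (Ev.pair (Ev.fst Ev.x1) Ev.x0)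
        (ev_snocTm (Q := Q) ?_)) (Ev.cons (Ev.pair (Ev.fst Ev.x1) Ev.x0) (Ev.snd Ev.x1))) ?_ ?_)) rfl ?_
  · rw [h] at hQ
    simp only [List.length_append, List.length_cons] at hQ ⊢
    omega
  · simp [tokenPairs_concat]
  · omega
  · have : Q * (1 + (39 + 8 * Q)) = Q * (40 + 8 * Q) := by ring
    omega

/-- The next-token pairs of drawn examples and their chains of thought. -/
def pairsTm : Tm [.prod (.list drawTy) (.list .str)] (.list (.prod .str .bit)) :=
  .call (revTm (.prod .str .bit)) (.snd (.fold (.snd x0) (.pair (.fst x0) .nil)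
    (.caseList (.fst x1) x1 (.pair x1 (.call tokTm (.pair (.pair (.snd x0) x2) (.snd x3)))))))

theorem zip_concat {α β : Type} {l : List α} {l' : List β} {b : β} (h : l'.length < l.length) :
    l.zip (l' ++ [b]) = l.zip l' ++ [(l[l'.length], b)] := by
  induction l' generalizing l with
  | nil =>
    cases l with
    | nil => simp at h
    | cons a l => simp
  | cons c l' ih =>
    cases l with
    | nil => simp at h
    | cons a l => simpa using ih (by simpa using h)

theorem nextTokenPairs_append (T : ℕ) (S S' : List (Str × Str)) :
    nextTokenPairs T (S ++ S') = nextTokenPairs T S ++ nextTokenPairs T S' := by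
  simp [nextTokenPairs]

theorem nextTokenPairs_singleton {T : ℕ} {x z : Str} (hz : z.length = T) :
    nextTokenPairs T [(x, z)] = tokenPairs x z := by
  simp [nextTokenPairs, tokenPairs, hz]

theorem length_nextTokenPairs (T : ℕ) (S : List (Str × Str)) :
    (nextTokenPairs T S).length = S.length * T := by
  simp [nextTokenPairs, List.length_flatMap]

/-- The fold runs over the answers while the unused draws travel in the accumulator. Pairs pile up
in reverse, and one reversal at the end restores the order. -/
theorem ev_pairsTm {smp : List drawTy.Val} {Z : List Str} {T Q n : ℕ} (hlen : Z.length = smp.length)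
    (hZ : ∀ z ∈ Z, z.length = T) (hx : ∀ p ∈ smp, p.2.length ≤ n) (hn : n + T ≤ Q)
    (hQ : smp.length ≤ Q) (hQT : smp.length * T ≤ Q) :
    Ev pairsTm ((smp, Z), ()) (nextTokenPairs T ((smp.map Prod.snd).zip Z))
      (20 + Q * (50 + Q * (40 + 8 * Q))) := by
  unfold pairsTm
  refine Ev.conv (Ev.call (Ev.snd (Ev.fold (xs := Z) (Q := Q) (fun pre =>
    ((smp.drop pre.length, (nextTokenPairs T ((smp.map Prod.snd).zip pre)).reverse) :
      (Ty.prod (.list drawTy) (.list (.prod .str .bit))).Val)) (Ev.snd Ev.x0) (by omega)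
      (Ev.conv (Ev.pair (Ev.fst Ev.x0) Ev.nil) (by simp [nextTokenPairs]) le_rfl)
      (D := 35 + Q * (40 + 8 * Q))
      fun pre z suf h => ?_)) (ev_revTm (Q := Q) ?_)) ?_ ?_
  · have hk : pre.length < smp.length := by rw [← hlen, h]; simp
    have hz : z.length = T := hZ z (by rw [h]; simp)
    have hxk := hx _ (List.getElem_mem hk)
    refine Ev.conv (Ev.caseCons (Ev.conv (Ev.fst Ev.x1) (List.drop_eq_getElem_cons hk) le_rfl)
      (Ev.pair Ev.x1 (Ev.call (Ev.pair (Ev.pair (Ev.snd Ev.x0) Ev.x2) (Ev.snd Ev.x3))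
        (ev_tokTm (Q := Q) (by rw [hz]; omega))))) ?_ (by omega)
    have hzip : (smp.map Prod.snd).zip (pre ++ [z]) =
        (smp.map Prod.snd).zip pre ++ [(smp[pre.length].2, z)] := by
      rw [zip_concat (by simpa using hk)]
      simp
    rw [hzip, nextTokenPairs_append, nextTokenPairs_singleton hz]
    simp
  · simp only [List.length_reverse, length_nextTokenPairs, List.length_zip, List.length_map, hlen,
      min_self]
    exact hQT
  · simp
  · have : Q * (1 + (35 + Q * (40 + 8 * Q))) + 4 * Q ≤ Q * (50 + Q * (40 + 8 * Q)) := by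
      rw [show Q * (50 + Q * (40 + 8 * Q)) = Q * (1 + (35 + Q * (40 + 8 * Q))) + 14 * Q by ring]
      omega
    omega

/-! ### Errors, reweighting and votes -/

section Oracle

variable {code : Ty} (next : Tm [.prod code .str] .bit)

/-- The cost of an end-to-end evaluation. -/
def e2eCost (Q : ℕ) : ℕ := 10 + Q * (50 + 9 * Q)

/-- Whether an example is misclassified. -/
def misTm : Tm [.prod (.prod code .nat) exTy] .bit :=
  .letIn (.call (e2eTm next) (.pair (.fst x0) (.fst (.snd (.snd (.snd x0))))))
    (.ite x0 (.ite (.snd (.snd (.snd (.snd x1)))) (.bit false) (.bit true))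
      (.snd (.snd (.snd (.snd x1)))))

variable {r : code.Val} {T Q n : ℕ}

theorem ev_misTm {p : exTy.Val} (hT : 1 ≤ T) (hp : p.2.2.1.length + T ≤ n) (hnQ : n ≤ Q)
    (hn : ∀ w : Str, w.length ≤ n → next.time (r, w) ≤ Q) :
    Ev (misTm next) (((r, T), p), ()) (decide (e2e (thinkerOf next r) T p.2.2.1 ≠ p.2.2.2))
      (e2eCost Q + 30) := by
  unfold misTm
  refine Ev.conv (Ev.letIn (Ev.call (Ev.pair (Ev.fst Ev.x0) (Ev.fst (Ev.snd (Ev.snd (Ev.snd Ev.x0)))))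
    (ev_e2eTm next hT hp hnQ hn)) (Ev.ite Ev.x0 (C := 10)
      (fun hb => Ev.conv (Ev.ite (Ev.snd (Ev.snd (Ev.snd (Ev.snd Ev.x1)))) (C := 1)
        (v := decide (e2e (thinkerOf next r) T p.2.2.1 ≠ p.2.2.2))
        (fun hc => Ev.conv (Ev.bit _) ?_ le_rfl) fun hc => Ev.conv (Ev.bit _) ?_ le_rfl) rfl (by omega))
      fun hb => Ev.conv (Ev.snd (Ev.snd (Ev.snd (Ev.snd Ev.x1)))) ?_ (by omega))) rfl ?_
  · have hc : p.2.2.2 = true := hc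
    have hb : e2e (thinkerOf next r) T p.2.2.1 = true := hb
    simp [hb, hc]
  · have hc : p.2.2.2 = false := hc
    have hb : e2e (thinkerOf next r) T p.2.2.1 = true := hb
    simp [hb, hc]
  · have hb : e2e (thinkerOf next r) T p.2.2.1 = false := hb
    simp [hb]
  · unfold e2eCost
    omega

/-- The total weight of the misclassified examples. -/
def errTm : Tm [.prod (.prod code .nat) (.list exTy)] .nat :=
  .fold (.snd x0) (.num 0) (.ite (.call (misTm next) (.pair (.fst x2) x0)) (.add x1 (.fst x0)) x1)

theorem ev_errTm {l : List exTy.Val} (hT : 1 ≤ T) (hp : ∀ p ∈ l, p.2.2.1.length + T ≤ n)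
    (hnQ : n ≤ Q) (hn : ∀ w : Str, w.length ≤ n → next.time (r, w) ≤ Q) (hl : l.length ≤ Q)
    (hW : wsum l < 2 ^ Q) :
    Ev (errTm next) (((r, T), l), ()) (errSum (thinkerOf next r) T l)
      (10 + Q * (e2eCost Q + 50 + 2 * Q)) := by
  unfold errTm
  refine Ev.conv (Ev.fold (xs := l) (fun pre => errSum (thinkerOf next r) T pre) (Ev.snd Ev.x0) hl
    (Ev.num 0) (D := e2eCost Q + 49 + 2 * Q) fun pre x suf h => ?_) rfl ?_
  · obtain ⟨h3, h4⟩ := size_weight_le h hW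
    have h2 := size_le_of_lt ((errSum_le_wsum (thinkerOf next r) T pre).trans_lt h4)
    refine Ev.conv (Ev.ite (Ev.call (Ev.pair (Ev.fst Ev.x2) Ev.x0)
      (ev_misTm next hT (hp x (by rw [h]; simp)) hnQ hn)) (C := 5 + 2 * Q)
      (fun hb => Ev.conv (Ev.add Ev.x1 (Ev.fst Ev.x0)) ?_ (by omega))
      fun hb => Ev.conv Ev.x1 ?_ (by omega)) rfl (by omega)
    · have hb := of_decide_eq_true hb
      simp [errSum, hb]
    · have hb := of_decide_eq_false hb
      simp only [errSum, List.map_append, List.sum_append, List.map_singleton, List.sum_singleton,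
        if_neg hb, add_zero]
  · simp only [Nat.size_zero]
    have : Q * (1 + (e2eCost Q + 49 + 2 * Q)) = Q * (e2eCost Q + 50 + 2 * Q) := by ring
    omega

/-- The new weight of an example. -/
def newWeight (f : Thinker) (T W E : ℕ) (p : exTy.Val) : ℕ :=
  if e2e f T p.2.2.1 ≠ p.2.2.2 then p.1 * (W - E) else p.1 * E

/-- The reweighted examples. -/
def reweightTm : Tm [.prod (.prod code .nat) (.prod (.list exTy) (.prod .nat .nat))] (.list exTy) :=
  .call (revTm exTy) (.fold (.fst (.snd x0)) .nil
    (.cons (.pair (.ite (.call (misTm next) (.pair (.fst x2) x0))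
      (.mul (.fst x0) (.sub (.fst (.snd (.snd x2))) (.snd (.snd (.snd x2)))))
      (.mul (.fst x0) (.snd (.snd (.snd x2))))) (.snd x0)) x1))

theorem ev_reweightTm {l : List exTy.Val} {W E : ℕ} (hT : 1 ≤ T)
    (hp : ∀ p ∈ l, p.2.2.1.length + T ≤ n)
    (hnQ : n ≤ Q) (hn : ∀ w : Str, w.length ≤ n → next.time (r, w) ≤ Q) (hl : l.length ≤ Q)
    (hlW : wsum l ≤ W) (hE : E ≤ W) (hW : W < 2 ^ Q) :
    Ev (reweightTm next) (((r, T), l, W, E), ())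
      (l.map fun p => ((newWeight (thinkerOf next r) T W E p, p.2) : exTy.Val))
      (20 + Q * (e2eCost Q + 80 + 2 * Q + (Q + 1) * (Q + 1))) := by
  unfold reweightTm
  refine Ev.conv (Ev.call (Ev.fold (xs := l) (fun pre =>
    ((pre.map fun p => (newWeight (thinkerOf next r) T W E p, p.2)).reverse : List exTy.Val))
    (Ev.fst (Ev.snd Ev.x0)) hl Ev.nil (D := e2eCost Q + 70 + 2 * Q + (Q + 1) * (Q + 1))
    fun pre x suf h => ?_) (ev_revTm (Q := Q) (by simpa using hl))) (by simp) ?_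
  · have h2 := (size_weight_le h (hlW.trans_lt hW)).1
    have h3 := size_le_of_lt hW
    have h4 := size_le_of_lt (show E < 2 ^ Q by omega)
    have h5 := size_le_of_lt (show W - E < 2 ^ Q by omega)
    have h6 : (Nat.size x.1 + 1) * (Nat.size (W - E) + 1) ≤ (Q + 1) * (Q + 1) :=
      Nat.mul_le_mul (by omega) (by omega)
    have h7 : (Nat.size x.1 + 1) * (Nat.size E + 1) ≤ (Q + 1) * (Q + 1) :=
      Nat.mul_le_mul (by omega) (by omega)
    refine Ev.conv (Ev.cons (Ev.pair (Ev.ite (Ev.call (Ev.pair (Ev.fst Ev.x2) Ev.x0)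
      (ev_misTm next hT (hp x (by rw [h]; simp)) hnQ hn)) (C := 20 + 2 * Q + (Q + 1) * (Q + 1))
      (v := newWeight (thinkerOf next r) T W E x)
      (fun hb => Ev.conv (Ev.mul (Ev.fst Ev.x0) (Ev.sub (Ev.fst (Ev.snd (Ev.snd Ev.x2)))
        (Ev.snd (Ev.snd (Ev.snd Ev.x2))))) ?_ (by dsimp only; omega))
      fun hb => Ev.conv (Ev.mul (Ev.fst Ev.x0) (Ev.snd (Ev.snd (Ev.snd Ev.x2)))) ?_
        (by dsimp only; omega))
      (Ev.snd Ev.x0)) Ev.x1) (by simp) (by omega)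
    · rw [newWeight, if_pos (of_decide_eq_true hb)]
    · rw [newWeight, if_neg (of_decide_eq_false hb)]
  · have : Q * (1 + (e2eCost Q + 70 + 2 * Q + (Q + 1) * (Q + 1))) + 4 * Q + 5 * Q =
        Q * (e2eCost Q + 80 + 2 * Q + (Q + 1) * (Q + 1)) := by ring
    omega

/-- A weighted predictor: the ratio of two positive numbers, and a representation. -/
abbrev voterTy (code : Ty) : Ty := .prod (.prod .nat .nat) code

/-- The voter that a weighted predictor stands for. -/
def voterOf (p : (voterTy code).Val) : ℝ × Thinker :=
  (1 / 2 * Real.log (p.1.1 / p.1.2), thinkerOf next p.2)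

/-- The product of the ratios of the voters for `false`, and of the inverse ratios of the others
(numerators). -/
def prodFalse (T : ℕ) (x : Str) (l : List (voterTy code).Val) : ℕ :=
  (l.map fun p => if e2e (thinkerOf next p.2) T x = true then p.1.2 else p.1.1).prod

/-- The product for `true`. -/
def prodTrue (T : ℕ) (x : Str) (l : List (voterTy code).Val) : ℕ :=
  (l.map fun p => if e2e (thinkerOf next p.2) T x = true then p.1.1 else p.1.2).prod

/-- Each vote weight is half the logarithm of a ratio of naturals, so the signed sum is half the
logarithm of a ratio of two products. -/
theorem margin_voters (T : ℕ) (x : Str) (l : List (voterTy code).Val)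
    (hl : ∀ p ∈ l, 0 < p.1.1 ∧ 0 < p.1.2) :
    0 < prodFalse next T x l ∧ 0 < prodTrue next T x l ∧
      margin T (l.map (voterOf next)) x true =
        1 / 2 * (Real.log (prodTrue next T x l) - Real.log (prodFalse next T x l)) := by
  induction l with
  | nil => simp [prodFalse, prodTrue, margin]
  | cons p l ih =>
    obtain ⟨h1, h2, h3⟩ := ih fun q hq => hl q (List.mem_cons_of_mem _ hq)
    obtain ⟨h4, h5⟩ := hl p List.mem_cons_self
    have h4' : (0 : ℝ) < p.1.1 := by exact_mod_cast h4
    have h5' : (0 : ℝ) < p.1.2 := by exact_mod_cast h5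
    have h1' : (0 : ℝ) < prodFalse next T x l := by exact_mod_cast h1
    have h2' : (0 : ℝ) < prodTrue next T x l := by exact_mod_cast h2
    have e1 : prodFalse next T x (p :: l) =
        (if e2e (thinkerOf next p.2) T x = true then p.1.2 else p.1.1) * prodFalse next T x l := by
      simp [prodFalse]
    have e2 : prodTrue next T x (p :: l) =
        (if e2e (thinkerOf next p.2) T x = true then p.1.1 else p.1.2) * prodTrue next T x l := by
      simp [prodTrue]
    have e3 : margin T ((p :: l).map (voterOf next)) x true =
        1 / 2 * Real.log (p.1.1 / p.1.2) * (if e2e (thinkerOf next p.2) T x = true then 1 else -1) +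
          margin T (l.map (voterOf next)) x true := by
      simp [margin, voterOf]
    rw [e1, e2, e3, h3]
    split_ifs
    · refine ⟨Nat.mul_pos h5 h1, Nat.mul_pos h4 h2, ?_⟩
      push_cast
      rw [Real.log_mul h4'.ne' h2'.ne', Real.log_mul h5'.ne' h1'.ne', Real.log_div h4'.ne' h5'.ne']
      ring
    · refine ⟨Nat.mul_pos h4 h1, Nat.mul_pos h5 h2, ?_⟩
      push_cast
      rw [Real.log_mul h5'.ne' h2'.ne', Real.log_mul h4'.ne' h1'.ne', Real.log_div h4'.ne' h5'.ne']
      ring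

theorem vote_voters (T : ℕ) (x : Str) (l : List (voterTy code).Val)
    (hl : ∀ p ∈ l, 0 < p.1.1 ∧ 0 < p.1.2) :
    vote T (l.map (voterOf next)) x = decide (prodFalse next T x l ≤ prodTrue next T x l) := by
  obtain ⟨h1, h2, h3⟩ := margin_voters next T x l hl
  have h1' : (0 : ℝ) < prodFalse next T x l := by exact_mod_cast h1
  rw [vote_eq, h3, decide_eq_decide, ← Nat.cast_le (α := ℝ),
    ← Real.log_le_log_iff h1' (by exact_mod_cast h2)]
  constructor <;> intro h <;> linarith

/-- The type of representations of the final predictor. -/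
abbrev repTy (code : Ty) : Ty := .prod .nat (.list (voterTy code))

/-- Evaluation of the final predictor. -/
def predictTm : Tm [.prod (repTy code) .str] .bit :=
  .letIn (.fold (.snd (.fst x0)) (.pair (.num 1) (.num 1))
    (.ite (.call (e2eTm next) (.pair (.pair (.snd x0) (.fst (.fst x2))) (.snd x2)))
      (.pair (.mul (.fst x1) (.snd (.fst x0))) (.mul (.snd x1) (.fst (.fst x0))))
      (.pair (.mul (.fst x1) (.fst (.fst x0))) (.mul (.snd x1) (.snd (.fst x0))))))
    (.le (.fst x0) (.snd x0))

theorem prod_map_lt {α : Type} (g : α → ℕ) (l : List α) {Q : ℕ} (h : ∀ p ∈ l, g p < 2 ^ Q) :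
    (l.map g).prod ≤ 2 ^ (Q * l.length) := by
  induction l with
  | nil => simp
  | cons p l ih =>
    rw [List.map_cons, List.prod_cons, List.length_cons, Nat.mul_succ, pow_add, mul_comm]
    exact Nat.mul_le_mul (ih fun q hq => h q (List.mem_cons_of_mem _ hq)) (h p List.mem_cons_self).le

/-- A product of at most `Q` numbers of `Q` bits has at most `Q² + 1` bits, so no multiplication
costs more than `(Q² + 2) (Q + 1)`. -/
theorem ev_predictTm {l : List (voterTy code).Val} {x : Str} (hT : 1 ≤ T) (hl : l.length ≤ Q)
    (hx : x.length + T ≤ n) (hnQ : n ≤ Q)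
    (hp : ∀ p ∈ l, p.1.1 < 2 ^ Q ∧ p.1.2 < 2 ^ Q ∧
      ∀ w : Str, w.length ≤ n → next.time (p.2, w) ≤ Q) :
    Ev (predictTm next) (((T, l), x), ()) (decide (prodFalse next T x l ≤ prodTrue next T x l))
      (30 + 2 * (Q * Q) + Q * (e2eCost Q + 50 + 2 * ((Q * Q + 2) * (Q + 1)))) := by
  have hsize : ∀ (g : (voterTy code).Val → ℕ) (pre : List (voterTy code).Val),
      (∀ p ∈ pre, g p < 2 ^ Q) → pre.length ≤ Q → Nat.size (pre.map g).prod ≤ Q * Q + 1 := by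
    intro g pre hg hpre
    refine Nat.size_le.2 ?_
    calc _ ≤ 2 ^ (Q * pre.length) := prod_map_lt g pre hg
      _ ≤ 2 ^ (Q * Q) := Nat.pow_le_pow_right (by norm_num) (Nat.mul_le_mul_left _ hpre)
      _ < 2 ^ (Q * Q + 1) := Nat.pow_lt_pow_right (by norm_num) (by omega)
  have hF : ∀ pre : List (voterTy code).Val, (∀ p ∈ pre, p ∈ l) → pre.length ≤ Q →
      Nat.size (prodFalse next T x pre) ≤ Q * Q + 1 := fun pre hpre hlen =>
    hsize _ pre (fun p hpp => by
      have := hp p (hpre p hpp)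
      split_ifs
      exacts [this.2.1, this.1]) hlen
  have hTr : ∀ pre : List (voterTy code).Val, (∀ p ∈ pre, p ∈ l) → pre.length ≤ Q →
      Nat.size (prodTrue next T x pre) ≤ Q * Q + 1 := fun pre hpre hlen =>
    hsize _ pre (fun p hpp => by
      have := hp p (hpre p hpp)
      split_ifs
      exacts [this.1, this.2.1]) hlen
  unfold predictTm
  refine Ev.conv (Ev.letIn (Ev.fold (xs := l) (fun pre =>
    ((prodFalse next T x pre, prodTrue next T x pre) : (Ty.prod .nat .nat).Val))
    (Ev.snd (Ev.fst Ev.x0)) hl (Ev.pair (Ev.num 1) (Ev.num 1))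
    (D := e2eCost Q + 49 + 2 * ((Q * Q + 2) * (Q + 1))) fun pre p suf h => ?_)
    (Ev.le (Ev.fst Ev.x0) (Ev.snd Ev.x0))) rfl ?_
  · have hpl : p ∈ l := by rw [h]; simp
    obtain ⟨hp1, hp2, hp3⟩ := hp p hpl
    have hpre : ∀ q ∈ pre, q ∈ l := fun q hq => by rw [h]; simp [hq]
    have hlen : pre.length ≤ Q := by rw [h] at hl; simp at hl; omega
    have hA := hF pre hpre hlen
    have hB := hTr pre hpre hlen
    have hs1 := size_le_of_lt hp1
    have hs2 := size_le_of_lt hp2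
    have hmul : ∀ {a b : ℕ}, a ≤ Q * Q + 1 → b ≤ Q → (a + 1) * (b + 1) ≤ (Q * Q + 2) * (Q + 1) :=
      fun ha hb => Nat.mul_le_mul (by omega) (by omega)
    have m1 := hmul hA hs1
    have m2 := hmul hA hs2
    have m3 := hmul hB hs1
    have m4 := hmul hB hs2
    refine Ev.conv (Ev.ite (Ev.call (Ev.pair (Ev.pair (Ev.snd Ev.x0) (Ev.fst (Ev.fst Ev.x2)))
      (Ev.snd Ev.x2)) (ev_e2eTm next hT hx hnQ hp3)) (C := 20 + 2 * ((Q * Q + 2) * (Q + 1)))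
      (fun hb => Ev.conv (Ev.pair (Ev.mul (Ev.fst Ev.x1) (Ev.snd (Ev.fst Ev.x0)))
        (Ev.mul (Ev.snd Ev.x1) (Ev.fst (Ev.fst Ev.x0)))) ?_ (by dsimp only; omega))
      fun hb => Ev.conv (Ev.pair (Ev.mul (Ev.fst Ev.x1) (Ev.fst (Ev.fst Ev.x0)))
        (Ev.mul (Ev.snd Ev.x1) (Ev.snd (Ev.fst Ev.x0)))) ?_ (by dsimp only; omega)) rfl ?_
    · have hb : e2e (thinkerOf next p.2) T x = true := hb
      simp [prodFalse, prodTrue, hb]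
    · have hb : e2e (thinkerOf next p.2) T x = false := hb
      simp [prodFalse, prodTrue, hb]
    · unfold e2eCost
      omega
  · have hA := hF l (fun _ h => h) hl
    have hB := hTr l (fun _ h => h) hl
    simp only [Nat.size_one]
    have : Q * (1 + (e2eCost Q + 49 + 2 * ((Q * Q + 2) * (Q + 1)))) =
      Q * (e2eCost Q + 50 + 2 * ((Q * Q + 2) * (Q + 1))) := by ring
    omega

/-- The program for the final predictor computes the vote. -/
theorem out_predictTm {T : ℕ} (hT : 1 ≤ T) {l : List (voterTy code).Val}
    (hl : ∀ p ∈ l, 0 < p.1.1 ∧ 0 < p.1.2) :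
    (fun x => (predictTm next).out ((T, l), x) : Thinker) = vote T (l.map (voterOf next)) := by
  funext x
  -- Only the value is wanted here, so any cost bound will do: the voters and the strings of bounded
  -- length are finite in number.
  have hfin : {q : (voterTy code).Val × Str | q.1 ∈ l ∧ q.2.length ≤ x.length + T}.Finite :=
    (l.finite_toSet.prod (List.finite_length_le Bool (x.length + T))).subset fun q hq => hq
  obtain ⟨B, hB⟩ := (hfin.image fun q => next.time (q.1.2, q.2) + q.1.1.1 + q.1.1.2).bddAbove
  rw [vote_voters next T x l hl]
  have hpB : ∀ p ∈ l, ∀ w : Str, w.length ≤ x.length + T →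
      next.time (p.2, w) + p.1.1 + p.1.2 ≤ B := fun p hp w hw => hB ⟨(p, w), ⟨hp, hw⟩, rfl⟩
  have hlt : B + (x.length + T) + l.length < 2 ^ (B + (x.length + T) + l.length) := Nat.lt_two_pow_self
  refine (ev_predictTm next (Q := B + (x.length + T) + l.length) hT (by omega) le_rfl (by omega)
    fun p hp => ⟨?_, ?_, fun w hw => ?_⟩).out_eq
  · exact (((Nat.le_add_left _ _).trans (Nat.le_add_right _ _)).trans (hpB p hp [] (by simp))).trans_lt
      (lt_of_le_of_lt (by omega) hlt)
  · exact ((Nat.le_add_left _ _).trans (hpB p hp [] (by simp))).trans_lt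
      (lt_of_le_of_lt (by omega) hlt)
  · have := hpB p hp w hw
    omega

end Oracle

/-! ### Simulation of an interaction by a program -/

/-- The program `P` has, through `φ`, the joint law of value and rounds of the interaction `A`; its
possible values satisfy `Inv`, and it takes at most `B` steps. -/
structure Sim {m : ℕ} {α β : Type} (P : StateT (Trace m) PMF α) (A : Interaction m β) (φ : α → β)
    (Inv : α → Prop) (B : ℕ) : Prop where
  law : ∀ s, (P s).map (fun o => (φ o.1, o.2.rounds)) = A s.rounds
  supp : ∀ s, ∀ o ∈ (P s).support, Inv o.1 ∧ o.2.steps ≤ s.steps + B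

theorem PMF_bind_congr {α β : Type} {p : PMF α} {f g : α → PMF β}
    (h : ∀ a ∈ p.support, f a = g a) : p.bind f = p.bind g := by
  ext b
  rw [PMF.bind_apply, PMF.bind_apply]
  refine tsum_congr fun a => ?_
  by_cases ha : a ∈ p.support
  · rw [h a ha]
  · rw [(p.apply_eq_zero_iff a).2 ha, zero_mul, zero_mul]

theorem stateT_bind_apply {σ α β : Type} (P : StateT σ PMF α) (k : α → StateT σ PMF β) (s : σ) :
    (P >>= k) s = (P s).bind fun o => k o.1 o.2 := by
  change (P s).bind _ = _
  congr 1

theorem stateT_pure_apply {σ α : Type} (a : α) (s : σ) :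
    (pure a : StateT σ PMF α) s = PMF.pure (a, s) := rfl

theorem tick_apply {m n : ℕ} (s : Trace m) :
    tick n s = PMF.pure ((), { s with steps := s.steps + n }) := rfl

theorem stateT_lift_apply {σ α : Type} (p : PMF α) (s : σ) :
    (StateT.lift p : StateT σ PMF α) s = p.map fun a => (a, s) := rfl

/-- The requested training examples. -/
def decodeIdx (m : ℕ) (l : List ℕ) : List (Fin m) :=
  l.filterMap fun i => if h : i < m then some ⟨i, h⟩ else none

/-! ### Composition rules for simulations -/

namespace Sim

variable {m : ℕ} {α β γ δ : Type}

theorem conv {P : StateT (Trace m) PMF α} {A A' : Interaction m β} {φ : α → β}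
    {Inv Inv' : α → Prop} {B B' : ℕ} (h : Sim P A φ Inv B) (hA : A = A')
    (hInv : ∀ x, Inv x → Inv' x) (hB : B ≤ B') : Sim P A' φ Inv' B' := by
  subst hA
  exact ⟨h.law, fun s o ho => ⟨hInv _ (h.supp s o ho).1, (h.supp s o ho).2.trans (by omega)⟩⟩

theorem pure (x : α) (φ : α → β) : Sim (m := m) (pure x) (pure (φ x)) φ (fun y => y = x) 0 where
  law s := by
    simp only [stateT_pure_apply, PMF.pure_map]
  supp s o ho := by
    rw [stateT_pure_apply, PMF.mem_support_pure_iff] at ho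
    subst ho
    exact ⟨rfl, le_rfl⟩

/-- The continuation has to be simulated only from values satisfying the invariant, as all others
have probability zero. -/
theorem bind {P : StateT (Trace m) PMF α} {A : Interaction m β} {φ : α → β} {Inv : α → Prop} {B : ℕ}
    {k : α → StateT (Trace m) PMF γ} {A' : β → Interaction m δ} {ψ : γ → δ} {Inv' : γ → Prop} {C : ℕ}
    (h : Sim P A φ Inv B) (h' : ∀ x, Inv x → Sim (k x) (A' (φ x)) ψ Inv' C) :
    Sim (P >>= k) (A >>= A') ψ Inv' (B + C) where
  law s := by
    rw [stateT_bind_apply, stateT_bind_apply, PMF.map_bind, ← h.law s, PMF.bind_map]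
    refine PMF_bind_congr fun o ho => ?_
    exact (h' o.1 (h.supp s o ho).1).law o.2
  supp s o ho := by
    rw [stateT_bind_apply, PMF.mem_support_bind_iff] at ho
    obtain ⟨p, hp, ho⟩ := ho
    obtain ⟨h1, h2⟩ := h.supp s p hp
    obtain ⟨h3, h4⟩ := (h' p.1 h1).supp p.2 o ho
    exact ⟨h3, by omega⟩

theorem tick {P : StateT (Trace m) PMF α} {A : Interaction m β} {φ : α → β} {Inv : α → Prop}
    {B n : ℕ} (h : Sim P A φ Inv B) :
    Sim (CoTBoosting.tick n >>= fun _ => P) A φ Inv (n + B) where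
  law s := by
    rw [stateT_bind_apply, tick_apply, PMF.pure_bind]
    exact h.law _
  supp s o ho := by
    rw [stateT_bind_apply, tick_apply, PMF.pure_bind] at ho
    obtain ⟨h1, h2⟩ := h.supp _ o ho
    exact ⟨h1, h2.trans (by simp only; omega)⟩

theorem run_bind {G : List Ty} {a : Ty} {t : Tm G a} {e : Env G} {v : a.Val} {B C : ℕ}
    {k : a.Val → StateT (Trace m) PMF γ} {A : Interaction m δ} {ψ : γ → δ} {Inv : γ → Prop}
    (h : Ev t e v B) (hk : Sim (k v) A ψ Inv C) : Sim (t.run e >>= k) A ψ Inv (B + C) := by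
  obtain ⟨rfl, h2⟩ := h
  have : Sim (CoTBoosting.tick (t.eval e).2 >>= fun _ => k (t.eval e).1) A ψ Inv
    ((t.eval e).2 + C) := hk.tick
  refine Sim.conv ?_ rfl (fun _ h => h) (show (t.eval e).2 + C ≤ B + C by omega)
  have heq : (t.run e >>= k) = CoTBoosting.tick (m := m) (t.eval e).2 >>= fun _ => k (t.eval e).1 := by
    simp only [Tm.run, bind_assoc, pure_bind]
  rw [heq]
  exact this

theorem lift (p : PMF α) (Inv : α → Prop) (h : ∀ x ∈ p.support, Inv x) :
    Sim (m := m) (StateT.lift p) (StateT.lift p) id Inv 0 where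
  law s := by
    rw [stateT_lift_apply, stateT_lift_apply, PMF.map_comp]
    rfl
  supp s o ho := by
    rw [stateT_lift_apply, PMF.support_map] at ho
    obtain ⟨x, hx, rfl⟩ := ho
    exact ⟨h x hx, le_rfl⟩

/-! #### Commands -/

variable {T : ℕ} {xs : Fin m → Str} {adv : Adversary m} {G : List Ty} {a b : Ty} {e : Env G}

theorem ret {t : Tm G a} {v : a.Val} {B : ℕ} (h : Ev t e v B) (φ : a.Val → β) :
    Sim ((Cmd.ret t).exec T xs adv e) (Pure.pure (φ v)) φ (fun y => y = v) B := by
  have := run_bind (k := fun x => (Pure.pure x : StateT (Trace m) PMF a.Val)) h (Sim.pure v φ)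
  rw [bind_pure, add_zero] at this
  simpa only [Cmd.exec] using this

theorem cmdBind {c : Cmd G a} {k : Cmd (a :: G) b} {A : Interaction m β} {φ : a.Val → β}
    {Inv : a.Val → Prop} {A' : β → Interaction m δ} {ψ : b.Val → δ} {Inv' : b.Val → Prop} {B C : ℕ}
    (h : Sim (c.exec T xs adv e) A φ Inv B)
    (h' : ∀ x, Inv x → Sim (k.exec T xs adv (x, e)) (A' (φ x)) ψ Inv' C) :
    Sim ((Cmd.bind c k).exec T xs adv e) (A >>= A') ψ Inv' (B + (1 + C)) := by
  simp only [Cmd.exec]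
  exact h.bind fun x hx => (h' x hx).tick

theorem cmdLet {t : Tm G a} {v : a.Val} {k : Cmd (a :: G) b} {A : Interaction m δ} {ψ : b.Val → δ}
    {Inv : b.Val → Prop} {B C : ℕ} (h : Ev t e v B) (h' : Sim (k.exec T xs adv (v, e)) A ψ Inv C) :
    Sim ((Cmd.bind (.ret t) k).exec T xs adv e) A ψ Inv (B + (1 + C)) := by
  simp only [Cmd.exec]
  exact run_bind h h'.tick

theorem cmdIte {t : Tm G .bit} {x : Bool} {c k : Cmd G a} {A : Interaction m β} {φ : a.Val → β}
    {Inv : a.Val → Prop} {B C : ℕ} (h : Ev t e x B)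
    (hc : x = true → Sim (c.exec T xs adv e) A φ Inv C)
    (hk : x = false → Sim (k.exec T xs adv e) A φ Inv C) :
    Sim ((Cmd.ite t c k).exec T xs adv e) A φ Inv (B + (1 + C)) := by
  simp only [Cmd.exec]
  refine run_bind h (Sim.tick ?_)
  cases x
  · simpa using hk rfl
  · simpa using hc rfl

theorem cmdIter {n : Tm G .nat} {init : Tm G a} {body : Cmd (a :: G) a} {k : ℕ} {v : a.Val}
    {A : Interaction m β} {φ : a.Val → β} {Inv : a.Val → Prop} {B C D : ℕ}
    (hn : Ev n e k B) (hi : Ev init e v C)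
    (h : Sim (repeatM (fun y => do CoTBoosting.tick 1; body.exec T xs adv (y, e)) k v) A φ Inv D) :
    Sim ((Cmd.iter n init body).exec T xs adv e) A φ Inv (B + (C + D)) := by
  simp only [Cmd.exec]
  exact run_bind hn (run_bind hi h)

theorem cmdRand {n : Tm G .nat} {k B : ℕ} (hn : Ev n e (k + 1 : ℕ) B) :
    Sim ((Cmd.rand n).exec T xs adv e) (StateT.lift (uniformBelow (k + 1))) id
      (fun r : ℕ => r < k + 1) (B + (1 + Nat.size (k + 1) + 0)) := by
  simp only [Cmd.exec]
  refine run_bind hn (Sim.tick (Sim.lift _ _ fun r hr => ?_))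
  rw [uniformBelow, PMF.support_map] at hr
  obtain ⟨i, -, rfl⟩ := hr
  exact i.2

theorem cmdQuery {t : Tm G (.list .nat)} {l : List ℕ} {S : List (Fin m)} {B : ℕ}
    (h : Ev t e l B) (hS : decodeIdx m l = S) {Inv : List Str → Prop}
    (hInv : ∀ H, Inv (S.map fun i => cot (adv xs H S) T (xs i))) :
    Sim ((Cmd.query t).exec T xs adv e) (request T xs adv S) id Inv
      (B + (1 + l.length + T * S.length + 0)) := by
  simp only [Cmd.exec]
  subst hS
  refine run_bind h (Sim.tick ?_)
  have heq : ∀ s : Trace m, (request T xs adv (decodeIdx m l)).run s.rounds =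
      PMF.pure ((decodeIdx m l).map fun i => cot (adv xs s.rounds (decodeIdx m l)) T (xs i),
        ⟨decodeIdx m l, adv xs s.rounds (decodeIdx m l)⟩ :: s.rounds) := fun s => rfl
  constructor
  · intro s
    change ((PMF.bind ((request T xs adv (decodeIdx m l)).run s.rounds) fun o =>
      PMF.pure (o.1, { s with rounds := o.2 })).map _) = _
    rw [heq, PMF.pure_bind, PMF.pure_map]
    rfl
  · intro s o ho
    change o ∈ (PMF.bind ((request T xs adv (decodeIdx m l)).run s.rounds) fun o =>
      PMF.pure (o.1, { s with rounds := o.2 })).support at ho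
    rw [heq, PMF.pure_bind, PMF.mem_support_pure_iff] at ho
    subst ho
    exact ⟨hInv _, le_rfl⟩

end Sim

/-! ### The law of a drawn example -/

/-- The list of weighted examples. -/
def encEx {m : ℕ} (w : Fin m → ℕ) (xs : Fin m → Str) (ys : Fin m → Bool) : List exTy.Val :=
  List.ofFn fun i => (w i, i.val, xs i, ys i)

theorem wsum_encEx {m : ℕ} (w : Fin m → ℕ) (xs : Fin m → Str) (ys : Fin m → Bool) :
    wsum (encEx w xs ys) = ∑ i, w i := by
  simp [wsum, encEx, List.map_ofFn, List.sum_ofFn]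

theorem foldl_pickStep_done (l : List exTy.Val) (s : ℕ × ℕ × Str) :
    l.foldl pickStep (true, s) = (true, s) := by
  induction l with
  | nil => rfl
  | cons p l ih => simpa [pickStep] using ih

theorem pick_cons (p : exTy.Val) (l : List exTy.Val) (r : ℕ) :
    pick (p :: l) r = if r < p.1 then (p.2.1, p.2.2.1) else pick l (r - p.1) := by
  unfold pick
  rw [List.foldl_cons]
  by_cases h : r + 1 ≤ p.1
  · rw [if_pos (show r < p.1 from h)]
    simp only [pickStep, if_pos h]
    rw [if_neg (by simp), foldl_pickStep_done]
  · rw [if_neg (show ¬ r < p.1 from h)]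
    simp only [pickStep, if_neg h]
    rw [if_neg (by simp)]

/-- Each example is selected by exactly as many numbers as its weight. -/
theorem sum_pick (l : List (ℕ × ℕ × Str × Bool)) (g : ℕ × Str → ℝ≥0∞) :
    ∑ r ∈ Finset.range (wsum l), g (pick l r) =
      (l.map fun p => (p.1 : ℝ≥0∞) * g (p.2.1, p.2.2.1)).sum := by
  induction l with
  | nil => simp [wsum]
  | cons p l ih =>
    have hw : wsum (p :: l) = p.1 + wsum l := by simp [wsum]
    rw [hw, Finset.sum_range_add, List.map_cons, List.sum_cons, ← ih]
    congr 1
    · rw [Finset.sum_congr rfl (g := fun _ => g (p.2.1, p.2.2.1)) fun r hr => by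
        rw [pick_cons, if_pos (Finset.mem_range.1 hr)]]
      simp
    · refine Finset.sum_congr rfl fun r _ => ?_
      rw [pick_cons, if_neg (by simp), Nat.add_sub_cancel_left]

/-- The distribution `D` is proportional to the weights `w`. -/
def HasWeights {m : ℕ} (D : PMF (Fin m)) (w : Fin m → ℕ) : Prop :=
  (0 < ∑ i, w i) ∧ ∀ i, D i = (w i : ℝ≥0∞) * ((∑ i, w i : ℕ) : ℝ≥0∞)⁻¹

/-- Hence one uniform number below the total weight realizes a draw from `D` exactly, without real
arithmetic. -/
theorem map_pick_uniformBelow {m : ℕ} {D : PMF (Fin m)} {w : Fin m → ℕ} (hD : HasWeights D w)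
    (xs : Fin m → Str) (ys : Fin m → Bool) :
    (uniformBelow (∑ i, w i)).map (pick (encEx w xs ys)) = D.map fun i => (i.val, xs i) := by
  classical
  obtain ⟨hpos, hw⟩ := hD
  obtain ⟨n, hn⟩ := Nat.exists_eq_add_of_le' hpos
  have hws := wsum_encEx w xs ys
  rw [hn] at hw hws ⊢
  rw [uniformBelow, PMF.map_comp]
  ext z
  rw [PMF.map_apply, PMF.map_apply, tsum_fintype, tsum_fintype]
  simp only [PMF.uniformOfFintype_apply, Fintype.card_fin, Function.comp_apply, hw]
  rw [Fin.sum_univ_eq_sum_range (fun r => if z = pick (encEx w xs ys) r then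
    (((n + 1 : ℕ) : ℝ≥0∞))⁻¹ else 0), ← hws,
    sum_pick (encEx w xs ys) fun q => if z = q then ((wsum (encEx w xs ys) : ℕ) : ℝ≥0∞)⁻¹ else 0, encEx,
    List.map_ofFn, List.sum_ofFn]
  refine Finset.sum_congr rfl fun i _ => ?_
  simp only [Function.comp_apply, mul_ite, mul_zero]

theorem toReal_of_hasWeights {m : ℕ} {D : PMF (Fin m)} {w : Fin m → ℕ} (hD : HasWeights D w)
    (i : Fin m) : (D i).toReal = w i / (∑ i, w i : ℕ) := by
  rw [hD.2 i, ENNReal.toReal_mul, ENNReal.toReal_inv, ENNReal.toReal_natCast, ENNReal.toReal_natCast,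
    div_eq_mul_inv]

theorem errSum_encEx {m : ℕ} (f : Thinker) (T : ℕ) (w : Fin m → ℕ) (xs : Fin m → Str)
    (ys : Fin m → Bool) :
    errSum f T (encEx w xs ys) = ∑ i, if e2e f T (xs i) ≠ ys i then w i else 0 := by
  simp only [errSum, encEx, List.map_ofFn, List.sum_ofFn]
  rfl

theorem error_eq_div {m : ℕ} (s : Setup m) {D : PMF (Fin m)} {w : Fin m → ℕ} (hD : HasWeights D w)
    (f : Thinker) :
    s.error D f = errSum f s.T (encEx w s.xs s.ys) / (∑ i, w i : ℕ) := by
  rw [Setup.error, errSum_encEx]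
  push_cast
  rw [Finset.sum_div]
  refine Finset.sum_congr rfl fun i _ => ?_
  rw [toReal_of_hasWeights hD]
  push_cast
  split_ifs <;> ring

/-- The weighted error is a quotient of naturals, so the stopping test of the inner loop is an exact
integer comparison. -/
theorem error_le_quarter_iff {m : ℕ} (s : Setup m) {D : PMF (Fin m)} {w : Fin m → ℕ}
    (hD : HasWeights D w) (f : Thinker) :
    s.error D f ≤ 1 / 4 ↔ 4 * errSum f s.T (encEx w s.xs s.ys) ≤ ∑ i, w i := by
  have hpos : (0 : ℝ) < (∑ i, w i : ℕ) := by exact_mod_cast hD.1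
  rw [error_eq_div s hD, div_le_iff₀ hpos, ← Nat.cast_le (α := ℝ)]
  push_cast
  constructor <;> intro h <;> linarith

/-! ### The learner -/

abbrev x7 {G : List Ty} {a b c d e f g h : Ty} : Tm (h :: g :: f :: e :: d :: c :: b :: a :: G) a :=
  .var (.tail (.tail (.tail (.tail (.tail (.tail (.tail .head)))))))

theorem Ev.x7 {G : List Ty} {a b c d f g h i : Ty} {e : Env G} {va : a.Val} {vb : b.Val} {vc : c.Val}
    {vd : d.Val} {vf : f.Val} {vg : g.Val} {vh : h.Val} {vi : i.Val} :
    Ev (G := i :: h :: g :: f :: d :: c :: b :: a :: G) CoTBoosting.x7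
      (vi, vh, vg, vf, vd, vc, vb, va, e) va 1 := ⟨rfl, le_rfl⟩

/-- A value of each type, in any context. -/
def defaultIn {G : List Ty} : (a : Ty) → Tm G a
  | .bit => .bit false
  | .nat => .num 0
  | .prod a b => .pair (defaultIn a) (defaultIn b)
  | .list _ => .nil

/-- The default value. -/
def defaultVal : (a : Ty) → a.Val
  | .bit => false
  | .nat => (0 : ℕ)
  | .prod a b => (defaultVal a, defaultVal b)
  | .list _ => []

/-- The cost of the default value. -/
def defaultCost : Ty → ℕ
  | .bit => 1
  | .nat => 1
  | .prod a b => 1 + defaultCost a + defaultCost b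
  | .list _ => 1

theorem ev_defaultIn {G : List Ty} (e : Env G) :
    (a : Ty) → Ev (defaultIn a) e (defaultVal a) (defaultCost a)
  | .bit => Ev.bit _
  | .nat => (Ev.num 0).mono (by simp [defaultCost])
  | .prod a b => Ev.pair (ev_defaultIn e a) (ev_defaultIn e b)
  | .list _ => Ev.nil

/-- The state of the inner loop: success, representation, error weight. -/
abbrev innerTy (code : Ty) : Ty := .prod .bit (.prod code .nat)

/-- The state of the outer loop: finished, weighted examples, voters. -/
abbrev outerTy (code : Ty) : Ty := .prod .bit (.prod (.list exTy) (.list (voterTy code)))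

section Programs

variable {G : List Ty} {code : Ty}

abbrev inpData (t : Tm G learnerInput) : Tm G (.list (.prod .str .bit)) := .fst t
abbrev inpD (t : Tm G learnerInput) : Tm G .nat := .fst (.snd t)
abbrev inpT (t : Tm G learnerInput) : Tm G .nat := .fst (.snd (.snd t))
abbrev inpK (t : Tm G learnerInput) : Tm G .nat := .fst (.snd (.snd (.snd t)))
abbrev inpL (t : Tm G learnerInput) : Tm G .nat := .fst (.snd (.snd (.snd (.snd t))))
abbrev inpM (t : Tm G learnerInput) : Tm G .nat := .snd (.snd (.snd (.snd (.snd t))))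

variable (find : Tm [.prod (.list (.prod .str .bit)) .nat] code) (next : Tm [.prod code .str] .bit)

/-- Draw one more example. -/
def drawBody : Cmd [.list drawTy, innerTy code, .nat, outerTy code, learnerInput] (.list drawTy) :=
  .bind (.rand x2) (.ret (.cons (.call pickTm (.pair (.fst (.snd x4)) x0)) x1))

/-- Draw the examples of an attempt. -/
def drawCmd : Cmd [innerTy code, .nat, outerTy code, learnerInput] (.list drawTy) :=
  .iter (inpM x3) .nil drawBody

/-- The state of the inner loop for a representation, the innermost variable. -/
def scoreTm : Tm [code, .list .str, .list drawTy, .list drawTy, innerTy code, .nat, outerTy code,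
    learnerInput] (innerTy code) :=
  .letIn (.call (errTm next) (.pair (.pair x0 (inpT x7)) (.fst (.snd x6))))
    (.pair (.le (.mul (.num 4) x0) x6) (.pair x1 x0))

/-- One attempt. -/
def attemptCmd : Cmd [innerTy code, .nat, outerTy code, learnerInput] (innerTy code) :=
  .bind drawCmd
    (.bind (.ret (.call (revTm drawTy) x0))
      (.bind (.query (.call idxTm x0))
        (.bind (.ret (.call find (.pair (.call pairsTm (.pair x1 x0)) (inpD x6))))
          (.ret (scoreTm next)))))

/-- The inner loop. -/
def weakCmd : Cmd [.nat, outerTy code, learnerInput] (innerTy code) :=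
  .iter (inpL x2) (.pair (.bit false) (.pair (defaultIn code) (.num 0)))
    (.ite (.fst x0) (.ret x0) (attemptCmd find next))

/-- The new state of the outer loop. -/
def updateTm : Tm [innerTy code, .nat, outerTy code, learnerInput] (outerTy code) :=
  .ite (.le (.snd (.snd x0)) (.num 0))
    (.pair (.bit true) (.pair (.fst (.snd x2))
      (.cons (.pair (.pair (.num 2) (.num 1)) (.fst (.snd x0))) .nil)))
    (.ite (.le x1 (.snd (.snd x0)))
      (.pair (.bit false) (.pair (.fst (.snd x2))
        (.cons (.pair (.pair (.num 1) (.num 1)) (.fst (.snd x0))) (.snd (.snd x2)))))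
      (.pair (.bit false) (.pair
        (.call (reweightTm next) (.pair (.pair (.fst (.snd x0)) (inpT x3))
          (.pair (.fst (.snd x2)) (.pair x1 (.snd (.snd x0))))))
        (.cons (.pair (.pair (.sub x1 (.snd (.snd x0))) (.snd (.snd x0))) (.fst (.snd x0)))
          (.snd (.snd x2))))))

/-- One iteration of the outer loop. -/
def boostCmd : Cmd [outerTy code, learnerInput] (outerTy code) :=
  .ite (.fst x0) (.ret x0)
    (.bind (.ret (.call totalTm (.fst (.snd x0)))) (.bind (weakCmd find next) (.ret (updateTm next))))

/-- The learner. -/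
def learnCmd : Cmd [learnerInput] (repTy code) :=
  .bind (.iter (inpK x0) (.pair (.bit false) (.pair (.call initTm (inpData x0)) .nil))
      (boostCmd find next))
    (.ret (.pair (inpT x1) (.snd (.snd x0))))

end Programs

/-! ### Bounds on the quantities of a run -/

/-- The quantity `Q` bounds the parameters of a run, the costs of the oracle and the bit lengths of
the weights. -/
structure RunBounds {F : ℕ → Set Thinker} (O : ConsistencyOracle F) (d T m K L M Q : ℕ) : Prop where
  one_le_T : 1 ≤ T
  one_le_L : 1 ≤ L
  two_le : 2 ≤ Q
  d_add_T : d + T ≤ Q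
  m_le : m ≤ Q
  K_le : K ≤ Q
  L_le : L ≤ Q
  M_le : M ≤ Q
  MT_le : M * T ≤ Q
  oracle_le : O.degree * (1 + d + (d + T) + M * T) ^ O.degree ≤ Q
  weight_lt : m ^ 2 ^ K < 2 ^ Q

section Simulation

variable {F : ℕ → Set Thinker} {O : ConsistencyOracle F} {d T m K L M Q : ℕ}

/-- The representation was found by the oracle on the answers to one request. -/
def GoodCode (O : ConsistencyOracle F) (d T M : ℕ) (r : O.code.Val) : Prop :=
  ∃ S : List (Str × Bool), (∃ f ∈ F d, ∀ p ∈ S, f p.1 = p.2) ∧ (∀ p ∈ S, p.1.length ≤ d + T) ∧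
    S.length ≤ M * T ∧ r = O.find.out (S, d)

theorem GoodCode.next_time {r : O.code.Val} (h : GoodCode O d T M r)
    (hQ : RunBounds O d T m K L M Q) (w : Str) (hw : w.length ≤ d + T) :
    O.next.time (r, w) ≤ Q := by
  obtain ⟨S, h1, h2, h3, rfl⟩ := h
  refine (O.next_time d (d + T) S h1 h2 w hw).trans (le_trans ?_ hQ.oracle_le)
  gcongr

theorem oracle_find_time {S : List (Str × Bool)} (h1 : ∃ f ∈ F d, ∀ p ∈ S, f p.1 = p.2)
    (h2 : ∀ p ∈ S, p.1.length ≤ d + T) (h3 : S.length ≤ M * T)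
    (hQ : RunBounds O d T m K L M Q) : O.find.time (S, d) ≤ Q := by
  refine (O.find_time d (d + T) S h1 h2).trans (le_trans ?_ hQ.oracle_le)
  gcongr

/-- The value of the input of the learner. -/
def inputVal {m : ℕ} (xs : Fin m → Str) (ys : Fin m → Bool) (d T K L M : ℕ) : learnerInput.Val :=
  (List.ofFn fun i => (xs i, ys i), d, T, K, L, M)

/-- The code of a draw. -/
def encDraw {m : ℕ} (xs : Fin m → Str) (i : Fin m) : ℕ × Str := (i.val, xs i)

theorem decodeIdx_encDraw {m : ℕ} (xs : Fin m → Str) (S : List (Fin m)) :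
    decodeIdx m ((S.map (encDraw xs)).map Prod.fst) = S := by
  induction S with
  | nil => rfl
  | cons i S ih =>
    have : decodeIdx m (((i :: S).map (encDraw xs)).map Prod.fst) =
        i :: decodeIdx m ((S.map (encDraw xs)).map Prod.fst) := by
      simp [decodeIdx, encDraw]
    rw [this, ih]

/-- The cost of drawing one example. -/
def drawCost (Q : ℕ) : ℕ := 60 + Q * (50 + 6 * Q) + Q

/-! ### Simulation of the draws -/

section Draw

variable {w : Fin m → ℕ} {xs : Fin m → Str} {ys : Fin m → Bool} {D : PMF (Fin m)} {adv : Adversary m}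
  {code : Ty}

/-- The environment of a draw. -/
abbrev drawEnv (w : Fin m → ℕ) (xs : Fin m → Str) (ys : Fin m → Bool) (st : (innerTy code).Val)
    (b : Bool) (fs : List (voterTy code).Val) (inp : learnerInput.Val) :
    Env [innerTy code, .nat, outerTy code, learnerInput] :=
  (st, (∑ i, w i : ℕ), (b, encEx w xs ys, fs), inp, ())

theorem sim_draw_step (hD : HasWeights D w) (hm : m ≤ Q) (hW : ∑ i, w i < 2 ^ Q)
    {st : (innerTy code).Val} {b : Bool} {fs : List (voterTy code).Val} {inp : learnerInput.Val}
    (acc : List drawTy.Val) :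
    Sim (drawBody.exec T xs adv ((acc, drawEnv w xs ys st b fs inp) :
        Env [.list drawTy, innerTy code, .nat, outerTy code, learnerInput]))
      (StateT.lift (D.map fun i => (encDraw xs i :: acc : List drawTy.Val))) id
      (fun l => ∃ i, l = encDraw xs i :: acc) (drawCost Q - 1) := by
  obtain ⟨n, hn⟩ : ∃ n, ∑ i, w i = n + 1 := Nat.exists_eq_add_of_le' hD.1
  have hws := wsum_encEx w xs ys
  have hlen : (encEx w xs ys).length ≤ Q := by simpa [encEx] using hm
  have hsize := size_le_of_lt hW
  -- Every admissible number selects a genuine example; this is read off from the support of the law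
  -- of `pick`.
  have key : ∀ r, r < n + 1 → ∃ i, pick (encEx w xs ys) r = encDraw xs i := by
    intro r hr
    have h1 : pick (encEx w xs ys) r ∈ ((uniformBelow (∑ i, w i)).map (pick (encEx w xs ys))).support := by
      rw [PMF.support_map, hn, uniformBelow, PMF.support_map]
      exact ⟨r, ⟨⟨r, hr⟩, by simp, rfl⟩, rfl⟩
    rw [map_pick_uniformBelow hD, PMF.support_map] at h1
    obtain ⟨i, -, hi⟩ := h1
    exact ⟨i, hi.symm⟩
  unfold drawBody drawEnv
  refine Sim.conv (Sim.cmdBind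
    (A' := fun r => (pure (pick (encEx w xs ys) r :: acc) : Interaction m (List drawTy.Val)))
    (Sim.cmdRand (k := n) (Ev.conv Ev.x2 hn le_rfl)) (C := 40 + Q * (50 + 6 * Q))
      fun (r : ℕ) (hr : r < n + 1) => Sim.conv
        (Sim.ret (v := (pick (encEx w xs ys) r :: acc : List drawTy.Val))
          (Ev.cons (Ev.call (Ev.pair (Ev.fst (Ev.snd Ev.x4)) Ev.x0)
          (ev_pickTm (Q := Q) hlen (by rw [hws]; exact hW) (by rw [hws, hn]; exact hr))) Ev.x1) id)
          rfl ?_ (by omega)) ?_ (fun _ h => h) ?_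
  · rintro l rfl
    obtain ⟨i, hi⟩ := key r hr
    exact ⟨i, by rw [hi]⟩
  · funext H
    rw [stateT_bind_apply, stateT_lift_apply, stateT_lift_apply, PMF.bind_map, PMF.map_comp]
    have := map_pick_uniformBelow hD xs ys
    rw [hn] at this
    change (uniformBelow (n + 1)).bind (PMF.pure ∘ fun r => (pick (encEx w xs ys) r :: acc, H)) = _
    rw [PMF.bind_pure_comp]
    change (uniformBelow (n + 1)).map ((fun q => (q :: acc, H)) ∘ pick (encEx w xs ys)) = _
    rw [← PMF.map_comp, this, PMF.map_comp]
    rfl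
  · rw [hn] at hsize
    unfold drawCost
    omega

/-- New draws go to the front of the list, so the sample appears reversed; apart from that the
recursion is the one defining `iid`. -/
theorem sim_draws (hD : HasWeights D w) (hm : m ≤ Q) (hW : ∑ i, w i < 2 ^ Q)
    {st : (innerTy code).Val} {b : Bool} {fs : List (voterTy code).Val} {inp : learnerInput.Val} :
    ∀ (n : ℕ) (acc : List drawTy.Val),
    Sim (repeatM (fun y : List drawTy.Val => tick 1 >>= fun _ =>
        drawBody.exec T xs adv ((y, drawEnv w xs ys st b fs inp) :
        Env [.list drawTy, innerTy code, .nat, outerTy code, learnerInput])) n acc)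
      (StateT.lift ((iid D n).map fun t =>
        (((List.ofFn t).map (encDraw xs)).reverse ++ acc : List drawTy.Val))) id
      (fun l => ∃ t : Fin n → Fin m, l = ((List.ofFn t).map (encDraw xs)).reverse ++ acc)
      (n * drawCost Q)
  | 0, acc => by
    refine Sim.conv (Sim.pure acc id) ?_ ?_ (by omega)
    · funext H
      rw [stateT_lift_apply, iid, PMF.pure_map, PMF.pure_map]
      rfl
    · rintro _ rfl
      exact ⟨Fin.elim0, by simp⟩
  | n + 1, acc => by
    have hc : 1 ≤ drawCost Q := by unfold drawCost; omega
    refine Sim.conv (Sim.bind (Sim.tick (sim_draw_step hD hm hW acc)) (A' := fun l => StateT.lift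
      ((iid D n).map fun t => (((List.ofFn t).map (encDraw xs)).reverse ++ l : List drawTy.Val)))
      (Inv' := fun l => ∃ t : Fin (n + 1) → Fin m, l = ((List.ofFn t).map (encDraw xs)).reverse ++ acc)
      fun l hl => Sim.conv (sim_draws hD hm hW n l) rfl ?_ le_rfl) ?_ (fun _ h => h)
      (by rw [add_mul]; omega)
    · rintro _ ⟨t, rfl⟩
      obtain ⟨i, rfl⟩ := hl
      exact ⟨Fin.cons i t, by simp [List.ofFn_succ]⟩
    · funext H
      simp only [stateT_bind_apply, stateT_lift_apply, iid, PMF.map_comp, PMF.map_bind, PMF.bind_map,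
        PMF.pure_map]
      refine congrArg _ (funext fun i => ?_)
      simp only [Function.comp_apply]
      rw [← PMF.bind_pure_comp]
      refine congrArg _ (funext fun t => ?_)
      simp [List.ofFn_succ]

end Draw

end Simulation

/-! ### Simulation of the inner loop -/

section Attempt

variable {F : ℕ → Set Thinker} {O : ConsistencyOracle F} {d T m K L M Q : ℕ}
  {w : Fin m → ℕ} {xs : Fin m → Str} {ys : Fin m → Bool} {D : PMF (Fin m)} {adv : Adversary m}

/-- The states of the inner loop that record a representation and its error weight. -/
def InnerInv (O : ConsistencyOracle F) (d T M : ℕ) (w : Fin m → ℕ) (xs : Fin m → Str)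
    (ys : Fin m → Bool) (st : (innerTy O.code).Val) : Prop :=
  GoodCode O d T M st.2.1 ∧ st.2.2 = errSum (thinkerOf O.next st.2.1) T (encEx w xs ys) ∧
    st.1 = decide (4 * errSum (thinkerOf O.next st.2.1) T (encEx w xs ys) ≤ ∑ i, w i)

/-- The cost of computing the state of the inner loop for a representation. -/
def scoreCost (Q : ℕ) : ℕ := 60 + 10 * Q + Q * (e2eCost Q + 50 + 2 * Q)

theorem mem_encEx {p : exTy.Val} (hp : p ∈ encEx w xs ys) : ∃ i, p.2.2.1 = xs i := by
  obtain ⟨i, rfl⟩ := (List.mem_ofFn' _ _).1 hp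
  exact ⟨i, rfl⟩

theorem ev_scoreTm (hQ : RunBounds O d T m K L M Q) (hW : ∑ i, w i < 2 ^ Q)
    (hx : ∀ i, (xs i).length ≤ d) {r : O.code.Val} (hr : GoodCode O d T M r) {Z : List Str}
    {l l' : List drawTy.Val} {st : (innerTy O.code).Val} {b : Bool}
    {fs : List (voterTy O.code).Val} :
    Ev (scoreTm O.next)
      ((r, Z, l, l', drawEnv w xs ys st b fs (inputVal xs ys d T K L M)) :
        Env [O.code, .list .str, .list drawTy, .list drawTy, innerTy O.code, .nat, outerTy O.code,
          learnerInput])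
      (decide (4 * errSum (thinkerOf O.next r) T (encEx w xs ys) ≤ ∑ i, w i), r,
        errSum (thinkerOf O.next r) T (encEx w xs ys)) (scoreCost Q) := by
  have hws := wsum_encEx w xs ys
  have hlen : (encEx w xs ys).length ≤ Q := by simpa [encEx] using hQ.m_le
  have hE := errSum_le_wsum (thinkerOf O.next r) T (encEx w xs ys)
  rw [hws] at hE
  have h1 := size_le_of_lt (hE.trans_lt hW)
  have h2 := size_le_of_lt hW
  have h3 := size_le_of_lt (n := 4 * errSum (thinkerOf O.next r) T (encEx w xs ys)) (Q := Q + 2) (by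
    rw [pow_add]; omega)
  have h4 : Nat.size 4 ≤ 4 := size_le_of_le le_rfl
  have h5 : (Nat.size 4 + 1) * (Nat.size (errSum (thinkerOf O.next r) T (encEx w xs ys)) + 1) ≤
      5 * (Q + 1) := Nat.mul_le_mul (by omega) (by omega)
  unfold scoreTm inputVal drawEnv
  refine Ev.conv (Ev.letIn (Ev.call (Ev.pair (Ev.pair Ev.x0 (Ev.fst (Ev.snd (Ev.snd Ev.x7))))
    (Ev.fst (Ev.snd Ev.x6))) (ev_errTm O.next (n := d + T) hQ.one_le_T (fun p hp => ?_) hQ.d_add_T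
      (fun v hv => hr.next_time hQ v hv) hlen (by rw [hws]; exact hW)))
    (Ev.pair (Ev.le (Ev.mul (Ev.num 4) Ev.x0) Ev.x6) (Ev.pair Ev.x1 Ev.x0))) rfl ?_
  · obtain ⟨i, hi⟩ := mem_encEx hp
    have := hx i
    simp only at hi ⊢
    rw [hi]
    omega
  · unfold scoreCost
    simp only at h1 h2 h3 h4 h5 ⊢
    omega

/-- The cost of one attempt. -/
def attemptCost (Q : ℕ) : ℕ :=
  120 + 40 * Q + Q * drawCost Q + Q * (50 + Q * (40 + 8 * Q)) + scoreCost Q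

/-- The oracle promises consistency and its time bound only for pairs produced by a single member;
pairs read off a genuine chain of thought qualify. -/
theorem mem_nextTokenPairs_cot {f : Thinker} {S : List (Fin m)} {p : Str × Bool}
    (hx : ∀ i, (xs i).length ≤ d)
    (hp : p ∈ nextTokenPairs T ((S.map xs).zip (S.map fun i => cot f T (xs i)))) :
    f p.1 = p.2 ∧ p.1.length ≤ d + T := by
  rw [List.zip_map', nextTokenPairs, List.mem_flatMap] at hp
  obtain ⟨q, hq, hp⟩ := hp
  obtain ⟨i, -, rfl⟩ := List.mem_map.1 hq
  obtain ⟨t, ht, rfl⟩ := List.mem_map.1 hp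
  have ht := List.mem_range.1 ht
  have := hx i
  refine ⟨?_, ?_⟩
  · simp only
    rw [getD_cot f ht, take_cot f ht.le]
  · simp only [List.length_append, List.length_take, length_cot]
    omega

/-- Reversing the list of draws restores their order, and decoding the transmitted indices recovers
the request. The invariant remembers that the representation stems from a legitimate oracle call,
which bounds all later evaluations of it. -/
theorem sim_attempt (hQ : RunBounds O d T m K L M Q) (hD : HasWeights D w)
    (hW : ∑ i, w i < 2 ^ Q) (hx : ∀ i, (xs i).length ≤ d) (hadv : ∀ H S, adv xs H S ∈ F d)
    {st : (innerTy O.code).Val} {b : Bool} {fs : List (voterTy O.code).Val} :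
    Sim ((attemptCmd O.find O.next).exec T xs adv
        (drawEnv w xs ys st b fs (inputVal xs ys d T K L M)))
      ((Setup.mk T xs ys (O.rule d T) adv M).attempt D) (fun st' => thinkerOf O.next st'.2.1)
      (InnerInv O d T M w xs ys) (attemptCost Q) := by
  unfold attemptCmd
  refine Sim.conv (Sim.cmdBind (B := 7 + Q * drawCost Q)
    (C := 110 + 40 * Q + Q * (50 + Q * (40 + 8 * Q)) + scoreCost Q)
    (A' := fun l : List drawTy.Val => request T xs adv (decodeIdx m (l.reverse.map Prod.fst)) >>=
      fun Z => pure (O.rule d T ((l.reverse.map Prod.snd).zip Z)))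
    (Sim.conv (Sim.cmdIter (k := M)
      (Ev.snd (Ev.snd (Ev.snd (Ev.snd (Ev.snd Ev.x3))))) Ev.nil
      (sim_draws hD hQ.m_le hW M [])) rfl (fun _ h => h) ?_) fun l hl => ?_) ?_ (fun _ h => h) ?_
  · have := Nat.mul_le_mul_right (drawCost Q) hQ.M_le
    omega
  · obtain ⟨t, rfl⟩ := hl
    rw [List.append_nil]
    set S := List.ofFn t with hS
    have hSlen : S.length = M := by simp [hS]
    have hrev : ((S.map (encDraw xs)).reverse).reverse = S.map (encDraw xs) := List.reverse_reverse _
    have hsnd : (S.map (encDraw xs)).map Prod.snd = S.map xs := by simp [encDraw, Function.comp_def]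
    have hMQ := hQ.M_le
    have hTM : T * S.length ≤ Q := by rw [hSlen, mul_comm]; exact hQ.MT_le
    simp only [id, hrev]
    refine Sim.conv (Sim.cmdLet (Ev.conv (Ev.call Ev.x0 (ev_revTm (Q := Q) (by simpa [hSlen] using hMQ)))
      hrev le_rfl) (Sim.cmdBind (Inv := fun Z => ∃ f ∈ F d, Z = S.map fun i => cot f T (xs i))
        (C := 80 + 2 * Q + Q * (50 + Q * (40 + 8 * Q)) + scoreCost Q)
        (Sim.cmdQuery (Ev.call Ev.x0 (ev_idxTm (Q := Q) (by simpa [hSlen] using hMQ)))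
          rfl (fun H => ⟨_, hadv H _, by rw [decodeIdx_encDraw]⟩)) fun Z hZ => ?_))
        rfl (fun _ h => h) ?_
    · obtain ⟨f, hf, rfl⟩ := hZ
      have hp := fun p => mem_nextTokenPairs_cot (T := T) (f := f) (S := S) (p := p) hx
      have hlen : (nextTokenPairs T ((S.map xs).zip (S.map fun i => cot f T (xs i)))).length ≤ M * T := by
        rw [length_nextTokenPairs]
        simp [hSlen]
      have hgood : GoodCode O d T M
          (O.find.out (nextTokenPairs T ((S.map xs).zip (S.map fun i => cot f T (xs i))), d)) :=
        ⟨_, ⟨f, hf, fun p h => (hp p h).1⟩, fun p h => (hp p h).2, hlen, rfl⟩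
      have hfind := oracle_find_time (O := O) ⟨f, hf, fun p h => (hp p h).1⟩ (fun p h => (hp p h).2)
        hlen hQ
      rw [hsnd]
      refine Sim.conv (Sim.cmdLet (Ev.call (Ev.pair (Ev.call (Ev.pair Ev.x1 Ev.x0)
        (Ev.conv (ev_pairsTm (T := T) (Q := Q) (n := d) ?_ ?_ ?_ hQ.d_add_T ?_ ?_)
          (congrArg (fun l => nextTokenPairs T (l.zip (S.map fun i => cot f T (xs i)))) hsnd) le_rfl))
        (Ev.fst (Ev.snd Ev.x6))) (Ev.of_time hfind))
        (Sim.ret (ev_scoreTm hQ hW hx hgood) _)) rfl ?_ ?_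
      · simp
      · intro z hz
        obtain ⟨i, -, rfl⟩ := List.mem_map.1 hz
        exact length_cot _ _ _
      · intro p hp
        obtain ⟨i, -, rfl⟩ := List.mem_map.1 hp
        exact hx i
      · simpa [hSlen] using hMQ
      · simpa [hSlen] using hQ.MT_le
      · rintro _ rfl
        exact ⟨hgood, rfl, rfl⟩
      · omega
    · rw [decodeIdx_encDraw]
      simp only [List.length_map]
      omega
  · funext H
    simp only [Setup.attempt, stateT_bind_apply, stateT_lift_apply, PMF.map_comp, PMF.bind_map]
    refine congrArg _ (funext fun t => ?_)
    simp only [Function.comp_apply, List.append_nil, List.reverse_reverse, decodeIdx_encDraw]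
    simp [encDraw, Function.comp_def]
  · unfold attemptCost
    omega

end Attempt

section Loops

variable {F : ℕ → Set Thinker} {O : ConsistencyOracle F} {d T m K L M Q : ℕ}
  {w : Fin m → ℕ} {xs : Fin m → Str} {ys : Fin m → Bool} {D : PMF (Fin m)} {adv : Adversary m}

/-- A loop whose body leaves a state unchanged keeps that state. -/
theorem sim_repeatM_done {α β : Type} {P : α → StateT (Trace m) PMF α} {φ : α → β} {st : α} {B : ℕ}
    (h : Sim (P st) (pure st) id (fun y => y = st) B) :
    ∀ n, Sim (repeatM P n st) (pure (φ st)) φ (fun y => y = st) (n * B)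
  | 0 => Sim.conv (Sim.pure st φ) rfl (fun _ h => h) (by omega)
  | n + 1 => by
    refine Sim.conv (Sim.bind h (A' := fun y => pure (φ y)) (C := n * B)
      (Inv' := fun y => y = st) fun x hx => ?_) ?_ (fun _ h => h) (by rw [add_mul]; omega)
    · subst hx
      exact sim_repeatM_done h n
    · rw [pure_bind]

/-- The cost of one iteration of the inner loop. -/
def weakBodyCost (Q : ℕ) : ℕ := 5 + attemptCost Q

/-- A bounded loop cannot be left early: after a success the flag makes the remaining iterations
idle. The shift is that `weakLearn D r` makes up to `r + 1` attempts. -/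
theorem sim_weakBody (hQ : RunBounds O d T m K L M Q) (hD : HasWeights D w)
    (hW : ∑ i, w i < 2 ^ Q) (hx : ∀ i, (xs i).length ≤ d) (hadv : ∀ H S, adv xs H S ∈ F d)
    {b : Bool} {fs : List (voterTy O.code).Val} :
    ∀ (r : ℕ) (st : (innerTy O.code).Val), st.1 = false →
    Sim (repeatM (fun y : (innerTy O.code).Val => tick 1 >>= fun _ =>
        (Cmd.ite (.fst x0) (.ret x0) (attemptCmd O.find O.next)).exec T xs adv
          (drawEnv w xs ys y b fs (inputVal xs ys d T K L M))) (r + 1) st)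
      ((Setup.mk T xs ys (O.rule d T) adv M).weakLearn D r) (fun st' => thinkerOf O.next st'.2.1)
      (fun st' => InnerInv O d T M w xs ys st') ((r + 1) * weakBodyCost Q) := by
  set s := Setup.mk T xs ys (O.rule d T) adv M with hs
  have hbody : ∀ st : (innerTy O.code).Val, st.1 = false → Sim (tick 1 >>= fun _ =>
      (Cmd.ite (.fst x0) (.ret x0) (attemptCmd O.find O.next)).exec T xs adv
          (drawEnv w xs ys st b fs (inputVal xs ys d T K L M)))
      (s.attempt D) (fun st' => thinkerOf O.next st'.2.1) (InnerInv O d T M w xs ys)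
      (weakBodyCost Q) := fun st hst => by
    refine Sim.conv (Sim.tick (Sim.cmdIte (C := attemptCost Q) (Ev.fst Ev.x0) (fun h => ?_)
      fun _ => sim_attempt hQ hD hW hx hadv)) rfl (fun _ h => h) (by unfold weakBodyCost; omega)
    rw [hst] at h
    exact absurd h (by simp)
  have hdone : ∀ st : (innerTy O.code).Val, st.1 = true → Sim (tick 1 >>= fun _ =>
      (Cmd.ite (.fst x0) (.ret x0) (attemptCmd O.find O.next)).exec T xs adv
          (drawEnv w xs ys st b fs (inputVal xs ys d T K L M)))
      (pure st) id (fun y => y = st) (weakBodyCost Q) := fun st hst => by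
    refine Sim.conv (Sim.tick (Sim.cmdIte (C := 1) (Ev.fst Ev.x0)
      (fun _ => Sim.ret (v := st) Ev.x0 id) fun h => ?_)) rfl (fun _ h => h)
      (by unfold weakBodyCost; omega)
    rw [hst] at h
    exact absurd h (by simp)
  intro r
  induction r with
  | zero =>
    intro st hst
    refine Sim.conv (Sim.bind (hbody st hst) (A' := fun f => pure f)
      (Inv' := fun st' => InnerInv O d T M w xs ys st') (C := 0)
      fun st' h => Sim.conv (Sim.pure st' _) rfl ?_ le_rfl) ?_ (fun _ h => h) (by omega)
    · rintro _ rfl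
      exact h
    · rw [bind_pure]
      rfl
  | succ r ih =>
    intro st hst
    refine Sim.conv (Sim.bind (hbody st hst)
      (A' := fun f => if s.error D f ≤ 1 / 4 then pure f else s.weakLearn D r)
      (Inv' := fun st' => InnerInv O d T M w xs ys st') (C := (r + 1) * weakBodyCost Q)
      fun st' h => ?_) ?_ (fun _ h => h) (by rw [add_mul (r + 1)]; omega)
    · have herr := error_le_quarter_iff s hD (thinkerOf O.next st'.2.1)
      simp only [hs] at herr ⊢
      obtain ⟨h1, h2, h3⟩ := h
      by_cases hc : 4 * errSum (thinkerOf O.next st'.2.1) T (encEx w xs ys) ≤ ∑ i, w i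
      · rw [if_pos (herr.2 hc)]
        refine Sim.conv (sim_repeatM_done (hdone st' (by rw [h3]; simpa using hc)) (r + 1)) rfl ?_ le_rfl
        rintro _ rfl
        exact ⟨h1, h2, h3⟩
      · rw [if_neg (mt herr.1 hc)]
        exact ih st' (by rw [h3]; simpa using hc)
    · rfl

/-- The cost of the inner loop. -/
def weakCost (O : ConsistencyOracle F) (Q : ℕ) : ℕ :=
  20 + defaultCost O.code + Q * weakBodyCost Q

theorem sim_weak (hQ : RunBounds O d T m K L M Q) (hD : HasWeights D w)
    (hW : ∑ i, w i < 2 ^ Q) (hx : ∀ i, (xs i).length ≤ d) (hadv : ∀ H S, adv xs H S ∈ F d)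
    {b : Bool} {fs : List (voterTy O.code).Val} :
    Sim ((weakCmd O.find O.next).exec T xs adv
        (((∑ i, w i : ℕ), (b, encEx w xs ys, fs), inputVal xs ys d T K L M, ()) :
          Env [.nat, outerTy O.code, learnerInput]))
      ((Setup.mk T xs ys (O.rule d T) adv M).weakLearn D (L - 1))
      (fun st' => thinkerOf O.next st'.2.1) (InnerInv O d T M w xs ys) (weakCost O Q) := by
  unfold weakCmd
  refine Sim.conv (Sim.cmdIter (k := L - 1 + 1) (Ev.conv
    (Ev.fst (Ev.snd (Ev.snd (Ev.snd (Ev.snd Ev.x2))))) (Nat.sub_add_cancel hQ.one_le_L).symm le_rfl)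
    (Ev.pair (Ev.bit _) (Ev.pair (ev_defaultIn _ _) (Ev.num 0)))
    (sim_weakBody hQ hD hW hx hadv (L - 1) _ rfl)) rfl (fun _ h => h) ?_
  have h1 : (L - 1 + 1) * weakBodyCost Q ≤ Q * weakBodyCost Q :=
    Nat.mul_le_mul_right _ (by have := hQ.L_le; have := hQ.one_le_L; omega)
  have h2 : Nat.size 0 = 0 := Nat.size_zero
  unfold weakCost
  omega

/-! ### Simulation of the outer loop -/

/-- A common factor `c` cancels in the normalization, so integer weights are needed only up to
scaling. -/
theorem hasWeights_reweight (hD : HasWeights D w) {g : Fin m → ℝ} {w' : Fin m → ℕ} {c : ℝ}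
    (hc : 0 < c) (h : ∀ i, (w' i : ℝ) = c * (w i * Real.exp (g i))) : HasWeights (reweight D g) w' := by
  have hW : (0 : ℝ) < (∑ i, w i : ℕ) := by exact_mod_cast hD.1
  have hpos : (0 : ℝ) < ∑ i, (w i : ℝ) * Real.exp (g i) := by
    obtain ⟨i, -, hi⟩ := Finset.exists_ne_zero_of_sum_ne_zero hD.1.ne'
    exact Finset.sum_pos' (fun i _ => by positivity) ⟨i, Finset.mem_univ i, by positivity⟩
  have hsum : ((∑ i, w' i : ℕ) : ℝ) = c * ∑ i, (w i : ℝ) * Real.exp (g i) := by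
    push_cast
    rw [Finset.mul_sum]
    exact Finset.sum_congr rfl fun i _ => h i
  have hW' : (0 : ℝ) < (∑ i, w' i : ℕ) := by rw [hsum]; positivity
  have hW'n : 0 < ∑ i, w' i := by exact_mod_cast hW'
  refine ⟨hW'n, fun i => ?_⟩
  rw [← ENNReal.toReal_eq_toReal_iff' ((reweight D g).apply_ne_top i)
    (ENNReal.mul_ne_top (ENNReal.natCast_ne_top _)
      (ENNReal.inv_ne_top.2 (by exact_mod_cast hW'n.ne'))), toReal_reweight, ENNReal.toReal_mul,
    ENNReal.toReal_inv, ENNReal.toReal_natCast, ENNReal.toReal_natCast, hsum, h i]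
  have hden : ∑ j, (D j).toReal * Real.exp (g j) =
      (∑ j, (w j : ℝ) * Real.exp (g j)) / (∑ i, w i : ℕ) := by
    rw [Finset.sum_div]
    refine Finset.sum_congr rfl fun j _ => ?_
    rw [toReal_of_hasWeights hD]
    ring
  rw [hden, toReal_of_hasWeights hD]
  field_simp

/-- The weights after an iteration. -/
def nextWeights (f : Thinker) (T : ℕ) (w : Fin m → ℕ) (xs : Fin m → Str) (ys : Fin m → Bool)
    (i : Fin m) : ℕ :=
  newWeight f T (∑ i, w i) (errSum f T (encEx w xs ys)) (w i, i.val, xs i, ys i)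

theorem map_newWeight_encEx (f : Thinker) (T : ℕ) :
    ((encEx w xs ys).map fun p => ((newWeight f T (∑ i, w i) (errSum f T (encEx w xs ys)) p, p.2) :
      exTy.Val)) = encEx (nextWeights f T w xs ys) xs ys := by
  simp only [encEx, List.map_ofFn]
  rfl

theorem errSum_encEx_le (f : Thinker) (T : ℕ) : errSum f T (encEx w xs ys) ≤ ∑ i, w i :=
  (errSum_le_wsum f T _).trans (wsum_encEx w xs ys).le

/-- Each weight is multiplied by `W - E` or `E`, both at most the total weight `W`. -/
theorem sum_nextWeights_le (f : Thinker) (T : ℕ) :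
    ∑ i, nextWeights f T w xs ys i ≤ (∑ i, w i) * ∑ i, w i := by
  rw [Finset.sum_mul]
  refine Finset.sum_le_sum fun i _ => ?_
  unfold nextWeights newWeight
  split_ifs
  · exact Nat.mul_le_mul_left _ (Nat.sub_le _ _)
  · exact Nat.mul_le_mul_left _ (errSum_encEx_le f T)

/-- The weight of the voter that a weak learner contributes. -/
def ratioOf (W E : ℕ) : ℕ × ℕ := if W ≤ E then (1, 1) else (W - E, E)

/-- The weights after an iteration, unchanged if everything is misclassified. -/
def stepWeights (f : Thinker) (T : ℕ) (w : Fin m → ℕ) (xs : Fin m → Str) (ys : Fin m → Bool) :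
    Fin m → ℕ :=
  if ∑ i, w i ≤ errSum f T (encEx w xs ys) then w else nextWeights f T w xs ys

/-- The odds of the error are `(W - E) / E`. If everything is misclassified, the ratio 1 : 1 has
logarithm 0, in agreement with the convention for error 1. -/
theorem voteWeight_error (s : Setup m) (hD : HasWeights D w) (f : Thinker)
    (hE : errSum f s.T (encEx w s.xs s.ys) ≠ 0) :
    Setup.voteWeight (s.error D f) =
      1 / 2 * Real.log ((ratioOf (∑ i, w i) (errSum f s.T (encEx w s.xs s.ys))).1 /
        (ratioOf (∑ i, w i) (errSum f s.T (encEx w s.xs s.ys))).2) := by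
  have hle := errSum_encEx_le (w := w) (xs := s.xs) (ys := s.ys) f s.T
  have hW : (0 : ℝ) < (∑ i, w i : ℕ) := by exact_mod_cast hD.1
  rw [Setup.voteWeight, error_eq_div s hD, ratioOf]
  generalize errSum f s.T (encEx w s.xs s.ys) = E at hE hle
  generalize ∑ i, w i = W at hle hW
  have hE' : (E : ℝ) ≠ 0 := by exact_mod_cast hE
  by_cases h : W ≤ E
  · rw [if_pos h]
    have : E = W := le_antisymm hle h
    subst this
    rw [div_self hE', if_pos rfl]
    simp
  · rw [if_neg h, if_neg, Nat.cast_sub hle]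
    · congr 2
      field_simp
    · rw [div_eq_one_iff_eq hW.ne']
      intro h'
      exact h (by exact_mod_cast h'.ge)

/-- The factors `exp (±α)` are `√((W - E) / E)` and its inverse; scaling both by `√(E (W - E))`
gives the naturals `W - E` and `E`. -/
theorem hasWeights_step (s : Setup m) (hD : HasWeights D w) (f : Thinker)
    (hE : errSum f s.T (encEx w s.xs s.ys) ≠ 0) :
    HasWeights (reweight D fun i => if e2e f s.T (s.xs i) ≠ s.ys i
        then Setup.voteWeight (s.error D f) else -Setup.voteWeight (s.error D f))
      (stepWeights f s.T w s.xs s.ys) := by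
  rw [voteWeight_error s hD f hE, stepWeights, ratioOf]
  have hle := errSum_encEx_le (w := w) (xs := s.xs) (ys := s.ys) f s.T
  by_cases h : ∑ i, w i ≤ errSum f s.T (encEx w s.xs s.ys)
  · rw [if_pos h, if_pos h]
    exact hasWeights_reweight hD one_pos fun i => by simp
  · rw [if_neg h, if_neg h]
    unfold nextWeights newWeight
    generalize errSum f s.T (encEx w s.xs s.ys) = E at *
    have hE' : (0 : ℝ) < E := by exact_mod_cast Nat.pos_of_ne_zero hE
    have hWE : (0 : ℝ) < ((∑ i, w i) - E : ℕ) := by exact_mod_cast Nat.sub_pos_of_lt (not_le.1 h)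
    generalize (∑ i, w i) - E = R at *
    have hexp : Real.exp (1 / 2 * Real.log (R / E)) * Real.exp (1 / 2 * Real.log (R / E)) = R / E := by
      rw [← Real.exp_add, ← add_mul, add_halves, one_mul, Real.exp_log (by positivity)]
    -- This constant is `√(E (W - E))`, with `R` standing for `W - E`.
    refine hasWeights_reweight hD (c := E * Real.exp (1 / 2 * Real.log (R / E))) (by positivity)
      fun i => ?_
    dsimp only
    split_ifs
    · have : (E : ℝ) * Real.exp (1 / 2 * Real.log (R / E)) * (w i * Real.exp (1 / 2 * Real.log (R / E))) =
        w i * (E * (Real.exp (1 / 2 * Real.log (R / E)) * Real.exp (1 / 2 * Real.log (R / E)))) := by ring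
      rw [this, hexp, mul_div_cancel₀ _ hE'.ne']
      push_cast
      rfl
    · rw [Real.exp_neg]
      have := (Real.exp_pos (1 / 2 * Real.log (R / E))).ne'
      push_cast
      field_simp

/-- The total weight at most squares. The bit length may double each time, which is affordable over
logarithmically many iterations. -/
theorem stepWeights_le (f : Thinker) {j : ℕ} (hW : ∑ i, w i ≤ m ^ 2 ^ j) :
    ∑ i, stepWeights f T w xs ys i ≤ m ^ 2 ^ (j + 1) := by
  have h2 : m ^ 2 ^ (j + 1) = m ^ 2 ^ j * m ^ 2 ^ j := by rw [pow_succ 2 j, pow_mul, sq]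
  rw [h2, stepWeights]
  split_ifs
  · exact hW.trans (Nat.le_mul_self _)
  · exact (sum_nextWeights_le f T).trans (Nat.mul_le_mul hW hW)

end Loops

section Outer

variable {F : ℕ → Set Thinker} {O : ConsistencyOracle F} {d T m K L M Q : ℕ}
  {w : Fin m → ℕ} {xs : Fin m → Str} {ys : Fin m → Bool} {D : PMF (Fin m)} {adv : Adversary m}

/-- The state of the outer loop after an iteration that found the representation `r`. -/
def outerStep (O : ConsistencyOracle F) (T : ℕ) (w : Fin m → ℕ) (xs : Fin m → Str)
    (ys : Fin m → Bool) (fs : List (voterTy O.code).Val) (r : O.code.Val) : (outerTy O.code).Val :=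
  if errSum (thinkerOf O.next r) T (encEx w xs ys) = 0 then (true, encEx w xs ys, [((2, 1), r)])
  else (false, encEx (stepWeights (thinkerOf O.next r) T w xs ys) xs ys,
    (ratioOf (∑ i, w i) (errSum (thinkerOf O.next r) T (encEx w xs ys)), r) :: fs)

/-- The cost of the update of the outer loop. -/
def updateCost (Q : ℕ) : ℕ :=
  150 + 10 * Q + Q * (e2eCost Q + 80 + 2 * Q + (Q + 1) * (Q + 1))

/-- Formulated for arbitrary `W`, `E` and an arbitrary reweighted list, so that the case distinction
and the cost arithmetic do not involve the concrete sums. -/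
theorem ev_updateTm_aux {code : Ty} {next : Tm [.prod code .str] .bit} {b : Bool} {r : code.Val}
    {W E : ℕ} {l l' : List exTy.Val} {fs : List (voterTy code).Val} {data : List (Str × Bool)}
    (hE : E < 2 ^ Q) (hW : W < 2 ^ Q)
    (hrew : Ev (reweightTm next) (((r, T), l, W, E), ()) l'
      (20 + Q * (e2eCost Q + 80 + 2 * Q + (Q + 1) * (Q + 1)))) :
    Ev (updateTm next) (((b, r, E), W, (false, l, fs), (data, d, T, K, L, M), ()) :
        Env [innerTy code, .nat, outerTy code, learnerInput])
      (if E = 0 then (true, l, [((2, 1), r)])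
        else (false, if W ≤ E then l else l', (ratioOf W E, r) :: fs)) (updateCost Q) := by
  have h1 := size_le_of_lt hE
  have h2 := size_le_of_lt hW
  have h3 : Nat.size 0 ≤ 0 := size_le_of_le le_rfl
  have h4 : Nat.size 1 ≤ 1 := size_le_of_le le_rfl
  have h5 : Nat.size 2 ≤ 2 := size_le_of_le le_rfl
  unfold updateTm
  generalize hc : Q * (e2eCost Q + 80 + 2 * Q + (Q + 1) * (Q + 1)) = c at hrew
  refine Ev.conv (Ev.ite (Ev.le (Ev.snd (Ev.snd Ev.x0)) (Ev.num 0)) (C := 120 + 5 * Q + c)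
    (fun hc => ?_) fun hc => ?_) rfl ?_
  · have hc : E = 0 := Nat.le_zero.1 (of_decide_eq_true hc)
    rw [if_pos hc]
    exact Ev.conv (Ev.pair (Ev.bit _) (Ev.pair (Ev.fst (Ev.snd Ev.x2))
      (Ev.cons (Ev.pair (Ev.pair (Ev.num 2) (Ev.num 1)) (Ev.fst (Ev.snd Ev.x0))) Ev.nil))) rfl
      (by omega)
  · have hc : E ≠ 0 := mt Nat.le_zero.2 (of_decide_eq_false hc)
    rw [if_neg hc]
    refine Ev.conv (Ev.ite (Ev.le Ev.x1 (Ev.snd (Ev.snd Ev.x0))) (C := 80 + 2 * Q + c)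
      (fun hd => ?_) fun hd => ?_) rfl (by simp only; omega)
    · have hd : W ≤ E := of_decide_eq_true hd
      rw [if_pos hd, ratioOf, if_pos hd]
      exact Ev.conv (Ev.pair (Ev.bit _) (Ev.pair (Ev.fst (Ev.snd Ev.x2))
        (Ev.cons (Ev.pair (Ev.pair (Ev.num 1) (Ev.num 1)) (Ev.fst (Ev.snd Ev.x0)))
          (Ev.snd (Ev.snd Ev.x2))))) rfl (by clear * - h4; omega)
    · have hd : ¬ W ≤ E := of_decide_eq_false hd
      rw [if_neg hd, ratioOf, if_neg hd]
      have hcall : Ev (.call (reweightTm next) (.pair (.pair (.fst (.snd x0)) (inpT x3))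
          (.pair (.fst (.snd x2)) (.pair x1 (.snd (.snd x0))))))
          (((b, r, E), W, (false, l, fs), (data, d, T, K, L, M), ()) :
            Env [innerTy code, .nat, outerTy code, learnerInput]) l' (40 + c) := by
        have ha : Ev (.pair (.fst (.snd x0)) (inpT x3))
          (((b, r, E), W, (false, l, fs), (data, d, T, K, L, M), ()) :
            Env [innerTy code, .nat, outerTy code, learnerInput]) (r, T) 8 :=
          Ev.conv (Ev.pair (Ev.fst (Ev.snd Ev.x0)) (Ev.fst (Ev.snd (Ev.snd Ev.x3)))) rfl le_rfl
        have hb : Ev (.pair (.fst (.snd x2)) (.pair x1 (.snd (.snd x0))))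
          (((b, r, E), W, (false, l, fs), (data, d, T, K, L, M), ()) :
            Env [innerTy code, .nat, outerTy code, learnerInput]) (l, W, E) 9 :=
          Ev.conv (Ev.pair (Ev.fst (Ev.snd Ev.x2)) (Ev.pair Ev.x1 (Ev.snd (Ev.snd Ev.x0)))) rfl le_rfl
        exact Ev.conv (Ev.call (Ev.pair ha hb) hrew) rfl (by omega)
      have hd : Ev (.cons (.pair (.pair (.sub x1 (.snd (.snd x0))) (.snd (.snd x0))) (.fst (.snd x0)))
          (.snd (.snd x2)))
          (((b, r, E), W, (false, l, fs), (data, d, T, K, L, M), ()) :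
            Env [innerTy code, .nat, outerTy code, learnerInput])
          (((W - E, E), r) :: fs : List (voterTy code).Val) (20 + 2 * Q) :=
        Ev.conv (Ev.cons (Ev.pair (Ev.pair (Ev.sub Ev.x1 (Ev.snd (Ev.snd Ev.x0))) (Ev.snd (Ev.snd Ev.x0)))
          (Ev.fst (Ev.snd Ev.x0))) (Ev.snd (Ev.snd Ev.x2))) rfl (by simp only; omega)
      exact Ev.conv (Ev.pair (Ev.bit _) (Ev.pair hcall hd)) rfl (by omega)
  · unfold updateCost
    simp only
    omega

theorem ev_updateTm (hQ : RunBounds O d T m K L M Q) (hW : ∑ i, w i < 2 ^ Q)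
    (hx : ∀ i, (xs i).length ≤ d) {fs : List (voterTy O.code).Val} {st : (innerTy O.code).Val}
    (hst : InnerInv O d T M w xs ys st) :
    Ev (updateTm O.next) (drawEnv w xs ys st false fs (inputVal xs ys d T K L M))
      (outerStep O T w xs ys fs st.2.1) (updateCost Q) := by
  obtain ⟨b, r, E⟩ := st
  obtain ⟨hr, hE, -⟩ := hst
  simp only at hr hE
  have hws := wsum_encEx w xs ys
  have hlen : (encEx w xs ys).length ≤ Q := by simpa [encEx] using hQ.m_le
  have hle := errSum_encEx_le (w := w) (xs := xs) (ys := ys) (thinkerOf O.next r) T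
  have hmap := map_newWeight_encEx (w := w) (xs := xs) (ys := ys) (thinkerOf O.next r) T
  rw [← hE] at hle hmap
  refine Ev.conv (ev_updateTm_aux (hle.trans_lt hW) hW (Ev.conv (ev_reweightTm O.next (n := d + T)
    hQ.one_le_T (fun p hp => ?_) hQ.d_add_T (fun v hv => hr.next_time hQ v hv) hlen hws.le hle hW) hmap
    le_rfl)) ?_ le_rfl
  · obtain ⟨i, hi⟩ := mem_encEx hp
    have := hx i
    rw [hi]
    omega
  · rw [outerStep, stepWeights, ← hE]
    split_ifs <;> rfl

/-- The thinker that was found last. -/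
def lastThinker (O : ConsistencyOracle F) (st : (outerTy O.code).Val) : Thinker :=
  (st.2.2.map fun p => thinkerOf O.next p.2).headD fun _ => false

theorem lastThinker_outerStep (fs : List (voterTy O.code).Val) (r : O.code.Val) :
    lastThinker O (outerStep O T w xs ys fs r) = thinkerOf O.next r := by
  unfold lastThinker outerStep
  split_ifs <;> rfl

/-- The cost of an iteration of the outer loop. -/
def boostBodyCost (O : ConsistencyOracle F) (Q : ℕ) : ℕ :=
  20 + Q * (10 + 2 * Q) + weakCost O Q + updateCost Q

theorem sim_boostBody (hQ : RunBounds O d T m K L M Q) (hD : HasWeights D w)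
    (hW : ∑ i, w i < 2 ^ Q) (hx : ∀ i, (xs i).length ≤ d) (hadv : ∀ H S, adv xs H S ∈ F d)
    (fs : List (voterTy O.code).Val) :
    Sim (tick 1 >>= fun _ => (boostCmd O.find O.next).exec T xs adv
        (((false, encEx w xs ys, fs), inputVal xs ys d T K L M, ()) :
          Env [outerTy O.code, learnerInput]))
      ((Setup.mk T xs ys (O.rule d T) adv M).weakLearn D (L - 1)) (lastThinker O)
      (fun st' => ∃ r, GoodCode O d T M r ∧ st' = outerStep O T w xs ys fs r) (boostBodyCost O Q) := by
  have hlen : (encEx w xs ys).length ≤ Q := by simpa [encEx] using hQ.m_le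
  have hws := wsum_encEx w xs ys
  unfold boostCmd
  refine Sim.conv (Sim.tick (Sim.cmdIte (C := 10 + Q * (10 + 2 * Q) + weakCost O Q + updateCost Q)
    (Ev.fst Ev.x0) (fun h => absurd h (by simp)) fun _ =>
    Sim.conv (Sim.cmdLet (Ev.conv (Ev.call (Ev.fst (Ev.snd Ev.x0)) (ev_totalTm (Q := Q) hlen
        (by rw [hws]; exact hW))) hws le_rfl)
      (Sim.cmdBind (sim_weak hQ hD hW hx hadv) (A' := fun f => pure f) (ψ := lastThinker O)
        (Inv' := fun st' => ∃ r, GoodCode O d T M r ∧ st' = outerStep O T w xs ys fs r)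
        fun st hst => Sim.conv (Sim.ret (ev_updateTm hQ hW hx hst) (lastThinker O))
          (by rw [lastThinker_outerStep]) ?_ le_rfl)) (bind_pure _) (fun _ h => h) (by omega)))
    rfl (fun _ h => h) (by unfold boostBodyCost; omega)
  rintro _ rfl
  exact ⟨_, hst.1, rfl⟩

theorem ratioOf_bounds {W E : ℕ} (hW : W < 2 ^ Q) (hE : E ≠ 0) (hle : E ≤ W) :
    (0 < (ratioOf W E).1 ∧ 0 < (ratioOf W E).2) ∧
      ((ratioOf W E).1 < 2 ^ Q ∧ (ratioOf W E).2 < 2 ^ Q) := by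
  unfold ratioOf
  split_ifs
  · exact ⟨⟨one_pos, one_pos⟩, by constructor <;> (simp only; omega)⟩
  · exact ⟨by constructor <;> (simp only; omega), by constructor <;> (simp only; omega)⟩

/-- The voters of a run. -/
def VotersInv (O : ConsistencyOracle F) (d T M Q : ℕ) (fs : List (voterTy O.code).Val) : Prop :=
  ∀ p ∈ fs, (0 < p.1.1 ∧ 0 < p.1.2) ∧ (p.1.1 < 2 ^ Q ∧ p.1.2 < 2 ^ Q) ∧ GoodCode O d T M p.2

theorem vote_reverse (T : ℕ) (fs : List (ℝ × Thinker)) : vote T fs.reverse = vote T fs := by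
  funext x
  simp only [vote, List.map_reverse, List.sum_reverse]

/-- After `j` iterations the natural weights represent the current distribution exactly, with total
at most `m ^ 2 ^ j`, and the voters carry exact ratios. They are stored most recent first, hence the
reversal. An iteration that follows an errorless predictor is idle. -/
theorem sim_boost (hQ : RunBounds O d T m K L M Q) (hx : ∀ i, (xs i).length ≤ d)
    (hadv : ∀ H S, adv xs H S ∈ F d) :
    ∀ (k j : ℕ) (w : Fin m → ℕ) (D : PMF (Fin m)) (fs : List (voterTy O.code).Val), j + k = K →
    HasWeights D w → ∑ i, w i ≤ m ^ 2 ^ j → VotersInv O d T M Q fs → fs.length ≤ j →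
    Sim (repeatM (fun y : (outerTy O.code).Val => tick 1 >>= fun _ =>
        (boostCmd O.find O.next).exec T xs adv ((y, inputVal xs ys d T K L M, ()) :
          Env [outerTy O.code, learnerInput])) k (false, encEx w xs ys, fs))
      ((Setup.mk T xs ys (O.rule d T) adv M).boost L k D (fs.map (voterOf O.next)).reverse)
      (fun st => vote T (st.2.2.map (voterOf O.next)))
      (fun st => VotersInv O d T M Q st.2.2 ∧ st.2.2.length ≤ K) (k * boostBodyCost O Q) := by
  set s := Setup.mk T xs ys (O.rule d T) adv M with hs
  intro k
  induction k with
  | zero =>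
    intro j w D fs hjk hD hW hfs hlen
    refine Sim.conv (Sim.pure _ _) ?_ ?_ (by omega)
    · funext H
      rw [Setup.boost_zero, vote_reverse]
      rfl
    · rintro _ rfl
      exact ⟨hfs, by simp only; omega⟩
  | succ k ih =>
    intro j w D fs hjk hD hW hfs hlen
    have hmpos : 1 ≤ m := by
      rcases Nat.eq_zero_or_pos m with rfl | h
      · exact absurd hD.1 (by simp)
      · exact h
    have hWQ : ∑ i, w i < 2 ^ Q := (hW.trans (Nat.pow_le_pow_right hmpos
      (Nat.pow_le_pow_right (by norm_num) (by omega)))).trans_lt hQ.weight_lt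
    refine Sim.conv (Sim.bind (sim_boostBody hQ hD hWQ hx hadv fs)
      (A' := fun f => if s.error D f = 0 then pure (e2e f s.T)
        else s.boost L k (reweight D fun i => if e2e f s.T (s.xs i) ≠ s.ys i
          then Setup.voteWeight (s.error D f) else -Setup.voteWeight (s.error D f))
          ((fs.map (voterOf O.next)).reverse ++ [(Setup.voteWeight (s.error D f), f)]))
      (ψ := fun st : (outerTy O.code).Val => vote T (st.2.2.map (voterOf O.next)))
      (Inv' := fun st : (outerTy O.code).Val => VotersInv O d T M Q st.2.2 ∧ st.2.2.length ≤ K)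
      (C := k * boostBodyCost O Q)
      fun st h => ?_) ?_ (fun _ h => h) (by rw [add_mul]; omega)
    · obtain ⟨r, hr, rfl⟩ := h
      rw [lastThinker_outerStep]
      have hle := errSum_encEx_le (w := w) (xs := xs) (ys := ys) (thinkerOf O.next r) T
      have herr : s.error D (thinkerOf O.next r) = 0 ↔
          errSum (thinkerOf O.next r) T (encEx w xs ys) = 0 := by
        have hW0 : ((∑ i, w i : ℕ) : ℝ) ≠ 0 := by exact_mod_cast hD.1.ne'
        rw [error_eq_div s hD, div_eq_zero_iff, or_iff_left hW0, Nat.cast_eq_zero]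
      by_cases hE : errSum (thinkerOf O.next r) T (encEx w xs ys) = 0
      · rw [if_pos (herr.2 hE), outerStep, if_pos hE]
        refine Sim.conv (sim_repeatM_done (B := boostBodyCost O Q) ?_ k) ?_ ?_ le_rfl
        · unfold boostCmd
          refine Sim.conv (Sim.tick (Sim.cmdIte (C := 1) (Ev.fst Ev.x0)
            (fun _ => Sim.ret (Ev.x0) id) fun h => absurd h (by simp))) rfl (fun _ h => h)
            (by unfold boostBodyCost; omega)
        -- A lone voter with ratio 2 : 1 has positive weight, so its vote is its own end-to-end map,
        -- as the early return requires.
        · have hlog : 0 < 1 / 2 * Real.log ((2 : ℕ) / (1 : ℕ)) := by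
            have := Real.log_pos (show (1 : ℝ) < 2 by norm_num)
            norm_num
            exact this
          simp only [List.map_singleton, voterOf]
          rw [vote_singleton hlog]
        · rintro _ rfl
          have h2Q : 2 < 2 ^ Q := by
            calc 2 < 2 ^ 2 := by norm_num
              _ ≤ 2 ^ Q := Nat.pow_le_pow_right (by norm_num) hQ.two_le
          refine ⟨fun p hp => ?_, by simp only [List.length_singleton]; omega⟩
          obtain rfl := List.mem_singleton.1 hp
          exact ⟨by norm_num, ⟨h2Q, (show 1 < 2 by norm_num).trans h2Q⟩, hr⟩
      · rw [if_neg (mt herr.1 hE), outerStep, if_neg hE]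
        have hstep := ih (j + 1) (stepWeights (thinkerOf O.next r) T w xs ys) _
          ((ratioOf (∑ i, w i) (errSum (thinkerOf O.next r) T (encEx w xs ys)), r) :: fs) (by omega)
          (hasWeights_step s hD (thinkerOf O.next r) hE) (stepWeights_le _ hW) ?_
          (by simp only [List.length_cons]; omega)
        · refine Sim.conv hstep ?_ (fun _ h => h) le_rfl
          rw [List.map_cons, List.reverse_cons, voterOf, voteWeight_error s hD _ hE]
        · intro p hp
          rcases List.mem_cons.1 hp with rfl | hp
          · have h := ratioOf_bounds hWQ hE hle
            exact ⟨h.1, h.2, hr⟩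
          · exact hfs p hp
    · funext H
      rw [Setup.boost_succ, stateT_bind_apply]
      refine congrArg _ (funext fun o => ?_)
      split_ifs <;> rfl

/-- The cost of the learner. -/
def learnCost (O : ConsistencyOracle F) (Q : ℕ) : ℕ :=
  60 + Q * (40 + 2 * Q) + Q * boostBodyCost O Q

/-- The uniform distribution is encoded by unit weights, with total `m = m ^ 2 ^ 0`. -/
theorem sim_learn [NeZero m] (hQ : RunBounds O d T m K L M Q) (hx : ∀ i, (xs i).length ≤ d)
    (hadv : ∀ H S, adv xs H S ∈ F d) :
    Sim ((learnCmd O.find O.next).exec T xs adv ((inputVal xs ys d T K L M, ()) : Env [learnerInput]))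
      ((Setup.mk T xs ys (O.rule d T) adv M).boost L K (PMF.uniformOfFintype (Fin m)) [])
      (fun rep : (repTy O.code).Val => vote T (rep.2.map (voterOf O.next)))
      (fun rep : (repTy O.code).Val => rep.1 = T ∧ VotersInv O d T M Q rep.2 ∧ rep.2.length ≤ K) (learnCost O Q) := by
  have hD : HasWeights (PMF.uniformOfFintype (Fin m)) fun _ => 1 := by
    have hm : m ≠ 0 := NeZero.ne m
    refine ⟨by simpa using Nat.pos_of_ne_zero hm, fun i => ?_⟩
    simp [PMF.uniformOfFintype_apply]
  have hinit : ((List.ofFn fun i => (xs i, ys i)).mapIdx fun i p => ((1, i, p) : exTy.Val)) =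
      encEx (fun _ => 1) xs ys := by
    refine List.ext_getElem (by simp [encEx]) fun i h1 h2 => ?_
    simp [encEx]
  unfold learnCmd
  refine Sim.conv (Sim.cmdBind (Sim.cmdIter (k := K) (Ev.fst (Ev.snd (Ev.snd (Ev.snd Ev.x0))))
    (Ev.pair (Ev.bit _) (Ev.pair (Ev.conv (Ev.call (Ev.fst Ev.x0)
      (ev_initTm (Q := Q) (by simpa [inputVal] using hQ.m_le))) hinit le_rfl) Ev.nil))
    (sim_boost hQ hx hadv K 0 (fun _ => 1) _ [] (by omega) hD (by simp) (fun p hp => by simp at hp)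
      (by simp))) (A' := fun f => pure f)
    (ψ := fun rep : (repTy O.code).Val => vote T (rep.2.map (voterOf O.next)))
    (Inv' := fun rep : (repTy O.code).Val => rep.1 = T ∧ VotersInv O d T M Q rep.2 ∧ rep.2.length ≤ K)
    fun st hst => Sim.conv (Sim.ret (Ev.pair (Ev.fst (Ev.snd (Ev.snd Ev.x1))) (Ev.snd (Ev.snd Ev.x0)))
      (fun rep : (repTy O.code).Val => vote T (rep.2.map (voterOf O.next)))) rfl ?_ le_rfl) (bind_pure _) (fun _ h => h) ?_
  · rintro _ rfl
    exact ⟨rfl, hst⟩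
  · have := Nat.mul_le_mul_right (boostBodyCost O Q) hQ.K_le
    unfold learnCost
    omega

/-- The cost of evaluating the predictor. -/
def predictCost (Q : ℕ) : ℕ :=
  30 + 2 * (Q * Q) + Q * (e2eCost Q + 50 + 2 * ((Q * Q + 2) * (Q + 1)))

/-- The learner has the joint law of the algorithm, and its cost and the cost of evaluating the
predictor are bounded. -/
theorem learnCmd_spec [NeZero m] (hQ : RunBounds O d T m K L M Q) (hx : ∀ i, (xs i).length ≤ d)
    (hadv : ∀ H S, adv xs H S ∈ F d) {run : PMF ((repTy O.code).Val × Trace m)}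
    (hrun : run = ((learnCmd O.find O.next).exec T xs adv
      ((inputVal xs ys d T K L M, ()) : Env [learnerInput])).run ⟨0, []⟩) :
    run.map (fun o => ((fun x => (predictTm O.next).out (o.1, x) : Thinker), o.2.rounds)) =
        (Setup.mk T xs ys (O.rule d T) adv M).adaBoost K L ∧
      ∀ o ∈ run.support, o.2.steps ≤ learnCost O Q ∧
        ∀ x ∈ inputsUpTo d, (predictTm O.next).time (o.1, x) ≤ predictCost Q := by
  have h := sim_learn (ys := ys) hQ hx hadv
  have hlaw := h.law ⟨0, []⟩
  have hsupp := h.supp ⟨0, []⟩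
  subst hrun
  refine ⟨?_, fun o ho => ?_⟩
  · refine Eq.trans ?_ hlaw
    rw [← PMF.bind_pure_comp, ← PMF.bind_pure_comp]
    -- The program for the predictor is known to compute the vote only for positive ratios, which
    -- the invariant guarantees on the support.
    refine PMF_bind_congr fun o ho => ?_
    obtain ⟨⟨h1, h2, -⟩, -⟩ := hsupp o ho
    obtain ⟨⟨T', l⟩, tr⟩ := o
    simp only at h1 h2
    subst h1
    simp only [Function.comp_apply]
    rw [out_predictTm O.next hQ.one_le_T fun p hp => (h2 p hp).1]
  · obtain ⟨⟨h1, h2, h3⟩, h4⟩ := hsupp o ho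
    refine ⟨by simpa using h4, fun x hx => ?_⟩
    obtain ⟨⟨T', l⟩, tr⟩ := o
    simp only at h1 h2 h3
    subst h1
    have hx : x.length ≤ d := hx
    exact (ev_predictTm O.next (Q := Q) (n := d + T') hQ.one_le_T (h3.trans hQ.K_le) (by omega)
      hQ.d_add_T fun p hp => ⟨(h2 p hp).2.1.1, (h2 p hp).2.1.2,
        fun v hv => (h2 p hp).2.2.next_time hQ v hv⟩).time_le

end Outer

/-! ### Polynomial bounds -/

/-- `g` is bounded by a polynomial in `R`. -/
def PolyIn {ι : Type} (R g : ι → ℝ) : Prop := ∃ C : ℕ, ∀ i, g i ≤ C * R i ^ C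

namespace PolyIn

variable {ι κ : Type} {R g h : ι → ℝ}

theorem mono (hg : PolyIn R g) (hh : ∀ i, h i ≤ g i) : PolyIn R h := by
  obtain ⟨C, hC⟩ := hg
  exact ⟨C, fun i => (hh i).trans (hC i)⟩

theorem comp (hg : PolyIn R g) (φ : κ → ι) : PolyIn (fun k => R (φ k)) fun k => g (φ k) := by
  obtain ⟨C, hC⟩ := hg
  exact ⟨C, fun k => hC (φ k)⟩

theorem self (R : ι → ℝ) : PolyIn R R := ⟨1, fun i => by simp⟩

theorem const (hR : ∀ i, 1 ≤ R i) (c : ℝ) : PolyIn R fun _ => c :=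
  ⟨⌈c⌉₊, fun i => (Nat.le_ceil c).trans
    (le_mul_of_one_le_right (Nat.cast_nonneg _) (one_le_pow₀ (hR i)))⟩

theorem add (hR : ∀ i, 1 ≤ R i) (hg : PolyIn R g) (hh : PolyIn R h) :
    PolyIn R fun i => g i + h i := by
  obtain ⟨C, hC⟩ := hg
  obtain ⟨C', hC'⟩ := hh
  refine ⟨C + C', fun i => (add_le_add (hC i) (hC' i)).trans ?_⟩
  push_cast
  rw [add_mul]
  have h1 := pow_le_pow_right₀ (hR i) (Nat.le_add_right C C')
  have h2 := pow_le_pow_right₀ (hR i) (Nat.le_add_left C' C)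
  gcongr

theorem mul (hR : ∀ i, 1 ≤ R i) (h0 : ∀ i, 0 ≤ g i) (hg : PolyIn R g) (hh : PolyIn R h) :
    PolyIn R fun i => g i * h i := by
  obtain ⟨C, hC⟩ := hg
  obtain ⟨C', hC'⟩ := hh
  refine ⟨C * C' + (C + C'), fun i => ?_⟩
  have hR0 : 0 ≤ R i := zero_le_one.trans (hR i)
  have h1 := pow_le_pow_right₀ (hR i) (Nat.le_add_left (C + C') (C * C'))
  calc g i * h i ≤ g i * (C' * R i ^ C') := mul_le_mul_of_nonneg_left (hC' i) (h0 i)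
    _ ≤ C * R i ^ C * (C' * R i ^ C') := mul_le_mul_of_nonneg_right (hC i) (by positivity)
    _ = (C * C' : ℕ) * R i ^ (C + C') := by push_cast; ring
    _ ≤ (C * C' + (C + C') : ℕ) * R i ^ (C * C' + (C + C')) := by
      gcongr
      exact Nat.le_add_right _ _

theorem pow (hR : ∀ i, 1 ≤ R i) (h0 : ∀ i, 0 ≤ g i) (hg : PolyIn R g) (n : ℕ) :
    PolyIn R fun i => g i ^ n := by
  induction n with
  | zero => simpa using const hR 1
  | succ n ih => simpa only [pow_succ] using mul hR (fun i => pow_nonneg (h0 i) n) ih hg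

theorem trans {S : ι → ℝ} (hR : ∀ i, 1 ≤ R i) (hS : ∀ i, 0 ≤ S i) (hRS : PolyIn R S)
    (hg : PolyIn S g) : PolyIn R g := by
  obtain ⟨C, hC⟩ := hg
  exact mono (mul hR (fun _ => Nat.cast_nonneg C) (const hR C) (pow hR hS hRS C)) hC

end PolyIn

/-- `f` is bounded by a polynomial. -/
def PolyNat (f : ℕ → ℕ) : Prop := PolyIn (fun Q : ℕ => 1 + (Q : ℝ)) fun Q => (f Q : ℝ)

namespace PolyNat

variable {f g : ℕ → ℕ}

theorem one_le (Q : ℕ) : (1 : ℝ) ≤ 1 + (Q : ℝ) := le_add_of_nonneg_right (Nat.cast_nonneg Q)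

theorem const (c : ℕ) : PolyNat fun _ => c := PolyIn.const one_le c

theorem self : PolyNat fun Q => Q := (PolyIn.self _).mono fun Q => by simp

theorem add (hf : PolyNat f) (hg : PolyNat g) : PolyNat fun Q => f Q + g Q := by
  unfold PolyNat
  push_cast
  exact PolyIn.add one_le hf hg

theorem mul (hf : PolyNat f) (hg : PolyNat g) : PolyNat fun Q => f Q * g Q := by
  unfold PolyNat
  push_cast
  exact PolyIn.mul one_le (fun _ => Nat.cast_nonneg _) hf hg

end PolyNat

theorem polyNat_e2eCost : PolyNat e2eCost :=
  .add (.const 10) (.mul .self (.add (.const 50) (.mul (.const 9) .self)))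

theorem polyNat_drawCost : PolyNat drawCost :=
  .add (.add (.const 60) (.mul .self (.add (.const 50) (.mul (.const 6) .self)))) .self

theorem polyNat_scoreCost : PolyNat scoreCost :=
  .add (.add (.const 60) (.mul (.const 10) .self))
    (.mul .self (.add (.add polyNat_e2eCost (.const 50)) (.mul (.const 2) .self)))

theorem polyNat_attemptCost : PolyNat attemptCost :=
  .add (.add (.add (.add (.const 120) (.mul (.const 40) .self)) (.mul .self polyNat_drawCost))
    (.mul .self (.add (.const 50) (.mul .self (.add (.const 40) (.mul (.const 8) .self))))))
    polyNat_scoreCost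

theorem polyNat_updateCost : PolyNat updateCost :=
  .add (.add (.const 150) (.mul (.const 10) .self)) (.mul .self (.add (.add (.add polyNat_e2eCost
    (.const 80)) (.mul (.const 2) .self)) (.mul (.add .self (.const 1)) (.add .self (.const 1)))))

theorem polyNat_learnCost {F : ℕ → Set Thinker} (O : ConsistencyOracle F) : PolyNat (learnCost O) :=
  .add (.add (.const 60) (.mul .self (.add (.const 40) (.mul (.const 2) .self))))
    (.mul .self (.add (.add (.add (.const 20) (.mul .self (.add (.const 10) (.mul (.const 2) .self))))
      (.add (.const (20 + defaultCost O.code)) (.mul .self (.add (.const 5) polyNat_attemptCost))))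
      polyNat_updateCost))

theorem polyNat_predictCost : PolyNat predictCost :=
  .add (.add (.const 30) (.mul (.const 2) (.mul .self .self))) (.mul .self (.add (.add polyNat_e2eCost
    (.const 50)) (.mul (.const 2) (.mul (.add (.mul .self .self) (.const 2)) (.add .self (.const 1))))))

/-! ### Polynomial bounds on the parameters -/

/-- The parameters `d`, `T`, `ε`, `δ` of a run. -/
structure Params where
  d : ℕ
  T : ℕ
  ε : ℝ
  δ : ℝ
  one_le_T : 1 ≤ T
  ε_pos : 0 < ε
  ε_lt : ε < 1
  δ_pos : 0 < δ
  δ_lt : δ < 1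

namespace Params

/-- The quantity in which the running time is polynomial. -/
def size (p : Params) : ℝ := 1 + p.d + p.T + 1 / p.ε + Real.log (1 / p.δ)

variable (p : Params)

theorem inv_ε_nonneg : 0 ≤ 1 / p.ε := one_div_nonneg.2 p.ε_pos.le

theorem log_δ_nonneg : 0 ≤ Real.log (1 / p.δ) :=
  Real.log_nonneg (by rw [le_div_iff₀ p.δ_pos]; linarith [p.δ_lt])

theorem one_le_size : 1 ≤ p.size := by
  have := p.inv_ε_nonneg
  have := p.log_δ_nonneg
  have := (Nat.cast_nonneg p.d : (0 : ℝ) ≤ p.d)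
  have := (Nat.cast_nonneg p.T : (0 : ℝ) ≤ p.T)
  unfold size
  linarith

theorem le_size : (p.d : ℝ) ≤ p.size ∧ (p.T : ℝ) ≤ p.size ∧ 1 / p.ε ≤ p.size ∧
    Real.log (1 / p.δ) ≤ p.size ∧ 1 + (p.d : ℝ) + p.T ≤ p.size := by
  have := p.inv_ε_nonneg
  have := p.log_δ_nonneg
  have := (Nat.cast_nonneg p.d : (0 : ℝ) ≤ p.d)
  have := (Nat.cast_nonneg p.T : (0 : ℝ) ≤ p.T)
  unfold size
  refine ⟨?_, ?_, ?_, ?_, ?_⟩ <;> linarith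

end Params

open Params

theorem PolyBounded.polyIn {g : ℕ → ℕ → ℕ} (hg : PolyBounded g) :
    PolyIn size fun p => (g p.d p.T : ℝ) := by
  obtain ⟨C, hC⟩ := hg
  refine ⟨C, fun p => ?_⟩
  have h1 : (g p.d p.T : ℝ) ≤ C * (1 + p.d + p.T) ^ C := by exact_mod_cast hC p.d p.T p.one_le_T
  refine h1.trans ?_
  have := p.le_size.2.2.2.2
  gcongr

/-- For `v = 0` both sides vanish because `log 0 = 0`; otherwise the logarithm is nonnegative and
squaring is monotone. -/
theorem sq_log_le_sq {v : ℕ} {ε : ℝ} (hε : 0 < ε) (hε1 : ε < 1) :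
    Real.log (2 * v / ε) ^ 2 ≤ (2 * v * (1 / ε)) ^ 2 := by
  rw [mul_one_div]
  rcases Nat.eq_zero_or_pos v with rfl | hv
  · simp
  · have hv1 : (1 : ℝ) ≤ v := by exact_mod_cast hv
    have hpos : 0 ≤ 2 * v / ε := by positivity
    exact pow_le_pow_left₀ (Real.log_nonneg (by rw [le_div_iff₀ hε]; linarith))
      (Real.log_le_self hpos) 2

theorem sampleSize_nonneg (c v : ℕ) (p : Params) : 0 ≤ sampleSize c v p.ε p.δ := by
  have h1 := p.ε_pos
  have h2 : 0 ≤ Real.log (2 / p.ε) :=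
    Real.log_nonneg (by rw [le_div_iff₀ h1]; linarith [p.ε_lt])
  have h3 : 0 ≤ Real.log (2 / p.δ) :=
    Real.log_nonneg (by rw [le_div_iff₀ p.δ_pos]; linarith [p.δ_lt])
  unfold sampleSize
  positivity

/-- The number of training examples. -/
def numExamples (c : ℕ) (vc : ℕ → ℕ → ℕ) (p : Params) : ℕ := ⌈sampleSize c (vc p.d p.T) p.ε p.δ⌉₊

theorem polyIn_numExamples (c : ℕ) {vc : ℕ → ℕ → ℕ} (hvc : PolyBounded vc) :
    PolyIn size fun p => (numExamples c vc p : ℝ) := by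
  have hR := one_le_size
  have hv := hvc.polyIn
  have hε : PolyIn size fun p => 1 / p.ε := (PolyIn.self size).mono fun p => p.le_size.2.2.1
  have hδ : PolyIn size fun p => Real.log (1 / p.δ) :=
    (PolyIn.self size).mono fun p => p.le_size.2.2.2.1
  have hv0 : ∀ p : Params, (0 : ℝ) ≤ vc p.d p.T := fun _ => Nat.cast_nonneg _
  have hε0 := inv_ε_nonneg
  have h2 : PolyIn size fun p => 2 * (vc p.d p.T : ℝ) * (1 / p.ε) :=
    .mul hR (fun p => mul_nonneg zero_le_two (hv0 p)) (.mul hR (fun _ => zero_le_two)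
      (.const hR 2) hv) hε
  have h3 : PolyIn size fun p => (c : ℝ) * (((vc p.d p.T * (2 * (1 / p.ε)) *
      (2 * (vc p.d p.T : ℝ) * (1 / p.ε)) ^ 2) + (1 + Real.log (1 / p.δ))) * (1 / p.ε)) + 1 := by
    refine .add hR (.mul hR (fun _ => Nat.cast_nonneg _) (.const hR c) (.mul hR (fun p => ?_)
      (.add hR (.mul hR (fun p => ?_) (.mul hR hv0 hv (.mul hR (fun _ => zero_le_two) (.const hR 2) hε))
        (.pow hR (fun p => ?_) h2 2)) (.add hR (.const hR 1) hδ)) hε)) (.const hR 1)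
    · have := hv0 p
      have := hε0 p
      have := p.log_δ_nonneg
      positivity
    · have := hv0 p
      have := hε0 p
      positivity
    · have := hv0 p
      have := hε0 p
      positivity
  refine h3.mono fun p => (Nat.ceil_lt_add_one (sampleSize_nonneg c _ p)).le.trans ?_
  have e1 : Real.log (2 / p.ε) ≤ 2 * (1 / p.ε) := by
    rw [mul_one_div]
    exact Real.log_le_self (by have := p.ε_pos; positivity)
  have e2 := sq_log_le_sq (v := vc p.d p.T) p.ε_pos p.ε_lt
  have e3 : Real.log (2 / p.δ) ≤ 1 + Real.log (1 / p.δ) := by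
    have : (2 : ℝ) / p.δ = 2 * (1 / p.δ) := by ring
    rw [this, Real.log_mul two_ne_zero (one_div_pos.2 p.δ_pos).ne']
    linarith [Real.log_two_lt_d9]
  have e4 := hv0 p
  have e5 := hε0 p
  have e6 : 0 ≤ Real.log (2 / p.ε) :=
    Real.log_nonneg (by rw [le_div_iff₀ p.ε_pos]; linarith [p.ε_lt])
  unfold sampleSize
  rw [div_eq_mul_one_div _ p.ε]
  gcongr

theorem outerIters_le (m : ℕ) : (outerIters m : ℝ) ≤ 8 * Real.log m + 1 :=
  (Nat.ceil_lt_add_one (mul_nonneg (by norm_num) (Real.log_natCast_nonneg m))).le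

/-- From `2 ≤ e` and `K ≤ 8 log m + 1`. This is what keeps the bit length of weights as large as `m
^ 2 ^ K` polynomial. -/
theorem two_pow_outerIters_le {m : ℕ} (hm : 1 ≤ m) : (2 : ℝ) ^ outerIters m ≤ 3 * (m : ℝ) ^ 8 := by
  have hm0 : (0 : ℝ) < m := by exact_mod_cast hm
  calc (2 : ℝ) ^ outerIters m ≤ Real.exp 1 ^ outerIters m := by
        gcongr
        linarith [Real.exp_one_gt_d9]
    _ = Real.exp (outerIters m) := by rw [← Real.exp_nat_mul, mul_one]
    _ ≤ Real.exp (8 * Real.log m + 1) := Real.exp_le_exp.2 (outerIters_le m)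
    _ = Real.exp 1 * (m : ℝ) ^ 8 := by
        rw [Real.exp_add, mul_comm]
        congr 1
        have := Real.exp_nat_mul (Real.log m) 8
        rw [Real.exp_log hm0] at this
        exact_mod_cast this
    _ ≤ 3 * (m : ℝ) ^ 8 := by
        gcongr
        linarith [Real.exp_one_lt_d9]

theorem innerIters_le {m : ℕ} (hm : 2 ≤ m) (p : Params) :
    (innerIters m p.δ : ℝ) ≤ 2 * outerIters m + Real.log (1 / p.δ) + 1 := by
  have hK : (1 : ℝ) ≤ outerIters m := by exact_mod_cast outerIters_pos hm
  have h1 : Real.log (2 * outerIters m / p.δ) = Real.log (2 * outerIters m) + Real.log (1 / p.δ) := by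
    rw [← Real.log_mul (by positivity) (one_div_pos.2 p.δ_pos).ne', mul_one_div]
  have h2 : 0 ≤ Real.log (2 * outerIters m) := Real.log_nonneg (by linarith)
  have h3 := p.log_δ_nonneg
  have h4 := Real.log_le_self (show (0 : ℝ) ≤ 2 * outerIters m by positivity)
  have h5 := (Nat.ceil_lt_add_one (show 0 ≤ Real.log (2 * outerIters m / p.δ) by
    rw [h1]; positivity)).le
  unfold innerIters
  linarith

/-- The bound on all quantities of a run. -/
def runBound (D d T m K L M : ℕ) : ℕ :=
  2 + d + T + m + K + L + M + M * T + m * 2 ^ K + D * (1 + d + (d + T) + M * T) ^ D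

/-- The summand `m * 2 ^ K` of the bound accounts for the weights, since `m ^ 2 ^ K ≤ 2 ^ (m * 2 ^
K)`. -/
theorem runBounds {F : ℕ → Set Thinker} (O : ConsistencyOracle F) {d T m K L M : ℕ} (hT : 1 ≤ T)
    (hL : 1 ≤ L) : RunBounds O d T m K L M (runBound O.degree d T m K L M) where
  one_le_T := hT
  one_le_L := hL
  two_le := by unfold runBound; omega
  d_add_T := by unfold runBound; omega
  m_le := by unfold runBound; omega
  K_le := by unfold runBound; omega
  L_le := by unfold runBound; omega
  M_le := by unfold runBound; omega
  MT_le := by unfold runBound; omega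
  oracle_le := by unfold runBound; omega
  weight_lt := by
    calc m ^ 2 ^ K ≤ (2 ^ m) ^ 2 ^ K := Nat.pow_le_pow_left Nat.lt_two_pow_self.le _
      _ = 2 ^ (m * 2 ^ K) := (pow_mul 2 m (2 ^ K)).symm
      _ < 2 ^ runBound O.degree d T m K L M :=
        Nat.pow_lt_pow_right (by norm_num) (by unfold runBound; omega)

theorem two_le_numExamples {c : ℕ} (hc : 2 ≤ c) (vc : ℕ → ℕ → ℕ) (p : Params) :
    2 ≤ numExamples c vc p :=
  two_le_of_sampleSize_le p.ε_pos p.ε_lt p.δ_pos p.δ_lt hc (Nat.le_ceil _)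

theorem polyIn_runBound {c : ℕ} (hc : 2 ≤ c) (D : ℕ) {vc budget : ℕ → ℕ → ℕ} (hvc : PolyBounded vc)
    (hb : PolyBounded budget) :
    PolyIn size fun p => (runBound D p.d p.T (numExamples c vc p) (outerIters (numExamples c vc p))
      (innerIters (numExamples c vc p) p.δ) (budget p.d p.T) : ℝ) := by
  have hR := one_le_size
  have hm := polyIn_numExamples c hvc
  have hM := hb.polyIn
  have hd : PolyIn size fun p => (p.d : ℝ) := (PolyIn.self size).mono fun p => p.le_size.1
  have hT : PolyIn size fun p => (p.T : ℝ) := (PolyIn.self size).mono fun p => p.le_size.2.1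
  have hδ : PolyIn size fun p => Real.log (1 / p.δ) :=
    (PolyIn.self size).mono fun p => p.le_size.2.2.2.1
  have h2K : PolyIn size fun p => (2 : ℝ) ^ outerIters (numExamples c vc p) :=
    (PolyIn.mul hR (fun _ => zero_le_three) (.const hR 3)
      (.pow hR (fun _ => Nat.cast_nonneg _) hm 8)).mono fun p =>
      two_pow_outerIters_le (one_le_two.trans (two_le_numExamples hc vc p))
  -- The crude `K ≤ 2 ^ K` is enough here.
  have hK : PolyIn size fun p => (outerIters (numExamples c vc p) : ℝ) :=
    h2K.mono fun p => by exact_mod_cast (Nat.lt_two_pow_self).le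
  have hL : PolyIn size fun p => (innerIters (numExamples c vc p) p.δ : ℝ) :=
    (PolyIn.add hR (.add hR (.mul hR (fun _ => zero_le_two) (.const hR 2) hK) hδ) (.const hR 1)).mono
      fun p => innerIters_le (two_le_numExamples hc vc p) p
  have hMT : PolyIn size fun p => (budget p.d p.T : ℝ) * p.T :=
    .mul hR (fun _ => Nat.cast_nonneg _) hM hT
  unfold runBound
  push_cast
  exact .add hR (.add hR (.add hR (.add hR (.add hR (.add hR (.add hR (.add hR (.add hR (.const hR 2) hd)
    hT) hm) hK) hL) hM) hMT) (.mul hR (fun _ => Nat.cast_nonneg _) hm h2K))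
    (.mul hR (fun _ => Nat.cast_nonneg _) (.const hR D) (.pow hR (fun p => by positivity)
      (.add hR (.add hR (.add hR (.const hR 1) hd) (.add hR hd hT)) hMT) D))

theorem PolyNat.comp_polyIn {f : ℕ → ℕ} (hf : PolyNat f) {ι : Type} {R : ι → ℝ} (hR : ∀ i, 1 ≤ R i)
    {Q : ι → ℕ} (hQ : PolyIn R fun i => (Q i : ℝ)) : PolyIn R fun i => (f (Q i) : ℝ) :=
  PolyIn.trans hR (fun _ => zero_le_one.trans (PolyNat.one_le _)) (.add hR (.const hR 1) hQ)
    (PolyIn.comp hf Q)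

theorem runsInPolyTime {c : ℕ} (hc : 2 ≤ c) {F : ℕ → Set Thinker} (O : ConsistencyOracle F)
    {vc budget : ℕ → ℕ → ℕ} (hvc : PolyBounded vc) (hb : PolyBounded budget) :
    RunsInPolyTime c O vc budget := by
  have hQ := polyIn_runBound hc O.degree hvc hb
  -- Bounding the sum of both costs yields one constant for the learner and the predictor.
  obtain ⟨C, hC⟩ := PolyIn.add one_le_size ((polyNat_learnCost O).comp_polyIn one_le_size hQ)
    (polyNat_predictCost.comp_polyIn one_le_size hQ)
  refine ⟨repTy O.code, learnCmd O.find O.next, predictTm O.next, C, ?_⟩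
  intro d T hT ε δ hε hε1 hδ hδ1 m _ hm hstar _ xs hxs adv hadv run hrun
  have hbound := hC ⟨d, T, ε, δ, hT, hε, hε1, hδ, hδ1⟩
  have hm2 := two_le_numExamples hc vc ⟨d, T, ε, δ, hT, hε, hε1, hδ, hδ1⟩
  simp only [numExamples, size, ← hm] at hbound hm2
  obtain ⟨h1, h2⟩ := learnCmd_spec (runBounds O hT (innerIters_pos hm2 hδ hδ1)) hxs
    (fun H S => (hadv xs H S).1) hrun
  refine ⟨h1, fun o ho => ?_⟩
  obtain ⟨h3, h4⟩ := h2 o ho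
  refine ⟨le_trans (le_trans (Nat.cast_le.2 h3) (le_add_of_nonneg_right (Nat.cast_nonneg _))) hbound,
    fun x hx => le_trans (le_trans (Nat.cast_le.2 (h4 x hx))
      (le_add_of_nonneg_left (Nat.cast_nonneg _))) hbound⟩

theorem PolyBounded.const_mul {g : ℕ → ℕ → ℕ} (hg : PolyBounded g) (c : ℕ) :
    PolyBounded fun d T => c * g d T := by
  obtain ⟨C, hC⟩ := hg
  refine ⟨c * C + C, fun d T hT => ?_⟩
  calc c * g d T ≤ c * (C * (1 + d + T) ^ C) := Nat.mul_le_mul_left _ (hC d T hT)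
    _ = c * C * (1 + d + T) ^ C := (mul_assoc _ _ _).symm
    _ ≤ (c * C + C) * (1 + d + T) ^ (c * C + C) :=
      Nat.mul_le_mul (Nat.le_add_right _ _) (Nat.pow_le_pow_right (by omega) (Nat.le_add_left _ _))

end CoTBoosting

end

/-! ### The main theorem -/

theorem mainTheorem1 :
    ∃ c : ℕ,
      -- active and adaptive protocol, per-thinker budget proportional to the end-to-end VC dimension
      (∀ (F : Set CoTBoosting.Thinker) (T : ℕ) (X : Set CoTBoosting.Str) (v : ℕ), 1 ≤ T →
        CoTBoosting.vcDim (CoTBoosting.e2eClass F T) X = v →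
        ∀ (ε δ : ℝ), 0 < ε → ε < 1 → 0 < δ → δ < 1 →
        ∀ (m : ℕ) [NeZero m], CoTBoosting.sampleSize c v ε δ ≤ m →
        ∀ (D : PMF CoTBoosting.Str), D.support ⊆ X →
        ∀ hstar ∈ CoTBoosting.e2eClass F T,
        ∀ rule : CoTBoosting.CoTRule, rule.Consistent F T →
        ∀ adv : CoTBoosting.Adversary m, adv.Valid F X T hstar →
          CoTBoosting.Succeeds T D hstar m rule adv (c * v) ε δ) ∧
      -- polynomial running time for hierarchies with a tractable consistency oracle
      (∀ (F : ℕ → Set CoTBoosting.Thinker) (O : CoTBoosting.ConsistencyOracle F)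
        (vc : ℕ → ℕ → ℕ),
        (∀ d T, 1 ≤ T → CoTBoosting.vcDim (CoTBoosting.e2eClass (F d) T)
          (CoTBoosting.inputsUpTo d) = vc d T) →
        CoTBoosting.PolyBounded vc →
          CoTBoosting.RunsInPolyTime c O vc (fun d T => c * vc d T) ∧
          ∀ vl : ℕ → ℕ → ℕ,
            (∀ d T, 1 ≤ T → CoTBoosting.vcDim (CoTBoosting.cotLossClass (F d) T)
              (CoTBoosting.traceDomain (CoTBoosting.inputsUpTo d) T) = vl d T) →
            CoTBoosting.PolyBounded vl →
            CoTBoosting.RunsInPolyTime c O vc (fun d T => c * vl d T)) ∧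
      -- relaxed protocol, per-thinker budget proportional to the VC dimension of the loss class
      (∀ (F : Set CoTBoosting.Thinker) (T : ℕ) (X : Set CoTBoosting.Str) (v vl : ℕ), 1 ≤ T →
        CoTBoosting.vcDim (CoTBoosting.e2eClass F T) X = v →
        CoTBoosting.vcDim (CoTBoosting.cotLossClass F T) (CoTBoosting.traceDomain X T) = vl →
        ∀ (ε δ : ℝ), 0 < ε → ε < 1 → 0 < δ → δ < 1 →
        ∀ (m : ℕ) [NeZero m], CoTBoosting.sampleSize c v ε δ ≤ m →
        ∀ (D : PMF CoTBoosting.Str), D.support ⊆ X →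
        ∀ hstar ∈ CoTBoosting.e2eClass F T,
        ∀ rule : CoTBoosting.CoTRule, rule.Consistent F T →
        ∀ adv : CoTBoosting.Adversary m, adv.Valid F X T hstar → adv.Relaxed →
          CoTBoosting.Succeeds T D hstar m rule adv (c * vl) ε δ) ∧
      -- the VC dimension of the loss class
      (∀ (F : Set CoTBoosting.Thinker) (T : ℕ) (X : Set CoTBoosting.Str), 1 ≤ T →
        (F.Finite → ∃ vl : ℕ,
          CoTBoosting.vcDim (CoTBoosting.cotLossClass F T) (CoTBoosting.traceDomain X T) = vl ∧
          (vl : ℝ) ≤ c * Real.log F.ncard) ∧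
        (∀ vF : ℕ, CoTBoosting.vcDim F (CoTBoosting.prefixDomain X T) = vF → ∃ vl : ℕ,
          CoTBoosting.vcDim (CoTBoosting.cotLossClass F T) (CoTBoosting.traceDomain X T) = vl ∧
          (vl : ℝ) ≤ c * (vF * Real.log (T + 1)))) := by
  -- The number `2 ^ 30` is what `numerics` asks for, kept opaque behind an equation. The universal
  -- constant is `8 * c` because the weak learner draws `8 * c * v` examples for a double-sampling
  -- threshold of `c * v`.
  obtain ⟨c, hc⟩ : ∃ c : ℕ, c = 2 ^ 30 := ⟨_, rfl⟩
  refine ⟨8 * c, ?_, ?_, ?_, ?_⟩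
  · intro F T X v hT hv ε δ hε hε1 hδ hδ1 m _ hm D hD hstar hstarF rule hrule adv hadv
    exact CoTBoosting.succeeds_adaptive hT hc.ge hv hε hε1 hδ hδ1 hm hD hstarF hrule hadv
  · intro F O vc _ hvc
    exact ⟨CoTBoosting.runsInPolyTime (by omega) O hvc (hvc.const_mul _),
      fun vl _ hvl => CoTBoosting.runsInPolyTime (by omega) O hvc (hvl.const_mul _)⟩
  · intro F T X v vl hT hv hvl ε δ hε hε1 hδ hδ1 m _ hm D hD hstar hstarF rule hrule adv hadv hrel
    exact CoTBoosting.succeeds_relaxed hT hc.ge hv hvl hε hε1 hδ hδ1 hm hD hstarF hrule hadv hrel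
  · intro F T X hT
    have hc8 : (7 : ℝ) ≤ (8 * c : ℕ) := by exact_mod_cast (by omega : 7 ≤ 8 * c)
    refine ⟨fun hF => ?_, fun vF hvF => ?_⟩
    · obtain ⟨vl, h1, h2⟩ := CoTBoosting.exists_vcDim_cotLossClass_of_finite hF T
        (CoTBoosting.traceDomain X T)
      have hlog : 0 ≤ Real.log (F.ncard : ℝ) := Real.log_natCast_nonneg _
      exact ⟨vl, h1, h2.trans (mul_le_mul_of_nonneg_right (by linarith) hlog)⟩
    · obtain ⟨vl, h1, h2⟩ := CoTBoosting.exists_vcDim_cotLossClass hT hvF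
      have hlog : 0 ≤ Real.log ((T : ℝ) + 1) := Real.log_nonneg (by
        have := (Nat.cast_nonneg T : (0 : ℝ) ≤ T)
        linarith)
      exact ⟨vl, h1, h2.trans (mul_le_mul_of_nonneg_right hc8
        (mul_nonneg (Nat.cast_nonneg _) hlog))⟩
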